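/- **Elliptic functions.** Let $\tau\in\mathbb C$, $\operatorname{Im}\tau>0$, and let $\theta_1,\dots,\theta_4$ be the Jacobi theta functions with nome $e^{\pi i\tau}$, $\theta_i=\theta_i(0)$. Put $k^{1/2}=\theta_2/\theta_3$, $k'^{1/2}=\theta_4/\theta_3$, $K=\frac{\pi}{2}\theta_3^2$, $iK'=\tau K$, $\kappa=2K+iK'$, $H(u)=\theta_1(\pi u/2K)$, $\Theta(u)=\theta_4(\pi u/2K)$, $H_1(u)=H(u+K)$, $\Theta_1(u)=\Theta(u+K)$, and $$\mathrm{sn}=\frac{H}{k^{1/2}\Theta},\quad \mathrm{cn}=\frac{k'^{1/2}H_1}{k^{1/2}\Theta},\quad \mathrm{dn}=\frac{k'^{1/2}\Theta_1}{\Theta},\quad \mathrm{cd}=\frac{\mathrm{cn}}{\mathrm{dn}}$$ (Jacobian elliptic functions of modulus $k$). **Generators.** Consider variables $c_1,\dots,c_8,\eta,x,y$; write $c_{ij\cdots}=c_i+c_j+\cdots$ and $\lambda=\frac12\sum_{i=1}^8c_i$. A generator $w$ acts on functions by $w.F(c,\eta,x,y)=F(w(c),w(\eta),w(x),w(y))$,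 and $(w_1w_2).F=w_1.(w_2.F)$. Variables not mentioned are fixed: * $s_0:c_7\leftrightarrow c_8$; $s_1:\eta\mapsto-\eta,\ x\leftrightarrow y$; $s_j:c_{j-1}\leftrightarrow c_j$ ($3\le j\le7$); $s_8:c_1\leftrightarrow c_2$; * $s_2$, with $\mu=2\eta+c_1+c_2$: $\eta\mapsto\eta-\frac{\mu}{4}$, $c_i\mapsto c_i-\frac{3\mu}{4}$ ($i=1,2$), $c_i\mapsto c_i+\frac{\mu}{4}$ ($i\ge3$), and $$\frac{s_2(y)-\mathrm{cd}(2\eta-\frac{c_1-c_2}2)}{s_2(y)-\mathrm{cd}(2\eta+\frac{c_1-c_2}2)}\cdot\frac{x-\mathrm{cd}(\eta+c_1)}{x-\mathrm{cd}(\eta+c_2)}\cdot\frac{y-\mathrm{cd}(\eta-c_2)}{y-\mathrm{cd}(\eta-c_1)}=\frac{1-\frac{\mathrm{cd}(\eta-c_2)}{\mathrm{cd}(\eta)}}{1-\frac{\mathrm{cd}(\eta-c_1)}{\mathrm{cd}(\eta)}}\cdot\frac{1-\frac{\mathrm{cd}(\eta+c_1)}{\mathrm{cd}(\eta)}}{1-\frac{\mathrm{cd}(\eta+c_2)}{\mathrm{cd}(\eta)}}\cdot\frac{1-\frac{\mathrm{cd}(2\eta-\frac{c_1-c_2}2)}{\mathrm{cd}(\frac{c_1+c_2}2)}}{1-\frac{\mathrm{cd}(2\eta+\frac{c_1-c_2}2)}{\mathrm{cd}(\frac{c_1+c_2}2)}};$$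 * $\iota_1:(c_i,\eta,x)\mapsto(c_i-\frac{iK'}2,\eta-\frac{iK'}2,\frac1{kx})$, $\iota_2:(c_i,\eta,y)\mapsto(c_i-\frac{iK'}2,\eta+\frac{iK'}2,\frac1{ky})$, $\iota_3:(c_i,\eta,x)\mapsto(c_i-K,\eta-K,-x)$, $\iota_4:(c_i,\eta,y)\mapsto(c_i-K,\eta+K,-y)$. On the Picard lattice $\mathbb ZH_0\oplus\mathbb ZH_1\oplus\bigoplus_{i=1}^8\mathbb ZE_i$ with $(H_i|H_j)=1-\delta_{ij}$, $(H_i|E_j)=0$, $(E_i|E_j)=-\delta_{ij}$, the $\iota_j$ act trivially and $s_i$ acts as the reflection in $\alpha_i$, where $\alpha_1=H_1-H_0$, $\alpha_2=H_0-E_1-E_2$, $\alpha_i=E_{i-1}-E_i$ ($3\le i\le7$), $\alpha_8=E_1-E_2$, $\alpha_0=E_7-E_8$. Let $\delta=2H_0+2H_1-\sum E_i$. With $s_{i_1\cdots i_m}=s_{i_1}\cdots s_{i_m}$ put $$R=s_{56453483706756452348321\,56453483706756452348321706734830468}\,\iota_4\iota_3\iota_2\iota_1,\qquad T=R^2.$$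 "Generically" means: outside the zero set of some entire function of the variables in question that is not identically zero; this includes that all functions occurring are finite and all denominators nonzero there, at each step of the word. **Statement.** 1. *$R$ is not a translation.* On the roots, $R(\alpha_i)=-\alpha_i$ for $i\in\{0,3,4,6,7,8\}$, $R(\alpha_1)=-\alpha_0-\alpha_1-4\alpha_2-6\alpha_3-5\alpha_4-4\alpha_5-3\alpha_6-2\alpha_7-3\alpha_8$, $R(\alpha_2)=\alpha_2+2\alpha_3+\alpha_4+\alpha_8$, $R(\alpha_5)=\alpha_0+\alpha_1+2\alpha_2+4\alpha_3+4\alpha_4+3\alpha_5+3\alpha_6+2\alpha_7+2\alpha_8$; so $R$ is not of the form $\alpha_i\mapsto\alpha_i+m_i\delta$. On the parameters, $$R(c_i)=-c_i+\tfrac{c_{1234}-c_{5678}}4-\kappa\ (i\le4),\quad R(c_j)=-c_j+\tfrac{c_{1234}+3c_{5678}}4-\kappa\ (j\ge5),\quad R(\eta)=\eta+\tfrac\lambda2,$$ and $R$ does not shift all the parameters by functions of $\lambda$ alone. 2. *Half-translation.* Let $c_2=c_1+2K$, $c_3=c_1+iK'$, $c_4=c_1+\kappa$, $c_6=c_5+2K$,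 $c_7=c_5+iK'$, $c_8=c_5+\kappa$, and $z_0=\eta+c_5+\kappa$, $\gamma_e=c_5-\eta+\kappa$, $\gamma_o=\eta+c_1+\kappa$. Then $R:(\gamma_e,\gamma_o,z_0)\mapsto(\gamma_e,\gamma_o,z_0+2(\gamma_e+\gamma_o)-2\kappa)$, and the images of the $c_i$ satisfy the same relations up to periods (the constants $2K,iK',\kappa$ are replaced by $2K-4K$, $iK'-2iK'$, $\kappa-2\kappa$). For every $n\ge0$, generically in $(c_1,c_5,\eta,x,y)$, the step from $(R^n(x),R^n(y))$ to $(R^{n+1}(x),R^{n+1}(y))$ is the step $(x,y)\mapsto(\tilde x,\tilde y)$ of $$\tilde y=\frac{(1-k^2\mathrm{sz}^4)\mathrm{cg_e}\mathrm{dg_e}xy-(\mathrm{cg_e}^2-\mathrm{cz}^2)\mathrm{cz}\,\mathrm{dz}-(1-k^2\mathrm{sg_e}^2\mathrm{sz}^2)\mathrm{cz}\,\mathrm{dz}\,x^2}{k^2(\mathrm{cg_e}^2-\mathrm{cz}^2)\mathrm{cz}\,\mathrm{dz}\,x^2y-(1-k^2\mathrm{sz}^4)\mathrm{cg_e}\mathrm{dg_e}x+(1-k^2\mathrm{sg_e}^2\mathrm{sz}^2)\mathrm{cz}\,\mathrm{dz}\,y},$$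 $$\tilde x=\frac{(1-k^2\widehat{\mathrm{sz}}^4)\mathrm{cg_o}\mathrm{dg_o}\tilde yx-(\mathrm{cg_o}^2-\widehat{\mathrm{cz}}^2)\widehat{\mathrm{cz}}\,\widehat{\mathrm{dz}}-(1-k^2\mathrm{sg_o}^2\widehat{\mathrm{sz}}^2)\widehat{\mathrm{cz}}\,\widehat{\mathrm{dz}}\,\tilde y^2}{k^2(\mathrm{cg_o}^2-\widehat{\mathrm{cz}}^2)\widehat{\mathrm{cz}}\,\widehat{\mathrm{dz}}\,\tilde y^2x-(1-k^2\widehat{\mathrm{sz}}^4)\mathrm{cg_o}\mathrm{dg_o}\tilde y+(1-k^2\mathrm{sg_o}^2\widehat{\mathrm{sz}}^2)\widehat{\mathrm{cz}}\,\widehat{\mathrm{dz}}\,x}\qquad(\ast)$$ at independent variable $z=z_0+2n(\gamma_e+\gamma_o)$, where $\mathrm{sz},\mathrm{cz},\mathrm{dz}$ are $\mathrm{sn},\mathrm{cn},\mathrm{dn}$ at $z$, the hatted ones those at $z+\gamma_e+\gamma_o$, and $\mathrm{sg_e},\mathrm{cg_e},\mathrm{dg_e}$ ($\mathrm{sg_o},\mathrm{cg_o},\mathrm{dg_o}$)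 those at $\gamma_e$ ($\gamma_o$). 3. *$T$ is a translation and gives the 8-parameter equation.* $T(\alpha_1)=\alpha_1-2\delta$, $T(\alpha_5)=\alpha_5+\delta$, the other $\alpha_i$ are fixed; on the whole Picard lattice $T(v)=v+(\delta|v)\beta-\big(\frac{(\beta|\beta)(\delta|v)}2+(\beta|v)\big)\delta$ with $\beta=2H_0-E_5-E_6-E_7-E_8$; and $$T:(c_i,c_{i+4},\eta)\mapsto(c_i-\lambda,\ c_{i+4}+\lambda-4\kappa,\ \eta+\lambda-2\kappa),\quad i=1,\dots,4,$$ where $\lambda$ is invariant under $s_0,\dots,s_8$. Generically in $(c,\eta,x,y)$, the values $\tilde x=R(x)$, $\tilde y=R(y)$, $\bar x=T(x)$, $\bar y=T(y)$ are the unique solution of $$\frac{k\,\mathrm{cd}(\eta+c_8-\frac{c_{5678}}2)\tilde y+1}{k\,\mathrm{cd}(\eta+c_7-\frac{c_{5678}}2)\tilde y+1}\cdot\frac{x-\mathrm{cd}(\eta+c_7)}{x-\mathrm{cd}(\eta+c_8)}=\Phi(c_5,c_6,c_7,c_8,\eta;x,y),$$ $$\frac{k\,\mathrm{cd}(\eta-c_4+\frac{c_{1234}}2)\tilde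 x+1}{k\,\mathrm{cd}(\eta-c_3+\frac{c_{1234}}2)\tilde x+1}\cdot\frac{k\,\mathrm{cd}(\eta+c_3+\frac{c_{5678}}2)\tilde y+1}{k\,\mathrm{cd}(\eta+c_4+\frac{c_{5678}}2)\tilde y+1}=\Phi\big(r_1,r_2,r_3,r_4,\tfrac{c_{5678}}4;\tfrac{-1}{k\tilde y},x\big),\quad r_i=\eta+c_i+\tfrac{c_{5678}}4,$$ $$\frac{k\,\mathrm{cd}(\eta-c_8+\kappa)\bar y+1}{k\,\mathrm{cd}(\eta-c_7+\kappa)\bar y+1}\cdot\frac{\tilde x-\mathrm{cd}(\eta-c_7+\frac{c_{5678}}2+\lambda+\kappa)}{\tilde x-\mathrm{cd}(\eta-c_8+\frac{c_{5678}}2+\lambda+\kappa)}=\Phi\big(t_5,t_6,t_7,t_8,\eta+\tfrac\lambda2+\kappa;\tilde x,\tilde y\big),\quad t_j=\tfrac{c_{5678}-2c_j+\lambda}2,$$ $$\frac{k\,\mathrm{cd}(\eta+c_4+\kappa)\bar x+1}{k\,\mathrm{cd}(\eta+c_3+\kappa)\bar x+1}\cdot\frac{k\,\mathrm{cd}(\eta-c_3+2\lambda+\kappa)\bar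 y+1}{k\,\mathrm{cd}(\eta-c_4+2\lambda+\kappa)\bar y+1}=\Phi\big(v_1,v_2,v_3,v_4,\tfrac{c_{5678}+2\lambda}4+\kappa;\tfrac{-1}{k\bar y},\tilde x\big),\quad v_i=\eta-c_i+\tfrac{c_{1234}}4+\lambda.$$ Here $\Phi(a_1,a_2,a_3,a_4,b;X,Y)=G\cdot\dfrac{P(a_1,a_2,a_3,b;X,Y)}{P(a_1,a_2,a_4,b;X,Y)}$ and, with $h=\frac{a_1+a_2}2$, $S=\frac{a_1+a_2+a_3+a_4}2$, $p_i=\mathrm{cd}(b+a_i)$, $m_i=\mathrm{cd}(b-a_i)$, $$G=\frac{1-\frac{\mathrm{cd}(a_4+h)}{\mathrm{cd}(a_2+h)}}{1-\frac{\mathrm{cd}(a_3+h)}{\mathrm{cd}(a_2+h)}}\cdot\frac{1-\frac{\mathrm{cd}(b-a_4)}{\mathrm{cd}(b-a_1)}}{1-\frac{\mathrm{cd}(b-a_3)}{\mathrm{cd}(b-a_1)}}\cdot\frac{1-\frac{\mathrm{cd}(b+a_4-S)}{\mathrm{cd}(b+a_2+S)}}{1-\frac{\mathrm{cd}(b+a_3-S)}{\mathrm{cd}(b+a_2+S)}}\cdot\frac{1-\frac{\mathrm{cd}(a_3+h)}{\mathrm{cd}(2b+a_2-h)}}{1-\frac{\mathrm{cd}(a_4+h)}{\mathrm{cd}(2b+a_2-h)}},$$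 $$\begin{aligned}P(a_1,a_2,a_3,b;X,Y)=\;&[(m_3-m_2)p_1+(m_1-m_3)p_2+(m_2-m_1)p_3]XY\\&+[(m_2-m_3)m_1p_1+(m_3-m_1)m_2p_2+(m_1-m_2)m_3p_3]X\\&+[(p_3-p_2)m_1p_1+(p_1-p_3)m_2p_2+(p_2-p_1)m_3p_3]Y\\&+(p_2m_3-m_2p_3)m_1p_1+(p_3m_1-m_3p_1)m_2p_2+(p_1m_2-m_1p_2)m_3p_3.\end{aligned}$$ 4. *Projective reduction.* $T$ maps the special parameters of part 2 to special parameters. For special parameters, generically in $(c_1,c_5,\eta,x,y)$, the system of part 3 holds for $(\tilde x,\tilde y,\bar x,\bar y)$ if and only if $(x,y)\mapsto(\tilde x,\tilde y)$ is the step of $(\ast)$ at $z_0$ and $(\tilde x,\tilde y)\mapsto(\bar x,\bar y)$ is the step of $(\ast)$ at $z_0+2(\gamma_e+\gamma_o)$. -/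

import Mathlib

noncomputable section

namespace EllipticPainleve

/-! ### Picard lattice, reflections and Kac translations -/

/-- The Picard lattice `ℤ H₀ ⊕ ℤ H₁ ⊕ ℤ E₁ ⊕ … ⊕ ℤ E₈` of the blow-up of `ℙ¹ × ℙ¹` at eight points.
The first component holds the coefficients of `H₀, H₁`; the second one those of `E₁, …, E₈`,
the coefficient of `Eᵢ` having index `i - 1`. -/
abbrev Pic : Type := (Fin 2 → ℤ) × (Fin 8 → ℤ)

/-- The classes `H₀`, `H₁`. -/
def picH (i : Fin 2) : Pic := (Pi.single i 1, 0)

/-- The class of the exceptional divisor `E_{i+1}`. -/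
def picE (i : Fin 8) : Pic := (0, Pi.single i 1)

/-- The intersection form: `(Hᵢ|Hⱼ) = 1 - δᵢⱼ`, `(Hᵢ|Eⱼ) = 0`, `(Eᵢ|Eⱼ) = -δᵢⱼ`. -/
def picForm (v w : Pic) : ℤ :=
  v.1 0 * w.1 1 + v.1 1 * w.1 0 - ∑ i, v.2 i * w.2 i

/-- The anti-canonical class `δ = 2H₀ + 2H₁ - E₁ - … - E₈`. -/
def picDelta : Pic := 2 • picH 0 + 2 • picH 1 - ∑ i, picE i

/-- The simple roots `α₀, …, α₈` of type `E₈⁽¹⁾`. -/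
def simpleRoot : Fin 9 → Pic :=
  ![picE 6 - picE 7,
    picH 1 - picH 0,
    picH 0 - picE 0 - picE 1,
    picE 1 - picE 2,
    picE 2 - picE 3,
    picE 3 - picE 4,
    picE 4 - picE 5,
    picE 5 - picE 6,
    picE 0 - picE 1]

theorem picForm_simpleRoot_self (i : Fin 9) : picForm (simpleRoot i) (simpleRoot i) = -2 := by
  fin_cases i <;> decide

/-- The reflection `v ↦ v - (2 (v|αᵢ) / (αᵢ|αᵢ)) αᵢ`, written out with `(αᵢ|αᵢ) = -2`. -/
def picReflection (i : Fin 9) (v : Pic) : Pic :=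
  v + picForm v (simpleRoot i) • simpleRoot i

/-- The Kac translation
`v ↦ v + (δ|v) β - ((β|β)(δ|v)/2 + (β|v)) δ`, for `β` orthogonal to `δ`
(then `(β|β)` is even, so that the division is exact). -/
def kacTranslation (β v : Pic) : Pic :=
  v + picForm picDelta v • β
    - ((picForm β β / 2) * picForm picDelta v + picForm β v) • picDelta

/-! ### Words in the generators of the extended affine Weyl group -/

/-- The generators: `s i` is `sᵢ` for `i = 0, …, 8`; `iota j` is `ι_{j+1}` for `j = 0, …, 3`. -/
inductive Gen : Type
  | s (i : Fin 9)
  | iota (j : Fin 4)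

/-- Linear action of a generator on the Picard lattice; the `ιⱼ` act trivially. -/
def Gen.picAct : Gen → Pic → Pic
  | .s i => picReflection i
  | .iota _ => id

/-- Linear action of a word `g₁ g₂ ⋯ gₘ`: `(g₁ ⋯ gₘ).v = g₁.(g₂.(⋯ (gₘ.v)))`. -/
def picAct (w : List Gen) (v : Pic) : Pic := w.foldr Gen.picAct v

/-- `R_J1 = s_{56453483706756452348321 56453483706756452348321706734830468} ι₄ ι₃ ι₂ ι₁`. -/
def RJ1 : List Gen :=
  ([5, 6, 4, 5, 3, 4, 8, 3, 7, 0, 6, 7, 5, 6, 4, 5, 2, 3, 4, 8, 3, 2, 1,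
    5, 6, 4, 5, 3, 4, 8, 3, 7, 0, 6, 7, 5, 6, 4, 5, 2, 3, 4, 8, 3, 2, 1,
    7, 0, 6, 7, 3, 4, 8, 3, 0, 4, 6, 8] : List (Fin 9)).map Gen.s
  ++ [Gen.iota 3, Gen.iota 2, Gen.iota 1, Gen.iota 0]

/-- The word `R_J1ⁿ`. -/
def RJ1Pow (n : ℕ) : List Gen := (List.replicate n RJ1).flatten

/-- `T_J1 = R_J1²`. -/
def TJ1 : List Gen := RJ1Pow 2

/-- The matrix of `R_J1` on the simple roots `α₀, …, α₈`. -/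
def matrixRJ1 : Matrix (Fin 9) (Fin 9) ℤ :=
  !![-1, 0, 0, 0, 0, 0, 0, 0, 0;
     -1, -1, -4, -6, -5, -4, -3, -2, -3;
     0, 0, 1, 2, 1, 0, 0, 0, 1;
     0, 0, 0, -1, 0, 0, 0, 0, 0;
     0, 0, 0, 0, -1, 0, 0, 0, 0;
     1, 1, 2, 4, 4, 3, 3, 2, 2;
     0, 0, 0, 0, 0, 0, -1, 0, 0;
     0, 0, 0, 0, 0, 0, 0, -1, 0;
     0, 0, 0, 0, 0, 0, 0, 0, -1]

/-- A word acts on the root lattice as a translation when it moves every simple root by an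
integral multiple of `δ`. -/
def IsRootTranslation (w : List Gen) : Prop :=
  ∃ m : Fin 9 → ℤ, ∀ i, picAct w (simpleRoot i) = simpleRoot i + m i • picDelta

/-! ### Jacobi theta functions and Jacobian elliptic functions

Everything is parametrised by `τ = i K'/K` in the upper half plane, as in Whittaker and Watson:
the nome is `q = exp (π i τ)`, and with the theta constants `θ₂, θ₃, θ₄` one has
`k^{1/2} = θ₂/θ₃`, `k'^{1/2} = θ₄/θ₃`, `K = π θ₃²/2`, `i K' = τ K`. -/

/-- The complete elliptic integral `K = π θ₃(0)² / 2`. -/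
def ellK (τ : ℂ) : ℂ := Real.pi / 2 * (jacobiTheta₂ 0 τ) ^ 2

/-- `i K' = τ K`. -/
def ellIK' (τ : ℂ) : ℂ := τ * ellK τ

/-- `κ = 2K + i K'`. -/
def ellKappa (τ : ℂ) : ℂ := 2 * ellK τ + ellIK' τ

/-- Jacobi's eta function `H(u) = θ₁(π u / (2K))`, where
`θ₁(π v) = -i ∑ₙ (-1)ⁿ exp (π i τ (n + 1/2)² + (2n + 1) π i v)`. -/
def jacobiH (τ u : ℂ) : ℂ :=
  -Complex.I * Complex.exp (Real.pi * Complex.I * τ / 4 + Real.pi * Complex.I * (u / (2 * ellK τ)))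
    * jacobiTheta₂ (u / (2 * ellK τ) + 1 / 2 + τ / 2) τ

/-- Jacobi's theta function `Θ(u) = θ₄(π u / (2K))`, where
`θ₄(π v) = ∑ₙ (-1)ⁿ exp (π i τ n² + 2 n π i v)`. -/
def jacobiT (τ u : ℂ) : ℂ := jacobiTheta₂ (u / (2 * ellK τ) + 1 / 2) τ

/-- `H₁(u) = H(u + K)`. -/
def jacobiH1 (τ u : ℂ) : ℂ := jacobiH τ (u + ellK τ)

/-- `Θ₁(u) = Θ(u + K)`. -/
def jacobiT1 (τ u : ℂ) : ℂ := jacobiT τ (u + ellK τ)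

/-- `k^{1/2} = θ₂(0)/θ₃(0) = H₁(0)/Θ₁(0)`. -/
def sqrtModulus (τ : ℂ) : ℂ := jacobiH1 τ 0 / jacobiT1 τ 0

/-- `k'^{1/2} = θ₄(0)/θ₃(0) = Θ(0)/Θ₁(0)`. -/
def sqrtCoModulus (τ : ℂ) : ℂ := jacobiT τ 0 / jacobiT1 τ 0

/-- The modulus `k`. -/
def modulus (τ : ℂ) : ℂ := sqrtModulus τ ^ 2

def sn (τ u : ℂ) : ℂ := jacobiH τ u / (sqrtModulus τ * jacobiT τ u)

def cn (τ u : ℂ) : ℂ := sqrtCoModulus τ * jacobiH1 τ u / (sqrtModulus τ * jacobiT τ u)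

def dn (τ u : ℂ) : ℂ := sqrtCoModulus τ * jacobiT1 τ u / jacobiT τ u

/-- The meromorphic function `cd = cn/dn`, written so that the value is also the right one at the
common poles of `cn` and `dn`. -/
def cd (τ u : ℂ) : ℂ := jacobiH1 τ u / (sqrtModulus τ * jacobiT1 τ u)

theorem cd_eq_cn_div_dn (τ u : ℂ) (h : dn τ u ≠ 0) : cd τ u = cn τ u / dn τ u := by
  unfold dn at h
  have h1 : sqrtCoModulus τ ≠ 0 := by rintro h0; simp [h0] at h
  have h2 : jacobiT τ u ≠ 0 := by rintro h0; simp [h0] at h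
  have h3 : jacobiT1 τ u ≠ 0 := by rintro h0; simp [h0] at h
  unfold cd cn dn
  by_cases h4 : sqrtModulus τ = 0
  · simp [h4]
  · field_simp

/-- `u` is not a pole of `sn`, `cn`, `dn`. -/
def SnFinite (τ u : ℂ) : Prop := jacobiT τ u ≠ 0

/-- `u` is not a pole of `cd`. -/
def CdFinite (τ u : ℂ) : Prop := jacobiT1 τ u ≠ 0

/-! ### Birational actions -/

/-- A point `(c, η, x, y)`; the parameter `cᵢ` has index `i - 1`, for `i = 1, …, 8`. -/
abbrev State : Type := (Fin 8 → ℂ) × ℂ × ℂ × ℂ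

def cFun (i : Fin 8) (p : State) : ℂ := p.1 i
def etaFun (p : State) : ℂ := p.2.1
def xFun (p : State) : ℂ := p.2.2.1
def yFun (p : State) : ℂ := p.2.2.2

/-- `λ = (c₁ + ⋯ + c₈)/2`. -/
def lamFun (p : State) : ℂ := (∑ i, p.1 i) / 2

/-- The right-hand side of the equation that defines `s₂(y)`. -/
def s2Const (τ c1 c2 η : ℂ) : ℂ :=
  ((1 - cd τ (η - c2) / cd τ η) / (1 - cd τ (η - c1) / cd τ η))
  * ((1 - cd τ (η + c1) / cd τ η) / (1 - cd τ (η + c2) / cd τ η))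
  * ((1 - cd τ (2 * η - (c1 - c2) / 2) / cd τ ((c1 + c2) / 2))
      / (1 - cd τ (2 * η + (c1 - c2) / 2) / cd τ ((c1 + c2) / 2)))

/-- The value that the cross-ratio `(s₂(y) - A)/(s₂(y) - B)` must take, where
`A = cd (2η - (c₁ - c₂)/2)` and `B = cd (2η + (c₁ - c₂)/2)`. -/
def s2Ratio (τ c1 c2 η x y : ℂ) : ℂ :=
  s2Const τ c1 c2 η * ((x - cd τ (η + c2)) / (x - cd τ (η + c1)))
    * ((y - cd τ (η - c1)) / (y - cd τ (η - c2)))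

/-- `s₂(y)`: the solution `Y` of `(Y - A)/(Y - B) = s2Ratio`. -/
def s2y (τ c1 c2 η x y : ℂ) : ℂ :=
  (cd τ (2 * η - (c1 - c2) / 2) - s2Ratio τ c1 c2 η x y * cd τ (2 * η + (c1 - c2) / 2))
    / (1 - s2Ratio τ c1 c2 η x y)

/-- All functions in the definition of `s₂(y)` are finite and all denominators nonzero. -/
def S2Regular (τ c1 c2 η x y : ℂ) : Prop :=
  (∀ u ∈ [η, η - c1, η - c2, η + c1, η + c2, 2 * η - (c1 - c2) / 2, 2 * η + (c1 - c2) / 2,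
      (c1 + c2) / 2], CdFinite τ u)
  ∧ cd τ η ≠ 0 ∧ cd τ ((c1 + c2) / 2) ≠ 0
  ∧ 1 - cd τ (η - c1) / cd τ η ≠ 0
  ∧ 1 - cd τ (η + c2) / cd τ η ≠ 0
  ∧ 1 - cd τ (2 * η + (c1 - c2) / 2) / cd τ ((c1 + c2) / 2) ≠ 0
  ∧ x ≠ cd τ (η + c1) ∧ x ≠ cd τ (η + c2)
  ∧ y ≠ cd τ (η - c1) ∧ y ≠ cd τ (η - c2)
  ∧ cd τ (2 * η - (c1 - c2) / 2) ≠ cd τ (2 * η + (c1 - c2) / 2)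
  ∧ s2Ratio τ c1 c2 η x y ≠ 1

/-- At regular points, `Y = s₂(y)` is the unique solution of the defining equation. -/
theorem s2y_spec (τ c1 c2 η x y : ℂ) (h : S2Regular τ c1 c2 η x y) (Y : ℂ) :
    (Y ≠ cd τ (2 * η + (c1 - c2) / 2) ∧
      ((Y - cd τ (2 * η - (c1 - c2) / 2)) / (Y - cd τ (2 * η + (c1 - c2) / 2)))
        * ((x - cd τ (η + c1)) / (x - cd τ (η + c2)))
        * ((y - cd τ (η - c2)) / (y - cd τ (η - c1))) = s2Const τ c1 c2 η)
      ↔ Y = s2y τ c1 c2 η x y := by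
  obtain ⟨-, -, -, -, -, -, hx1, hx2, hy1, hy2, hAB, hM⟩ := h
  have hM' : s2Ratio τ c1 c2 η x y = s2Const τ c1 c2 η
    * ((x - cd τ (η + c2)) / (x - cd τ (η + c1)))
    * ((y - cd τ (η - c1)) / (y - cd τ (η - c2))) := rfl
  unfold s2y
  generalize s2Ratio τ c1 c2 η x y = M at *
  generalize s2Const τ c1 c2 η = G at *
  generalize cd τ (2 * η - (c1 - c2) / 2) = A at *
  generalize cd τ (2 * η + (c1 - c2) / 2) = B at *
  rw [← sub_ne_zero] at hx1 hx2 hy1 hy2 hAB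
  have hM1 : 1 - M ≠ 0 := sub_ne_zero.2 (Ne.symm hM)
  generalize x - cd τ (η + c1) = a at *
  generalize x - cd τ (η + c2) = b at *
  generalize y - cd τ (η - c1) = d at *
  generalize y - cd τ (η - c2) = e at *
  have key : ∀ r : ℂ, r * (a / b) * (e / d) = G ↔ r = M := by
    intro r
    rw [hM']
    constructor
    · rintro rfl
      field_simp
    · rintro rfl
      field_simp
  rw [key]
  constructor
  · rintro ⟨hY, h⟩
    rw [div_eq_iff (sub_ne_zero.2 hY)] at h
    rw [eq_div_iff hM1]
    linear_combination h
  · rintro rfl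
    have e1 : (A - M * B) / (1 - M) - B = (A - B) / (1 - M) := by field_simp; ring
    have e2 : (A - M * B) / (1 - M) - A = M * (A - B) / (1 - M) := by field_simp; ring
    refine ⟨?_, ?_⟩
    · rw [← sub_ne_zero, e1]
      exact div_ne_zero hAB hM1
    · rw [e1, e2]
      field_simp

/-- Interchange of the parameters with indices `a` and `b`. -/
def swapParam (a b : Fin 8) (p : State) : State := (p.1 ∘ Equiv.swap a b, p.2)

/-- The tuple `(g(c₁), …, g(c₈), g(η), g(x), g(y))` of the images of the coordinates under the
generator `g`, as functions of the coordinates. -/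
def Gen.image (τ : ℂ) : Gen → State → State
  | .s 0, p => swapParam 6 7 p
  | .s 1, (c, η, x, y) => (c, -η, y, x)
  | .s 2, (c, η, x, y) =>
      (fun i => if i = 0 ∨ i = 1 then c i - 3 * (2 * η + c 0 + c 1) / 4
          else c i + (2 * η + c 0 + c 1) / 4,
        η - (2 * η + c 0 + c 1) / 4, x, s2y τ (c 0) (c 1) η x y)
  | .s 3, p => swapParam 1 2 p
  | .s 4, p => swapParam 2 3 p
  | .s 5, p => swapParam 3 4 p
  | .s 6, p => swapParam 4 5 p
  | .s 7, p => swapParam 5 6 p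
  | .s 8, p => swapParam 0 1 p
  | .iota 0, (c, η, x, y) =>
      (fun i => c i - ellIK' τ / 2, η - ellIK' τ / 2, 1 / (modulus τ * x), y)
  | .iota 1, (c, η, x, y) =>
      (fun i => c i - ellIK' τ / 2, η + ellIK' τ / 2, x, 1 / (modulus τ * y))
  | .iota 2, (c, η, x, y) => (fun i => c i - ellK τ, η - ellK τ, -x, y)
  | .iota 3, (c, η, x, y) => (fun i => c i - ellK τ, η + ellK τ, x, -y)

/-- The images of the coordinates under the generator are given at the point by formulas without
vanishing denominators or poles. -/
def Gen.Regular (τ : ℂ) : Gen → State → Prop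
  | .s 2, (c, η, x, y) => S2Regular τ (c 0) (c 1) η x y
  | .iota 0, (_, _, x, _) => x ≠ 0
  | .iota 1, (_, _, _, y) => y ≠ 0
  | _, _ => True

/-- Action of a generator on functions: `g.F = F(g.c, g.η, g.x, g.y)`. -/
def Gen.act (τ : ℂ) (g : Gen) (F : State → ℂ) : State → ℂ := fun p => F (g.image τ p)

/-- Action of a word on functions: `(g₁ ⋯ gₘ).F = g₁.(g₂.(⋯ (gₘ.F)))`. -/
def act (τ : ℂ) (w : List Gen) (F : State → ℂ) : State → ℂ := w.foldr (Gen.act τ) F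

/-- All formulas that are used in the evaluation at the point of `w.F`, for coordinate functions
`F`, are regular. Since `(g w).F` takes at `p` the value of `w.F` at `g.image p`, the first letter
is used at `p`, the next one at its image, and so on. -/
def WordRegular (τ : ℂ) : List Gen → State → Prop
  | [], _ => True
  | g :: w, p => g.Regular τ p ∧ WordRegular τ w (g.image τ p)

/-- A word acts on the parameters as a translation when it adds to every parameter a function
of the invariant `λ` alone. -/
def IsParamTranslation (τ : ℂ) (w : List Gen) : Prop :=
  ∃ (f : Fin 8 → ℂ → ℂ) (g : ℂ → ℂ), ∀ p : State,
    (∀ i, act τ w (cFun i) p = cFun i p + f i (lamFun p)) ∧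
    act τ w etaFun p = etaFun p + g (lamFun p)

/-- A property holds generically: outside the zero set of an entire function which does not vanish
identically. -/
def Generically {E : Type} [NormedAddCommGroup E] [NormedSpace ℂ E] (P : E → Prop) : Prop :=
  ∃ F : E → ℂ, AnalyticOnNhd ℂ F Set.univ ∧ (∃ p, F p ≠ 0) ∧ ∀ p, F p ≠ 0 → P p

/-! ### The 8-parameter elliptic Painlevé equation -/

def gG (τ a1 a2 a3 a4 b : ℂ) : ℂ :=
  ((1 - cd τ (a4 + (a1 + a2) / 2) / cd τ (a2 + (a1 + a2) / 2))
    / (1 - cd τ (a3 + (a1 + a2) / 2) / cd τ (a2 + (a1 + a2) / 2)))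
  * ((1 - cd τ (b - a4) / cd τ (b - a1)) / (1 - cd τ (b - a3) / cd τ (b - a1)))
  * ((1 - cd τ (b + a4 - (a1 + a2 + a3 + a4) / 2) / cd τ (b + a2 + (a1 + a2 + a3 + a4) / 2))
    / (1 - cd τ (b + a3 - (a1 + a2 + a3 + a4) / 2) / cd τ (b + a2 + (a1 + a2 + a3 + a4) / 2)))
  * ((1 - cd τ (a3 + (a1 + a2) / 2) / cd τ (2 * b + a2 - (a1 + a2) / 2))
    / (1 - cd τ (a4 + (a1 + a2) / 2) / cd τ (2 * b + a2 - (a1 + a2) / 2)))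

/-- All functions in `gG` are finite and all denominators nonzero. -/
def GRegular (τ a1 a2 a3 a4 b : ℂ) : Prop :=
  (∀ u ∈ [a2 + (a1 + a2) / 2, a3 + (a1 + a2) / 2, a4 + (a1 + a2) / 2, b - a1, b - a3, b - a4,
      b + a2 + (a1 + a2 + a3 + a4) / 2, b + a3 - (a1 + a2 + a3 + a4) / 2,
      b + a4 - (a1 + a2 + a3 + a4) / 2, 2 * b + a2 - (a1 + a2) / 2], CdFinite τ u)
  ∧ cd τ (a2 + (a1 + a2) / 2) ≠ 0 ∧ cd τ (b - a1) ≠ 0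
  ∧ cd τ (b + a2 + (a1 + a2 + a3 + a4) / 2) ≠ 0
  ∧ cd τ (2 * b + a2 - (a1 + a2) / 2) ≠ 0
  ∧ 1 - cd τ (a3 + (a1 + a2) / 2) / cd τ (a2 + (a1 + a2) / 2) ≠ 0
  ∧ 1 - cd τ (b - a3) / cd τ (b - a1) ≠ 0
  ∧ 1 - cd τ (b + a3 - (a1 + a2 + a3 + a4) / 2) / cd τ (b + a2 + (a1 + a2 + a3 + a4) / 2) ≠ 0
  ∧ 1 - cd τ (a4 + (a1 + a2) / 2) / cd τ (2 * b + a2 - (a1 + a2) / 2) ≠ 0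

/-- `P(a₁, a₂, a₃, b; X, Y) = C₁ X Y + C₂ X + C₃ Y + C₄`. -/
def pP (τ a1 a2 a3 b X Y : ℂ) : ℂ :=
  ((cd τ (b - a3) - cd τ (b - a2)) * cd τ (b + a1)
    + (cd τ (b - a1) - cd τ (b - a3)) * cd τ (b + a2)
    + (cd τ (b - a2) - cd τ (b - a1)) * cd τ (b + a3)) * X * Y
  + ((cd τ (b - a2) - cd τ (b - a3)) * cd τ (b - a1) * cd τ (b + a1)
    + (cd τ (b - a3) - cd τ (b - a1)) * cd τ (b - a2) * cd τ (b + a2)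
    + (cd τ (b - a1) - cd τ (b - a2)) * cd τ (b - a3) * cd τ (b + a3)) * X
  + ((cd τ (b + a3) - cd τ (b + a2)) * cd τ (b - a1) * cd τ (b + a1)
    + (cd τ (b + a1) - cd τ (b + a3)) * cd τ (b - a2) * cd τ (b + a2)
    + (cd τ (b + a2) - cd τ (b + a1)) * cd τ (b - a3) * cd τ (b + a3)) * Y
  + ((cd τ (b + a2) * cd τ (b - a3) - cd τ (b - a2) * cd τ (b + a3))
      * cd τ (b - a1) * cd τ (b + a1)
    + (cd τ (b + a3) * cd τ (b - a1) - cd τ (b - a3) * cd τ (b + a1))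
      * cd τ (b - a2) * cd τ (b + a2)
    + (cd τ (b + a1) * cd τ (b - a2) - cd τ (b - a1) * cd τ (b + a2))
      * cd τ (b - a3) * cd τ (b + a3))

/-- The expression `G(a₁,a₂,a₃,a₄,b) P(a₁,a₂,a₃,b;X,Y) / P(a₁,a₂,a₄,b;X,Y)`. -/
def gP (τ a1 a2 a3 a4 b X Y : ℂ) : ℂ :=
  gG τ a1 a2 a3 a4 b * (pP τ a1 a2 a3 b X Y / pP τ a1 a2 a4 b X Y)

/-- All functions in `gP` are finite and all denominators nonzero. -/
def GPRegular (τ a1 a2 a3 a4 b X Y : ℂ) : Prop :=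
  GRegular τ a1 a2 a3 a4 b
  ∧ (∀ a ∈ [a1, a2, a3, a4], CdFinite τ (b - a) ∧ CdFinite τ (b + a))
  ∧ pP τ a1 a2 a4 b X Y ≠ 0

/-- `(k cd(u) Y + 1) / (k cd(v) Y + 1)`. -/
def mQ (τ u v Y : ℂ) : ℂ :=
  (modulus τ * cd τ u * Y + 1) / (modulus τ * cd τ v * Y + 1)

def MQRegular (τ u v Y : ℂ) : Prop :=
  CdFinite τ u ∧ CdFinite τ v ∧ modulus τ * cd τ v * Y + 1 ≠ 0

/-- `(X - cd(u)) / (X - cd(v))`. -/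
def lQ (τ u v X : ℂ) : ℂ := (X - cd τ u) / (X - cd τ v)

def LQRegular (τ u v X : ℂ) : Prop :=
  CdFinite τ u ∧ CdFinite τ v ∧ X - cd τ v ≠ 0

/-- The pair of equations which determines `(x̃, ỹ) = (xt, yt)` from `(x, y)`, with the condition
that all functions are finite and all denominators nonzero. -/
def HalfStepEquation (τ : ℂ) (c : Fin 8 → ℂ) (η x y xt yt : ℂ) : Prop :=
  let k := modulus τ
  let A := c 0 + c 1 + c 2 + c 3
  let B := c 4 + c 5 + c 6 + c 7
  (MQRegular τ (η + c 7 - B / 2) (η + c 6 - B / 2) yt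
    ∧ LQRegular τ (η + c 6) (η + c 7) x
    ∧ GPRegular τ (c 4) (c 5) (c 6) (c 7) η x y
    ∧ mQ τ (η + c 7 - B / 2) (η + c 6 - B / 2) yt * lQ τ (η + c 6) (η + c 7) x
      = gP τ (c 4) (c 5) (c 6) (c 7) η x y)
  ∧ (yt ≠ 0
    ∧ MQRegular τ (η - c 3 + A / 2) (η - c 2 + A / 2) xt
    ∧ MQRegular τ (η + c 2 + B / 2) (η + c 3 + B / 2) yt
    ∧ GPRegular τ (η + c 0 + B / 4) (η + c 1 + B / 4) (η + c 2 + B / 4) (η + c 3 + B / 4) (B / 4)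
        (-1 / (k * yt)) x
    ∧ mQ τ (η - c 3 + A / 2) (η - c 2 + A / 2) xt * mQ τ (η + c 2 + B / 2) (η + c 3 + B / 2) yt
      = gP τ (η + c 0 + B / 4) (η + c 1 + B / 4) (η + c 2 + B / 4) (η + c 3 + B / 4) (B / 4)
          (-1 / (k * yt)) x)

/-- The pair of equations which determines `(x̄, ȳ) = (xb, yb)` from `(x̃, ỹ) = (xt, yt)`, with
the condition that all functions are finite and all denominators nonzero. -/
def FullStepEquation (τ : ℂ) (c : Fin 8 → ℂ) (η xt yt xb yb : ℂ) : Prop :=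
  let k := modulus τ
  let κ := ellKappa τ
  let A := c 0 + c 1 + c 2 + c 3
  let B := c 4 + c 5 + c 6 + c 7
  let l := (A + B) / 2
  (MQRegular τ (η - c 7 + κ) (η - c 6 + κ) yb
    ∧ LQRegular τ (η - c 6 + B / 2 + l + κ) (η - c 7 + B / 2 + l + κ) xt
    ∧ GPRegular τ ((B - 2 * c 4 + l) / 2) ((B - 2 * c 5 + l) / 2) ((B - 2 * c 6 + l) / 2)
        ((B - 2 * c 7 + l) / 2) (η + l / 2 + κ) xt yt
    ∧ mQ τ (η - c 7 + κ) (η - c 6 + κ) yb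
        * lQ τ (η - c 6 + B / 2 + l + κ) (η - c 7 + B / 2 + l + κ) xt
      = gP τ ((B - 2 * c 4 + l) / 2) ((B - 2 * c 5 + l) / 2) ((B - 2 * c 6 + l) / 2)
          ((B - 2 * c 7 + l) / 2) (η + l / 2 + κ) xt yt)
  ∧ (yb ≠ 0
    ∧ MQRegular τ (η + c 3 + κ) (η + c 2 + κ) xb
    ∧ MQRegular τ (η - c 2 + 2 * l + κ) (η - c 3 + 2 * l + κ) yb
    ∧ GPRegular τ (η - c 0 + A / 4 + l) (η - c 1 + A / 4 + l) (η - c 2 + A / 4 + l)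
        (η - c 3 + A / 4 + l) ((B + 2 * l) / 4 + κ) (-1 / (k * yb)) xt
    ∧ mQ τ (η + c 3 + κ) (η + c 2 + κ) xb * mQ τ (η - c 2 + 2 * l + κ) (η - c 3 + 2 * l + κ) yb
      = gP τ (η - c 0 + A / 4 + l) (η - c 1 + A / 4 + l) (η - c 2 + A / 4 + l)
          (η - c 3 + A / 4 + l) ((B + 2 * l) / 4 + κ) (-1 / (k * yb)) xt)

/-- The 8-parameter elliptic Painlevé equation at the point `p = (c, η, x, y)`: the system of four
equations for `(x̃, ỹ)` and `(x̄, ȳ)`. -/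
def EllipticPainleveEquation (τ : ℂ) (p : State) (xt yt xb yb : ℂ) : Prop :=
  HalfStepEquation τ p.1 (etaFun p) (xFun p) (yFun p) xt yt
    ∧ FullStepEquation τ p.1 (etaFun p) xt yt xb yb

/-! ### The reduced equation and the specialization -/

/-- Numerator of the right-hand side of each half of the reduced equation, as a function of the
values `s, c, d` of `sn, cn, dn` at the independent variable, the values `sg, cg, dg` at `γ`, and of
`X, Y`. -/
def rcgNum (k s c d sg cg dg X Y : ℂ) : ℂ :=
  (1 - k ^ 2 * s ^ 4) * cg * dg * X * Y - (cg ^ 2 - c ^ 2) * c * d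
    - (1 - k ^ 2 * sg ^ 2 * s ^ 2) * c * d * X ^ 2

def rcgDen (k s c d sg cg dg X Y : ℂ) : ℂ :=
  k ^ 2 * (cg ^ 2 - c ^ 2) * c * d * X ^ 2 * Y - (1 - k ^ 2 * s ^ 4) * cg * dg * X
    + (1 - k ^ 2 * sg ^ 2 * s ^ 2) * c * d * Y

/-- One half of the reduced equation, `Z = rcgNum / rcgDen` at independent variable `z` and
parameter `γ`, with the condition that all functions are finite and the denominator nonzero. -/
def RCGHalf (τ z γ X Y Z : ℂ) : Prop :=
  SnFinite τ z ∧ SnFinite τ γ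
  ∧ rcgDen (modulus τ) (sn τ z) (cn τ z) (dn τ z) (sn τ γ) (cn τ γ) (dn τ γ) X Y ≠ 0
  ∧ Z = rcgNum (modulus τ) (sn τ z) (cn τ z) (dn τ z) (sn τ γ) (cn τ γ) (dn τ γ) X Y
      / rcgDen (modulus τ) (sn τ z) (cn τ z) (dn τ z) (sn τ γ) (cn τ γ) (dn τ γ) X Y

/-- The reduced elliptic difference equation `(x, y) ↦ (x̃, ỹ) = (xt, yt)` at `z₀`. -/
def RCGEquation (τ γe γo z0 x y xt yt : ℂ) : Prop :=
  RCGHalf τ z0 γe x y yt ∧ RCGHalf τ (z0 + γe + γo) γo yt x xt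

/-- The special values of the parameters: `c₂ = c₁ + 2K`, `c₃ = c₁ + iK'`, `c₄ = c₁ + κ`,
`c₆ = c₅ + 2K`, `c₇ = c₅ + iK'`, `c₈ = c₅ + κ`. -/
def RCGCondition (τ : ℂ) (p : State) : Prop :=
  cFun 1 p = cFun 0 p + 2 * ellK τ ∧ cFun 2 p = cFun 0 p + ellIK' τ
  ∧ cFun 3 p = cFun 0 p + ellKappa τ
  ∧ cFun 5 p = cFun 4 p + 2 * ellK τ ∧ cFun 6 p = cFun 4 p + ellIK' τ
  ∧ cFun 7 p = cFun 4 p + ellKappa τ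

/-- The point with special parameters and coordinates `q = (c₁, c₅, η, x, y)`. -/
def specialState (τ : ℂ) (q : ℂ × ℂ × ℂ × ℂ × ℂ) : State :=
  (![q.1, q.1 + 2 * ellK τ, q.1 + ellIK' τ, q.1 + ellKappa τ,
     q.2.1, q.2.1 + 2 * ellK τ, q.2.1 + ellIK' τ, q.2.1 + ellKappa τ], q.2.2)

theorem rcgCondition_iff (τ : ℂ) (p : State) :
    RCGCondition τ p ↔ ∃ q, p = specialState τ q := by
  constructor
  · rintro ⟨h1, h2, h3, h4, h5, h6⟩
    refine ⟨(p.1 0, p.1 4, p.2), Prod.ext (funext fun i => ?_) rfl⟩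
    fin_cases i
    exacts [rfl, h1, h2, h3, rfl, h4, h5, h6]
  · rintro ⟨q, rfl⟩
    exact ⟨rfl, rfl, rfl, rfl, rfl, rfl⟩

/-- `z₀ = η + c₅ + κ`. -/
def z0Fun (τ : ℂ) (p : State) : ℂ := etaFun p + cFun 4 p + ellKappa τ

/-- `γₑ = c₅ - η + κ`. -/
def gammaE (τ : ℂ) (p : State) : ℂ := cFun 4 p - etaFun p + ellKappa τ

/-- `γₒ = η + c₁ + κ`. -/
def gammaO (τ : ℂ) (p : State) : ℂ := etaFun p + cFun 0 p + ellKappa τ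

end EllipticPainleve

end

open EllipticPainleve

namespace EllipticPainleve

open Complex

/-! ### Product formula for theta functions -/

/-! Everything rests on one factorisation: `cd u - cd v` is a constant times `σ(u + v) σ(u - v) /
(Θ₁(u) Θ₁(v))`, where `σ` is the odd theta function `sigmaFun` of half the modular parameter
(`jacobiH1_mul_sub`, `cd_sub_cd`). It comes from the classical product formula `theta_mul_theta`.
Through it, identities between values of `cd` become cancellations of theta factors.

The action of `s₂`. The points `(cd(η + a), cd(η - a))` run over a curve that `s₂` preserves: its
constant is a quotient of values of `Θ₁` (`s2Const_eq`), and on the curve `s₂(y) = cd(a + (c₁ +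
c₂)/2)` (`s2_curve`). Off the curve, after clearing denominators, `s₂(y) - cd(a + (c₁ + c₂)/2)` is a
form of bidegree (1,1) in `x, y` which vanishes at the curve points with parameters `c₁, c₂, a`.
Such a form is a multiple of `P(c₁, c₂, a)`, which is, up to sign, the 4 × 4 determinant of that
interpolation problem (`s2y_sub_mul`).

The 8-parameter equation. Up to permutations and the `ι`'s, `R` is the square of a shorter word, and
that word consists of two actions of `s₂` with disjoint pairs of parameters, a permutation of the
parameters before each, and a final `s₁`. Substituting the first action into the cross-ratio
equation of the second produces the quotient `P(a₁, a₂, a₃)/P(a₁, a₂, a₄)`, and the constant in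
front is `G` (`twoStep_ratio`, `gG_eq`). Hence each equation of the system says exactly that its
unknown is `-1/(k · twoStepY)` (`twoStep_iff`). The last two equations are the first two at the
image point, up to the period `2κ` of `cd` (`fullStepEquation_iff`).

The reduction. For special parameters the four values of `cd(b + aᵢ)` are `s, -s, 1/(ks), -1/(ks)`,
and similarly for `b - aᵢ`; moreover `G = -1`. The equation then becomes linear in the unknown with
polynomial coefficients (`twoStep_special`). The reduced equation, written in `cd` alone by means of
the quadratic relations between `sn, cn, dn` (`rcg_eq`), is the same relation. `R` reverses the sign
of the half-period differences, so special points are treated with a sign `e = ±1` (`signedState`).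

Genericity. It suffices to find one base point at which everything is regular for all iterates,
since all quantities are quotients of entire functions with denominators nonvanishing there
(`GenAt`, `MeroAt`). The base point is taken on the invariant curve. There `R` acts on `(c₁, c₅, η,
u)` by an invertible rational affine map modulo `K, iK'`. A quadruple no nontrivial rational
combination of which meets a zero of the theta functions exists, because these zeros are countable,
and the property is kept by `R` (`exists_quadGeneric`, `QuadGeneric.step`,
`exists_halfStepRegular`).

The linear action on the lattice and on the parameters is computed from closed forms of the action
of the half word. -/

/-- The bijection `(n, m) ↦ (n + m, n - m)`, `(n, m) ↦ (n + m + 1, n - m)` onto the pairs of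
integers with the same, respectively with different parity. -/
noncomputable def intPairParityEquiv : (ℤ × ℤ) ⊕ (ℤ × ℤ) ≃ ℤ × ℤ :=
  Equiv.ofBijective
    (Sum.elim (fun p => (p.1 + p.2, p.1 - p.2)) (fun p => (p.1 + p.2 + 1, p.1 - p.2))) (by
      constructor
      · rintro (⟨a, b⟩ | ⟨a, b⟩) (⟨c, d⟩ | ⟨c, d⟩) h <;>
          simp only [Sum.elim_inl, Sum.elim_inr, Prod.mk.injEq] at h
        · obtain rfl : a = c := by omega
          obtain rfl : b = d := by omega
          rfl
        · omega
        · omega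
        · obtain rfl : a = c := by omega
          obtain rfl : b = d := by omega
          rfl
      · rintro ⟨p, r⟩
        rcases Int.even_or_odd' (p + r) with ⟨n, hn | hn⟩
        · exact ⟨Sum.inl (n, p - n), by simp; omega⟩
        · exact ⟨Sum.inr (n, p - n - 1), by simp; omega⟩)

theorem hasSum_jacobiTheta₂_term_mul (z w : ℂ) {τ : ℂ} (hτ : 0 < τ.im) :
    HasSum (fun p : ℤ × ℤ => jacobiTheta₂_term p.1 z τ * jacobiTheta₂_term p.2 w τ)
      (jacobiTheta₂ z τ * jacobiTheta₂ w τ) := by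
  have hs : ∀ z, Summable fun n : ℤ => ‖jacobiTheta₂_term n z τ‖ :=
    fun z => ((summable_jacobiTheta₂_term_iff z τ).2 hτ).norm
  have hm := summable_mul_of_summable_norm (hs z) (hs w)
  have he := tsum_mul_tsum_of_summable_norm (hs z) (hs w)
  rw [jacobiTheta₂, jacobiTheta₂, he]
  exact hm.hasSum

/-- The double series is split by the parity of the sum of the two indices. In the coordinates
half-sum and half-difference the quadratic exponent decouples, with `τ` doubled; the mixed-parity
half carries the shift by `τ` and the exponential prefactor. -/
theorem theta_mul_theta {τ : ℂ} (hτ : 0 < τ.im) (a b : ℂ) :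
    jacobiTheta₂ a τ * jacobiTheta₂ b τ
      = jacobiTheta₂ (a + b) (2 * τ) * jacobiTheta₂ (a - b) (2 * τ)
        + exp (2 * Real.pi * I * a + Real.pi * I * τ)
          * (jacobiTheta₂ (a + b + τ) (2 * τ) * jacobiTheta₂ (a - b + τ) (2 * τ)) := by
  have hτ2 : 0 < (2 * τ).im := by simpa using hτ
  have h1 : HasSum (fun p : ℤ × ℤ =>
      jacobiTheta₂_term (p.1 + p.2) a τ * jacobiTheta₂_term (p.1 - p.2) b τ)
      (jacobiTheta₂ (a + b) (2 * τ) * jacobiTheta₂ (a - b) (2 * τ)) := by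
    refine (hasSum_jacobiTheta₂_term_mul (a + b) (a - b) hτ2).congr_fun fun p => ?_
    simp only [jacobiTheta₂_term, ← exp_add]
    push_cast
    ring_nf
  have h2 : HasSum (fun p : ℤ × ℤ =>
      jacobiTheta₂_term (p.1 + p.2 + 1) a τ * jacobiTheta₂_term (p.1 - p.2) b τ)
      (exp (2 * Real.pi * I * a + Real.pi * I * τ)
        * (jacobiTheta₂ (a + b + τ) (2 * τ) * jacobiTheta₂ (a - b + τ) (2 * τ))) := by
    refine ((hasSum_jacobiTheta₂_term_mul (a + b + τ) (a - b + τ) hτ2).mul_left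
      (exp (2 * Real.pi * I * a + Real.pi * I * τ))).congr_fun fun p => ?_
    simp only [jacobiTheta₂_term, ← exp_add]
    push_cast
    ring_nf
  have h3 := intPairParityEquiv.hasSum_iff.2 (hasSum_jacobiTheta₂_term_mul a b hτ)
  have h4 := HasSum.sum
    (f := (fun p : ℤ × ℤ => jacobiTheta₂_term p.1 a τ * jacobiTheta₂_term p.2 b τ)
      ∘ intPairParityEquiv) h1 h2
  exact h3.unique h4

/-! ### Theta constants -/

/-- Evenness and the period 1 equate the values at `1/2 ± τ/2`, while the quasi-period `τ` relates
them by the factor `-1`. -/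
theorem theta_half_add_half (τ : ℂ) : jacobiTheta₂ (1 / 2 + τ / 2) τ = 0 := by
  have h1 := jacobiTheta₂_add_left' (1 / 2 - τ / 2) τ
  have h2 : exp (-Real.pi * I * (τ + 2 * (1 / 2 - τ / 2))) = -1 := by
    rw [show -Real.pi * I * (τ + 2 * (1 / 2 - τ / 2)) = -(Real.pi * I) by ring, exp_neg, exp_pi_mul_I]
    norm_num
  have h3 : jacobiTheta₂ (1 / 2 - τ / 2) τ = jacobiTheta₂ (1 / 2 + τ / 2) τ := by
    rw [← jacobiTheta₂_neg_left, ← jacobiTheta₂_add_left]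
    ring_nf
  rw [h2, h3, show (1 / 2 - τ / 2 + τ : ℂ) = 1 / 2 + τ / 2 by ring] at h1
  linear_combination h1 / 2

/-- Holds term by term since `n² ≡ n` modulo 2. It makes the norm estimate for `jacobiTheta`
available for `θ₄`. -/
theorem theta_half_eq (τ : ℂ) : jacobiTheta₂ (1 / 2) τ = jacobiTheta₂ 0 (τ + 1) := by
  refine tsum_congr fun n => ?_
  obtain ⟨m, hm⟩ := Int.even_mul_succ_self n
  have hm' : (n : ℂ) ^ 2 = 2 * m - n := by
    have : ((n * (n + 1) : ℤ) : ℂ) = ((m + m : ℤ) : ℂ) := by rw [hm]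
    push_cast at this
    linear_combination this
  unfold jacobiTheta₂_term
  refine exp_eq_exp_iff_exists_int.2 ⟨n - m, ?_⟩
  push_cast
  linear_combination (-Real.pi * I) * hm'

theorem theta_half_mul {τ : ℂ} (hτ : 0 < τ.im) :
    jacobiTheta₂ 0 τ * jacobiTheta₂ (1 / 2) τ = jacobiTheta₂ (1 / 2) (2 * τ) ^ 2 := by
  rw [theta_mul_theta hτ, show (0 + 1 / 2 + τ : ℂ) = 1 / 2 + 2 * τ / 2 by ring,
    theta_half_add_half, zero_add, zero_sub, jacobiTheta₂_neg_left]
  ring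

theorem theta_half_ne_zero_of_one_le {τ : ℂ} (hτ : 1 ≤ τ.im) : jacobiTheta₂ (1 / 2) τ ≠ 0 := by
  intro h
  have him : (τ + 1).im = τ.im := by simp
  have h1 := norm_jacobiTheta_sub_one_le (τ := τ + 1) (by rw [him]; linarith)
  rw [jacobiTheta_eq_jacobiTheta₂, ← theta_half_eq, h, him, zero_sub, norm_neg, norm_one] at h1
  -- A zero would give `1 ≤ 2q/(1 - q)`, that is `q ≥ 1/3`, for `q = exp(-π Im τ)`.
  have h2 : Real.exp (-Real.pi * τ.im) < 1 / 4 := by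
    have h3 : (3 : ℝ) < Real.pi * τ.im := by nlinarith [Real.pi_gt_three]
    rw [neg_mul, Real.exp_neg, one_div]
    exact inv_strictAnti₀ (by norm_num) (by linarith [Real.add_one_le_exp (Real.pi * τ.im)])
  have h5 : (0 : ℝ) < 1 - Real.exp (-Real.pi * τ.im) := by linarith
  rw [div_mul_eq_mul_div, le_div_iff₀ h5] at h1
  linarith

/-- By `theta_half_mul` a zero at `τ` forces `θ₄ = 0` at `2τ`, hence at `4τ, 8τ, …`. The imaginary
part eventually exceeds 1, where the direct estimate excludes a zero. -/
theorem theta_zero_mul_half_ne_zero {τ : ℂ} (hτ : 0 < τ.im) :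
    jacobiTheta₂ 0 τ * jacobiTheta₂ (1 / 2) τ ≠ 0 := by
  intro h
  have key : ∀ n : ℕ, jacobiTheta₂ (1 / 2) (2 ^ (n + 1) * τ) = 0 := by
    intro n
    induction n with
    | zero =>
      rw [theta_half_mul hτ] at h
      simpa using h
    | succ n ih =>
      have hn : 0 < (2 ^ (n + 1) * τ).im := by
        rw [show (2 ^ (n + 1) * τ : ℂ) = ((2 ^ (n + 1) : ℝ) : ℂ) * τ by push_cast; ring,
          im_ofReal_mul]
        positivity
      have h1 := theta_half_mul hn
      rw [ih, mul_zero, eq_comm, sq_eq_zero_iff] at h1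
      rw [← h1]
      ring_nf
  obtain ⟨n, hn⟩ := pow_unbounded_of_one_lt (1 / τ.im) (one_lt_two (α := ℝ))
  refine theta_half_ne_zero_of_one_le ?_ (key n)
  rw [show (2 ^ (n + 1) * τ : ℂ) = ((2 ^ (n + 1) : ℝ) : ℂ) * τ by push_cast; ring,
    im_ofReal_mul]
  rw [div_lt_iff₀ hτ] at hn
  rw [pow_succ]
  linarith

theorem theta_zero_ne_zero {τ : ℂ} (hτ : 0 < τ.im) : jacobiTheta₂ 0 τ ≠ 0 :=
  left_ne_zero_of_mul (theta_zero_mul_half_ne_zero hτ)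

theorem theta_half_ne_zero {τ : ℂ} (hτ : 0 < τ.im) : jacobiTheta₂ (1 / 2) τ ≠ 0 :=
  right_ne_zero_of_mul (theta_zero_mul_half_ne_zero hτ)

/-- The modular transformation `τ ↦ -1/τ` exchanges this constant with `θ₄`. -/
theorem theta_half_period_ne_zero {τ : ℂ} (hτ : 0 < τ.im) : jacobiTheta₂ (τ / 2) τ ≠ 0 := by
  have h0 : τ ≠ 0 := by rintro rfl; simp at hτ
  rw [jacobiTheta₂_functional_equation]
  refine mul_ne_zero (mul_ne_zero (one_div_ne_zero ?_) (exp_ne_zero _)) ?_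
  · rw [Ne, cpow_eq_zero_iff]
    simp [h0]
  · rw [show τ / 2 / τ = 1 / 2 by field_simp]
    refine theta_half_ne_zero ?_
    rw [neg_div, neg_im, one_div, inv_im, neg_div, neg_neg]
    exact div_pos hτ (normSq_pos.2 h0)

/-! ### The functions `H₁`, `Θ₁`, `cd` -/

theorem ellK_ne_zero {τ : ℂ} (hτ : 0 < τ.im) : ellK τ ≠ 0 :=
  mul_ne_zero (div_ne_zero (ofReal_ne_zero.2 Real.pi_ne_zero) two_ne_zero)
    (pow_ne_zero _ (theta_zero_ne_zero hτ))

theorem jacobiH1_eq {τ : ℂ} (hτ : 0 < τ.im) (u : ℂ) :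
    jacobiH1 τ u = exp (Real.pi * I * τ / 4 + Real.pi * I * (u / (2 * ellK τ)))
      * jacobiTheta₂ (u / (2 * ellK τ) + τ / 2) τ := by
  have hK := ellK_ne_zero hτ
  have e1 : (u + ellK τ) / (2 * ellK τ) = u / (2 * ellK τ) + 1 / 2 := by field_simp
  rw [jacobiH1, jacobiH, e1, show Real.pi * I * τ / 4 + Real.pi * I * (u / (2 * ellK τ) + 1 / 2)
    = (Real.pi * I * τ / 4 + Real.pi * I * (u / (2 * ellK τ))) + Real.pi / 2 * I by ring,
    exp_add _ (Real.pi / 2 * I), exp_pi_div_two_mul_I,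
    show u / (2 * ellK τ) + 1 / 2 + 1 / 2 + τ / 2 = u / (2 * ellK τ) + τ / 2 + 1 by ring,
    jacobiTheta₂_add_left]
  linear_combination (-exp (Real.pi * I * τ / 4 + Real.pi * I * (u / (2 * ellK τ)))
      * jacobiTheta₂ (u / (2 * ellK τ) + τ / 2) τ) * I_mul_I

theorem jacobiT1_eq {τ : ℂ} (hτ : 0 < τ.im) (u : ℂ) :
    jacobiT1 τ u = jacobiTheta₂ (u / (2 * ellK τ)) τ := by
  have hK := ellK_ne_zero hτ
  rw [jacobiT1, jacobiT, show (u + ellK τ) / (2 * ellK τ) + 1 / 2 = u / (2 * ellK τ) + 1 by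
    field_simp; ring, jacobiTheta₂_add_left]

theorem jacobiT1_zero_ne_zero {τ : ℂ} (hτ : 0 < τ.im) : jacobiT1 τ 0 ≠ 0 := by
  rw [jacobiT1_eq hτ, zero_div]
  exact theta_zero_ne_zero hτ

theorem jacobiH1_zero_ne_zero {τ : ℂ} (hτ : 0 < τ.im) : jacobiH1 τ 0 ≠ 0 := by
  rw [jacobiH1_eq hτ, zero_div, zero_add]
  exact mul_ne_zero (exp_ne_zero _) (theta_half_period_ne_zero hτ)

theorem jacobiT_zero_ne_zero {τ : ℂ} (hτ : 0 < τ.im) : jacobiT τ 0 ≠ 0 := by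
  rw [jacobiT, zero_div, zero_add]
  exact theta_half_ne_zero hτ

theorem sqrtModulus_ne_zero {τ : ℂ} (hτ : 0 < τ.im) : sqrtModulus τ ≠ 0 :=
  div_ne_zero (jacobiH1_zero_ne_zero hτ) (jacobiT1_zero_ne_zero hτ)

theorem sqrtCoModulus_ne_zero {τ : ℂ} (hτ : 0 < τ.im) : sqrtCoModulus τ ≠ 0 :=
  div_ne_zero (jacobiT_zero_ne_zero hτ) (jacobiT1_zero_ne_zero hτ)

theorem modulus_ne_zero {τ : ℂ} (hτ : 0 < τ.im) : modulus τ ≠ 0 :=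
  pow_ne_zero _ (sqrtModulus_ne_zero hτ)

theorem jacobiT1_neg {τ : ℂ} (hτ : 0 < τ.im) (u : ℂ) : jacobiT1 τ (-u) = jacobiT1 τ u := by
  rw [jacobiT1_eq hτ, jacobiT1_eq hτ, neg_div, jacobiTheta₂_neg_left]

theorem jacobiH1_neg {τ : ℂ} (hτ : 0 < τ.im) (u : ℂ) : jacobiH1 τ (-u) = jacobiH1 τ u := by
  rw [jacobiH1_eq hτ, jacobiH1_eq hτ, neg_div]
  generalize u / (2 * ellK τ) = v
  rw [← jacobiTheta₂_neg_left, show -(-v + τ / 2) = (v - τ / 2) by ring,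
    show v + τ / 2 = (v - τ / 2) + τ by ring, jacobiTheta₂_add_left', ← mul_assoc, ← exp_add]
  ring_nf

theorem jacobiT1_add_two_ellK {τ : ℂ} (hτ : 0 < τ.im) (u : ℂ) :
    jacobiT1 τ (u + 2 * ellK τ) = jacobiT1 τ u := by
  have hK := ellK_ne_zero hτ
  rw [jacobiT1_eq hτ, jacobiT1_eq hτ, add_div, div_self (mul_ne_zero two_ne_zero hK),
    jacobiTheta₂_add_left]

theorem jacobiH1_add_two_ellK {τ : ℂ} (hτ : 0 < τ.im) (u : ℂ) :
    jacobiH1 τ (u + 2 * ellK τ) = -jacobiH1 τ u := by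
  have hK := ellK_ne_zero hτ
  rw [jacobiH1_eq hτ, jacobiH1_eq hτ, add_div, div_self (mul_ne_zero two_ne_zero hK),
    add_right_comm, jacobiTheta₂_add_left, mul_add, mul_one, ← add_assoc, exp_add _ (Real.pi * I),
    exp_pi_mul_I]
  ring

theorem ellIK'_div {τ : ℂ} (hτ : 0 < τ.im) : ellIK' τ / (2 * ellK τ) = τ / 2 := by
  have hK := ellK_ne_zero hτ
  rw [ellIK']
  field_simp

theorem jacobiT1_add_ellIK' {τ : ℂ} (hτ : 0 < τ.im) (u : ℂ) :
    jacobiT1 τ (u + ellIK' τ)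
      = exp (-(Real.pi * I * τ / 4 + Real.pi * I * (u / (2 * ellK τ)))) * jacobiH1 τ u := by
  rw [jacobiT1_eq hτ, jacobiH1_eq hτ, add_div, ellIK'_div hτ, ← mul_assoc, ← exp_add,
    neg_add_cancel, exp_zero, one_mul]

theorem jacobiH1_add_ellIK' {τ : ℂ} (hτ : 0 < τ.im) (u : ℂ) :
    jacobiH1 τ (u + ellIK' τ)
      = exp (-(Real.pi * I * τ / 4 + Real.pi * I * (u / (2 * ellK τ)))) * jacobiT1 τ u := by
  rw [jacobiT1_eq hτ, jacobiH1_eq hτ, add_div, ellIK'_div hτ]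
  generalize u / (2 * ellK τ) = v
  rw [add_assoc, add_halves, jacobiTheta₂_add_left', ← mul_assoc, ← exp_add]
  ring_nf

theorem cd_neg {τ : ℂ} (hτ : 0 < τ.im) (u : ℂ) : cd τ (-u) = cd τ u := by
  rw [cd, cd, jacobiH1_neg hτ, jacobiT1_neg hτ]

theorem cd_add_two_ellK {τ : ℂ} (hτ : 0 < τ.im) (u : ℂ) : cd τ (u + 2 * ellK τ) = -cd τ u := by
  rw [cd, cd, jacobiH1_add_two_ellK hτ, jacobiT1_add_two_ellK hτ, neg_div]

/-- Because division by zero yields 0, the identity survives at the zeros and poles of `cd`; period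
shifts of `cd` therefore never need finiteness hypotheses. -/
theorem cd_add_ellIK' {τ : ℂ} (hτ : 0 < τ.im) (u : ℂ) :
    cd τ (u + ellIK' τ) = 1 / (modulus τ * cd τ u) := by
  have hk := sqrtModulus_ne_zero hτ
  rw [cd, cd, jacobiH1_add_ellIK' hτ, jacobiT1_add_ellIK' hτ, mul_left_comm,
    mul_div_mul_left _ _ (exp_ne_zero _), modulus]
  by_cases h1 : jacobiT1 τ u = 0
  · simp [h1]
  by_cases h2 : jacobiH1 τ u = 0
  · simp [h2]
  field_simp

theorem cd_add_ellKappa {τ : ℂ} (hτ : 0 < τ.im) (u : ℂ) :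
    cd τ (u + ellKappa τ) = -1 / (modulus τ * cd τ u) := by
  rw [ellKappa, ← add_assoc, cd_add_ellIK' hτ, cd_add_two_ellK hτ, mul_neg, div_neg, neg_div]

theorem cd_add_two_ellKappa {τ : ℂ} (hτ : 0 < τ.im) (u : ℂ) :
    cd τ (u + 2 * ellKappa τ) = cd τ u := by
  have hk := modulus_ne_zero hτ
  rw [two_mul, ← add_assoc, cd_add_ellKappa hτ, cd_add_ellKappa hτ]
  by_cases h : cd τ u = 0
  · simp [h]
  field_simp

theorem cdFinite_neg {τ : ℂ} (hτ : 0 < τ.im) (u : ℂ) : CdFinite τ (-u) ↔ CdFinite τ u := by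
  rw [CdFinite, CdFinite, jacobiT1_neg hτ]

theorem cdFinite_add_two_ellKappa {τ : ℂ} (hτ : 0 < τ.im) (u : ℂ) :
    CdFinite τ (u + 2 * ellKappa τ) ↔ CdFinite τ u := by
  rw [CdFinite, CdFinite, show u + 2 * ellKappa τ
    = u + 2 * ellK τ + 2 * ellK τ + ellIK' τ + ellIK' τ by rw [ellKappa]; ring,
    jacobiT1_add_ellIK' hτ, jacobiH1_add_ellIK' hτ, jacobiT1_add_two_ellK hτ,
    jacobiT1_add_two_ellK hτ, mul_ne_zero_iff, mul_ne_zero_iff]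
  simp only [ne_eq, exp_ne_zero, not_false_eq_true, true_and]

theorem cd_ne_zero {τ : ℂ} (hτ : 0 < τ.im) {u : ℂ} (h1 : CdFinite τ u) (h2 : jacobiH1 τ u ≠ 0) :
    cd τ u ≠ 0 :=
  div_ne_zero h2 (mul_ne_zero (sqrtModulus_ne_zero hτ) h1)

/-! ### The theta function of the period lattice of `cd` -/

/-- The odd theta function which vanishes on the periods of `cd`. -/
noncomputable def sigmaFun (τ w : ℂ) : ℂ :=
  exp (Real.pi * I * (w / (4 * ellK τ)))
    * jacobiTheta₂ (w / (4 * ellK τ) + 1 / 2 + τ / 4) (τ / 2)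

theorem sigmaFun_neg (τ w : ℂ) : sigmaFun τ (-w) = -sigmaFun τ w := by
  rw [sigmaFun, sigmaFun, neg_div]
  generalize w / (4 * ellK τ) = v
  rw [← jacobiTheta₂_neg_left, show -(-v + 1 / 2 + τ / 4) = v - 1 / 2 - τ / 4 by ring,
    show v + 1 / 2 + τ / 4 = v - 1 / 2 - τ / 4 + 1 + τ / 2 by ring, jacobiTheta₂_add_left',
    jacobiTheta₂_add_left, ← mul_assoc, ← exp_add,
    show Real.pi * I * v + -Real.pi * I * (τ / 2 + 2 * (v - 1 / 2 - τ / 4 + 1))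
      = Real.pi * I * -v - Real.pi * I by ring, exp_sub, exp_pi_mul_I]
  ring

theorem sigmaFun_add_four_ellK {τ : ℂ} (hτ : 0 < τ.im) (w : ℂ) :
    sigmaFun τ (w + 4 * ellK τ) = -sigmaFun τ w := by
  have hK := ellK_ne_zero hτ
  rw [sigmaFun, sigmaFun, add_div, div_self (mul_ne_zero (by norm_num) hK), mul_add, mul_one,
    exp_add, exp_pi_mul_I, show w / (4 * ellK τ) + 1 + 1 / 2 + τ / 4
      = w / (4 * ellK τ) + 1 / 2 + τ / 4 + 1 by ring, jacobiTheta₂_add_left]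
  ring

theorem im_half_pos {τ : ℂ} (hτ : 0 < τ.im) : 0 < (τ / 2).im := by simpa using hτ

/-- `2K`, `iK'` and `κ` are the half-periods of `σ`, so its values there are, up to exponentials,
the three theta constants at `τ/2`. -/
theorem sigmaFun_two_ellK_ne_zero {τ : ℂ} (hτ : 0 < τ.im) : sigmaFun τ (2 * ellK τ) ≠ 0 := by
  have hK := ellK_ne_zero hτ
  refine mul_ne_zero (exp_ne_zero _) ?_
  rw [show 2 * ellK τ / (4 * ellK τ) + 1 / 2 + τ / 4 = τ / 2 / 2 + 1 by field_simp; ring,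
    jacobiTheta₂_add_left]
  exact theta_half_period_ne_zero (im_half_pos hτ)

theorem sigmaFun_ellIK'_ne_zero {τ : ℂ} (hτ : 0 < τ.im) : sigmaFun τ (ellIK' τ) ≠ 0 := by
  have hK := ellK_ne_zero hτ
  refine mul_ne_zero (exp_ne_zero _) ?_
  rw [show ellIK' τ / (4 * ellK τ) + 1 / 2 + τ / 4 = 1 / 2 + τ / 2 by
    rw [ellIK']; field_simp; ring, jacobiTheta₂_add_left']
  exact mul_ne_zero (exp_ne_zero _) (theta_half_ne_zero (im_half_pos hτ))

theorem sigmaFun_ellKappa_ne_zero {τ : ℂ} (hτ : 0 < τ.im) : sigmaFun τ (ellKappa τ) ≠ 0 := by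
  have hK := ellK_ne_zero hτ
  refine mul_ne_zero (exp_ne_zero _) ?_
  rw [show ellKappa τ / (4 * ellK τ) + 1 / 2 + τ / 4 = 0 + τ / 2 + 1 by
    rw [ellKappa, ellIK']; field_simp; ring, jacobiTheta₂_add_left, jacobiTheta₂_add_left']
  exact mul_ne_zero (exp_ne_zero _) (theta_zero_ne_zero (im_half_pos hτ))

/-- This is `theta_mul_theta` at `τ/2`, read from the product `σ(u + v) σ(u - v)`: the two parity
classes give the two products on the left, and the shift by `1/2` in `σ` gives the minus sign. -/
theorem jacobiH1_mul_sub {τ : ℂ} (hτ : 0 < τ.im) (u v : ℂ) :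
    jacobiH1 τ u * jacobiT1 τ v - jacobiH1 τ v * jacobiT1 τ u
      = exp (Real.pi * I * τ / 4) * (sigmaFun τ (u + v) * sigmaFun τ (u - v)) := by
  have hK := ellK_ne_zero hτ
  have e1 : (u + v) / (4 * ellK τ) = (u / (2 * ellK τ) + v / (2 * ellK τ)) / 2 := by
    field_simp; ring
  have e2 : (u - v) / (4 * ellK τ) = (u / (2 * ellK τ) - v / (2 * ellK τ)) / 2 := by
    field_simp; ring
  rw [sigmaFun, sigmaFun, e1, e2, jacobiH1_eq hτ, jacobiH1_eq hτ, jacobiT1_eq hτ, jacobiT1_eq hτ]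
  generalize u / (2 * ellK τ) = x
  generalize v / (2 * ellK τ) = y
  have h := theta_mul_theta (im_half_pos hτ) ((x + y) / 2 + 1 / 2 + τ / 4)
    ((x - y) / 2 + 1 / 2 + τ / 4)
  rw [show 2 * (τ / 2) = τ by ring,
    show (x + y) / 2 + 1 / 2 + τ / 4 + ((x - y) / 2 + 1 / 2 + τ / 4) + τ / 2
      = x + 1 + τ by ring,
    show (x + y) / 2 + 1 / 2 + τ / 4 + ((x - y) / 2 + 1 / 2 + τ / 4) = x + τ / 2 + 1 by ring,
    show (x + y) / 2 + 1 / 2 + τ / 4 - ((x - y) / 2 + 1 / 2 + τ / 4) = y by ring,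
    jacobiTheta₂_add_left', jacobiTheta₂_add_left, jacobiTheta₂_add_left] at h
  rw [show ∀ a b c d e : ℂ, a * ((b * c) * (d * e)) = a * b * d * (c * e) by intros; ring, h]
  have e3 : exp (2 * Real.pi * I * ((x + y) / 2 + 1 / 2 + τ / 4) + Real.pi * I * (τ / 2))
      = -exp (Real.pi * I * (x + y) + Real.pi * I * τ) := by
    rw [show 2 * Real.pi * I * ((x + y) / 2 + 1 / 2 + τ / 4) + Real.pi * I * (τ / 2)
      = Real.pi * I * (x + y) + Real.pi * I * τ + Real.pi * I by ring, exp_add, exp_pi_mul_I]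
    ring
  have e4 : exp (-Real.pi * I * (τ + 2 * (x + 1)))
      = exp (-Real.pi * I * (τ + 2 * x)) := by
    rw [show -Real.pi * I * (τ + 2 * (x + 1)) = -Real.pi * I * (τ + 2 * x) - 2 * Real.pi * I by
      ring, exp_sub, exp_two_pi_mul_I, div_one]
  have e5 : exp (Real.pi * I * τ / 4) * exp (Real.pi * I * ((x + y) / 2))
      * exp (Real.pi * I * ((x - y) / 2)) = exp (Real.pi * I * τ / 4 + Real.pi * I * x) := by
    rw [← exp_add, ← exp_add]
    ring_nf
  have e6 : exp (Real.pi * I * τ / 4 + Real.pi * I * x)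
      * exp (Real.pi * I * (x + y) + Real.pi * I * τ) * exp (-Real.pi * I * (τ + 2 * x))
      = exp (Real.pi * I * τ / 4 + Real.pi * I * y) := by
    rw [← exp_add, ← exp_add]
    ring_nf
  rw [e3, e4, e5]
  linear_combination (jacobiTheta₂ (y + τ / 2) τ * jacobiTheta₂ x τ) * e6

theorem cd_sub_cd {τ : ℂ} (hτ : 0 < τ.im) {u v : ℂ} (hu : CdFinite τ u) (hv : CdFinite τ v) :
    cd τ u - cd τ v = exp (Real.pi * I * τ / 4) / sqrtModulus τ
      * (sigmaFun τ (u + v) * sigmaFun τ (u - v)) / (jacobiT1 τ u * jacobiT1 τ v) := by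
  have hk := sqrtModulus_ne_zero hτ
  rw [CdFinite] at hu hv
  have h := jacobiH1_mul_sub hτ u v
  rw [cd, cd]
  field_simp
  linear_combination h

theorem cd_ne_cd {τ : ℂ} (hτ : 0 < τ.im) {u v : ℂ} (hu : CdFinite τ u) (hv : CdFinite τ v)
    (h1 : sigmaFun τ (u + v) ≠ 0) (h2 : sigmaFun τ (u - v) ≠ 0) : cd τ u ≠ cd τ v := by
  rw [← sub_ne_zero, cd_sub_cd hτ hu hv]
  exact div_ne_zero (mul_ne_zero (div_ne_zero (exp_ne_zero _) (sqrtModulus_ne_zero hτ))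
    (mul_ne_zero h1 h2)) (mul_ne_zero hu hv)

theorem sigmaFun_ne_zero_of_cd_ne {τ : ℂ} (hτ : 0 < τ.im) {u v : ℂ} (hu : CdFinite τ u)
    (hv : CdFinite τ v) (h : cd τ u ≠ cd τ v) :
    sigmaFun τ (u + v) ≠ 0 ∧ sigmaFun τ (u - v) ≠ 0 := by
  rw [← sub_ne_zero, cd_sub_cd hτ hu hv] at h
  constructor <;> rintro h0 <;> simp [h0] at h

/-! ### Quadratic relations between `sn`, `cn`, `dn` -/

/-- The first of two functions which span the squares of the four theta functions. -/
noncomputable def thetaSqA (τ u : ℂ) : ℂ := jacobiTheta₂ (u / ellK τ) (2 * τ)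

/-- The second of two functions which span the squares of the four theta functions. -/
noncomputable def thetaSqB (τ u : ℂ) : ℂ :=
  exp (Real.pi * I * (u / ellK τ) + Real.pi * I * τ / 2)
    * jacobiTheta₂ (u / ellK τ + τ) (2 * τ)

theorem thetaSqA_sub {τ : ℂ} (hτ : 0 < τ.im) (u : ℂ) :
    thetaSqA τ (u - ellK τ) = thetaSqA τ u := by
  rw [thetaSqA, thetaSqA, sub_div, div_self (ellK_ne_zero hτ), ← jacobiTheta₂_add_left,
    sub_add_cancel]

theorem thetaSqB_sub {τ : ℂ} (hτ : 0 < τ.im) (u : ℂ) :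
    thetaSqB τ (u - ellK τ) = -thetaSqB τ u := by
  rw [thetaSqB, thetaSqB, sub_div, div_self (ellK_ne_zero hτ), ← jacobiTheta₂_add_left,
    show u / ellK τ - 1 + τ + 1 = u / ellK τ + τ by ring,
    show Real.pi * I * (u / ellK τ - 1) + Real.pi * I * τ / 2
      = Real.pi * I * (u / ellK τ) + Real.pi * I * τ / 2 - Real.pi * I by ring, exp_sub,
    exp_pi_mul_I]
  ring

/-- The product formula with equal arguments. All four squares of theta functions lie in the span of
`thetaSqA` and `thetaSqB`, which makes the relations between `sn, cn, dn` linear algebra. -/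
theorem jacobiT1_sq {τ : ℂ} (hτ : 0 < τ.im) (u : ℂ) :
    jacobiT1 τ u ^ 2 = thetaSqA τ 0 * thetaSqA τ u + thetaSqB τ 0 * thetaSqB τ u := by
  have hK := ellK_ne_zero hτ
  have e1 : u / ellK τ = 2 * (u / (2 * ellK τ)) := by field_simp
  rw [jacobiT1_eq hτ, thetaSqA, thetaSqA, thetaSqB, thetaSqB, e1, zero_div]
  generalize u / (2 * ellK τ) = v
  rw [sq, theta_mul_theta hτ, sub_self, ← two_mul, zero_add]
  have e2 : exp (2 * Real.pi * I * v + Real.pi * I * τ)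
      = exp (Real.pi * I * 0 + Real.pi * I * τ / 2)
        * exp (Real.pi * I * (2 * v) + Real.pi * I * τ / 2) := by
    rw [← exp_add]
    ring_nf
  rw [e2]
  ring

theorem jacobiH1_sq {τ : ℂ} (hτ : 0 < τ.im) (u : ℂ) :
    jacobiH1 τ u ^ 2 = thetaSqA τ 0 * thetaSqB τ u + thetaSqB τ 0 * thetaSqA τ u := by
  have hK := ellK_ne_zero hτ
  have e1 : u / ellK τ = 2 * (u / (2 * ellK τ)) := by field_simp
  rw [jacobiH1_eq hτ, thetaSqA, thetaSqA, thetaSqB, thetaSqB, e1, zero_div]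
  generalize u / (2 * ellK τ) = v
  rw [mul_pow, sq (jacobiTheta₂ _ _), theta_mul_theta hτ, sub_self, zero_add,
    show v + τ / 2 + (v + τ / 2) = 2 * v + τ by ring,
    show 2 * v + τ + τ = 2 * v + 2 * τ by ring, jacobiTheta₂_add_left']
  have e2 : exp (Real.pi * I * τ / 4 + Real.pi * I * v) ^ 2
      = exp (Real.pi * I * (2 * v) + Real.pi * I * τ / 2) := by
    rw [← exp_nat_mul]
    push_cast
    ring_nf
  have e3 : exp (Real.pi * I * (2 * v) + Real.pi * I * τ / 2)
      * exp (2 * Real.pi * I * (v + τ / 2) + Real.pi * I * τ)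
      * exp (-Real.pi * I * (2 * τ + 2 * (2 * v)))
      = exp (Real.pi * I * 0 + Real.pi * I * τ / 2) := by
    rw [← exp_add, ← exp_add]
    ring_nf
  rw [e2, ← e3]
  ring

theorem jacobiT_sq {τ : ℂ} (hτ : 0 < τ.im) (u : ℂ) :
    jacobiT τ u ^ 2 = thetaSqA τ 0 * thetaSqA τ u - thetaSqB τ 0 * thetaSqB τ u := by
  have h := jacobiT1_sq hτ (u - ellK τ)
  rw [jacobiT1, sub_add_cancel, thetaSqA_sub hτ, thetaSqB_sub hτ] at h
  rw [h]
  ring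

theorem jacobiH_sq {τ : ℂ} (hτ : 0 < τ.im) (u : ℂ) :
    jacobiH τ u ^ 2 = thetaSqB τ 0 * thetaSqA τ u - thetaSqA τ 0 * thetaSqB τ u := by
  have h := jacobiH1_sq hτ (u - ellK τ)
  rw [jacobiH1, sub_add_cancel, thetaSqA_sub hτ, thetaSqB_sub hτ] at h
  rw [h]
  ring

theorem thetaSq_zero_ne_zero {τ : ℂ} (hτ : 0 < τ.im) :
    thetaSqA τ 0 ^ 2 + thetaSqB τ 0 ^ 2 ≠ 0 := by
  have h := pow_ne_zero 2 (jacobiT1_zero_ne_zero hτ)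
  rwa [jacobiT1_sq hτ, ← sq, ← sq] at h

theorem modulus_eq {τ : ℂ} (hτ : 0 < τ.im) : modulus τ
    = 2 * thetaSqA τ 0 * thetaSqB τ 0 / (thetaSqA τ 0 ^ 2 + thetaSqB τ 0 ^ 2) := by
  rw [modulus, sqrtModulus, div_pow, jacobiH1_sq hτ, jacobiT1_sq hτ]
  ring

theorem sqrtCoModulus_sq {τ : ℂ} (hτ : 0 < τ.im) : sqrtCoModulus τ ^ 2
    = (thetaSqA τ 0 ^ 2 - thetaSqB τ 0 ^ 2) / (thetaSqA τ 0 ^ 2 + thetaSqB τ 0 ^ 2) := by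
  rw [sqrtCoModulus, div_pow, jacobiT_sq hτ, jacobiT1_sq hτ]
  ring

/-- With `A, B` the values at 0 of `thetaSqA`, `thetaSqB`, one has `k = 2AB/(A² + B²)` and `k' = (A²
- B²)/(A² + B²)`, so that `k² + k'² = 1`. -/
theorem one_sub_modulus_sq {τ : ℂ} (hτ : 0 < τ.im) :
    1 - modulus τ ^ 2 = sqrtCoModulus τ ^ 4 := by
  have h := thetaSq_zero_ne_zero hτ
  rw [show sqrtCoModulus τ ^ 4 = (sqrtCoModulus τ ^ 2) ^ 2 by ring, sqrtCoModulus_sq hτ,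
    modulus_eq hτ]
  field_simp
  ring

theorem one_sub_modulus_sq_ne_zero {τ : ℂ} (hτ : 0 < τ.im) : 1 - modulus τ ^ 2 ≠ 0 := by
  rw [one_sub_modulus_sq hτ]
  exact pow_ne_zero _ (sqrtCoModulus_ne_zero hτ)

theorem sn_sq_add_cn_sq {τ : ℂ} (hτ : 0 < τ.im) {u : ℂ} (hu : SnFinite τ u) :
    sn τ u ^ 2 + cn τ u ^ 2 = 1 := by
  have h := thetaSq_zero_ne_zero hτ
  have hu2 : jacobiT τ u ^ 2 ≠ 0 := pow_ne_zero 2 hu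
  have hk := modulus_ne_zero hτ
  have hk2 := modulus_eq hτ
  rw [eq_div_iff h] at hk2
  have hc := sqrtCoModulus_sq hτ
  rw [eq_div_iff h] at hc
  rw [sn, cn, div_pow, div_pow, mul_pow, mul_pow, ← add_div, ← modulus,
    div_eq_one_iff_eq (mul_ne_zero hk hu2)]
  refine mul_left_cancel₀ h ?_
  rw [jacobiH_sq hτ, jacobiH1_sq hτ, jacobiT_sq hτ]
  linear_combination (thetaSqA τ 0 * thetaSqB τ u + thetaSqB τ 0 * thetaSqA τ u) * hc
    - (thetaSqA τ 0 * thetaSqA τ u - thetaSqB τ 0 * thetaSqB τ u) * hk2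

theorem dn_sq_add_sn_sq {τ : ℂ} (hτ : 0 < τ.im) {u : ℂ} (hu : SnFinite τ u) :
    dn τ u ^ 2 + modulus τ ^ 2 * sn τ u ^ 2 = 1 := by
  have h := thetaSq_zero_ne_zero hτ
  have hu2 : jacobiT τ u ^ 2 ≠ 0 := pow_ne_zero 2 hu
  have hk := modulus_ne_zero hτ
  have hk2 := modulus_eq hτ
  rw [eq_div_iff h] at hk2
  have hc := sqrtCoModulus_sq hτ
  rw [eq_div_iff h] at hc
  have e : dn τ u ^ 2 + modulus τ ^ 2 * sn τ u ^ 2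
      = (sqrtCoModulus τ ^ 2 * jacobiT1 τ u ^ 2 + modulus τ * jacobiH τ u ^ 2)
        / jacobiT τ u ^ 2 := by
    rw [dn, sn, div_pow, div_pow, mul_pow, mul_pow, ← modulus]
    field_simp
  rw [e, div_eq_one_iff_eq hu2]
  refine mul_left_cancel₀ h ?_
  rw [jacobiH_sq hτ, jacobiT1_sq hτ, jacobiT_sq hτ]
  linear_combination (thetaSqA τ 0 * thetaSqA τ u + thetaSqB τ 0 * thetaSqB τ u) * hc
    + (thetaSqB τ 0 * thetaSqA τ u - thetaSqA τ 0 * thetaSqB τ u) * hk2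

/-! ### Analyticity and zeros -/

theorem differentiable_jacobiTheta₂_affine {τ : ℂ} (hτ : 0 < τ.im) (a b : ℂ) :
    Differentiable ℂ fun u => jacobiTheta₂ (u / a + b) τ := fun u =>
  DifferentiableAt.comp (g := fun z => jacobiTheta₂ z τ) (f := fun u => u / a + b) u
    (differentiableAt_jacobiTheta₂_fst (u / a + b) hτ) (by fun_prop)

theorem differentiable_jacobiT {τ : ℂ} (hτ : 0 < τ.im) : Differentiable ℂ (jacobiT τ) :=
  differentiable_jacobiTheta₂_affine hτ _ _

theorem differentiable_jacobiT1 {τ : ℂ} (hτ : 0 < τ.im) : Differentiable ℂ (jacobiT1 τ) :=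
  (differentiable_jacobiT hτ).comp (by fun_prop)

theorem differentiable_jacobiH1 {τ : ℂ} (hτ : 0 < τ.im) : Differentiable ℂ (jacobiH1 τ) := by
  rw [funext (jacobiH1_eq hτ)]
  exact Differentiable.mul (by fun_prop) (differentiable_jacobiTheta₂_affine hτ _ _)

theorem differentiable_sigmaFun {τ : ℂ} (hτ : 0 < τ.im) : Differentiable ℂ (sigmaFun τ) := by
  unfold sigmaFun
  simp only [add_assoc]
  exact Differentiable.mul (by fun_prop)
    (differentiable_jacobiTheta₂_affine (im_half_pos hτ) _ _)

/-- By the identity theorem the zeros form a discrete set, and a discrete closed subset of a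
Lindelöf space is countable. -/
theorem countable_zeros {f : ℂ → ℂ} (hf : Differentiable ℂ f) {u : ℂ} (hu : f u ≠ 0) :
    {w | f w = 0}.Countable := by
  have ha : AnalyticOnNhd ℂ f Set.univ := fun z _ => hf.analyticAt z
  rcases ha.eqOn_zero_or_eventually_ne_zero_of_preconnected isPreconnected_univ with h | h
  · exact absurd (h (Set.mem_univ u)) hu
  · have hd : {w | f w = 0}ᶜ ∈ Filter.codiscreteWithin Set.univ := h
    have := (HereditarilyLindelofSpace.isLindelof _).countable_of_isDiscrete
      (isDiscrete_of_codiscreteWithin hd)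
    rwa [Set.inter_univ] at this

/-- `w` is not a zero of any of the theta functions used here. -/
def ThetaGeneric (τ w : ℂ) : Prop :=
  jacobiT τ w ≠ 0 ∧ jacobiT1 τ w ≠ 0 ∧ jacobiH1 τ w ≠ 0 ∧ sigmaFun τ w ≠ 0

theorem countable_not_thetaGeneric {τ : ℂ} (hτ : 0 < τ.im) :
    {w | ¬ ThetaGeneric τ w}.Countable := by
  refine (((countable_zeros (differentiable_jacobiT hτ) (jacobiT_zero_ne_zero hτ)).union
    (countable_zeros (differentiable_jacobiT1 hτ) (jacobiT1_zero_ne_zero hτ))).union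
    ((countable_zeros (differentiable_jacobiH1 hτ) (jacobiH1_zero_ne_zero hτ)).union
    (countable_zeros (differentiable_sigmaFun hτ) (sigmaFun_two_ellK_ne_zero hτ)))).mono ?_
  intro w hw
  by_contra hcon
  simp only [Set.mem_union, Set.mem_ofPred_eq, not_or] at hcon
  exact hw ⟨hcon.1.1, hcon.1.2, hcon.2.1, hcon.2.2⟩

/-! ### One step of the action of `s₂` -/

theorem cd_sub_cd_of_eq {τ : ℂ} (hτ : 0 < τ.im) {u v s d : ℂ} (hs : u + v = s) (hd : u - v = d)
    (hu : CdFinite τ u) (hv : CdFinite τ v) :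
    cd τ u - cd τ v = exp (Real.pi * I * τ / 4) / sqrtModulus τ
      * (sigmaFun τ s * sigmaFun τ d) / (jacobiT1 τ u * jacobiT1 τ v) := by
  rw [cd_sub_cd hτ hu hv, hs, hd]

theorem sigmaFun_ne_zero_of_cd_ne_of_eq {τ : ℂ} (hτ : 0 < τ.im) {u v s d : ℂ} (hs : u + v = s)
    (hd : u - v = d) (hu : CdFinite τ u) (hv : CdFinite τ v) (h : cd τ u ≠ cd τ v) :
    sigmaFun τ s ≠ 0 ∧ sigmaFun τ d ≠ 0 := by
  rw [← hs, ← hd]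
  exact sigmaFun_ne_zero_of_cd_ne hτ hu hv h

theorem exp_div_sqrtModulus_ne_zero {τ : ℂ} (hτ : 0 < τ.im) :
    exp (Real.pi * I * τ / 4) / sqrtModulus τ ≠ 0 :=
  div_ne_zero (exp_ne_zero _) (sqrtModulus_ne_zero hτ)

theorem one_sub_div_eq {a b : ℂ} (hb : b ≠ 0) : 1 - a / b = (b - a) / b := by
  rw [sub_div, div_self hb]

theorem one_sub_div_div_one_sub_div {a b c : ℂ} (hb : b ≠ 0) :
    (1 - a / b) / (1 - c / b) = (b - a) / (b - c) := by
  rw [one_sub_div_eq hb, one_sub_div_eq hb, div_div_div_cancel_right₀ hb]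

theorem ne_of_one_sub_div_ne_zero {a b : ℂ} (hb : b ≠ 0) (h : 1 - a / b ≠ 0) : b ≠ a := by
  rintro rfl
  exact h (by rw [div_self hb, sub_self])

/-- The part of the regularity of `s₂` that concerns the parameters only. -/
def S2ConstRegular (τ c1 c2 η : ℂ) : Prop :=
  (∀ u ∈ [η, η - c1, η - c2, η + c1, η + c2, 2 * η - (c1 - c2) / 2, 2 * η + (c1 - c2) / 2,
      (c1 + c2) / 2], CdFinite τ u)
  ∧ cd τ η ≠ 0 ∧ cd τ ((c1 + c2) / 2) ≠ 0
  ∧ 1 - cd τ (η - c1) / cd τ η ≠ 0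
  ∧ 1 - cd τ (η + c2) / cd τ η ≠ 0
  ∧ 1 - cd τ (2 * η + (c1 - c2) / 2) / cd τ ((c1 + c2) / 2) ≠ 0

theorem S2Regular.constRegular {τ c1 c2 η x y : ℂ} (h : S2Regular τ c1 c2 η x y) :
    S2ConstRegular τ c1 c2 η :=
  ⟨h.1, h.2.1, h.2.2.1, h.2.2.2.1, h.2.2.2.2.1, h.2.2.2.2.2.1⟩

/-- The constant of `s₂` as a product of theta functions. -/
theorem s2Const_eq {τ : ℂ} (hτ : 0 < τ.im) {c1 c2 η : ℂ} (h : S2ConstRegular τ c1 c2 η) :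
    s2Const τ c1 c2 η
      = jacobiT1 τ (2 * η + (c1 - c2) / 2) * jacobiT1 τ (η + c2) * jacobiT1 τ (η - c1)
        / (jacobiT1 τ (2 * η - (c1 - c2) / 2) * jacobiT1 τ (η + c1) * jacobiT1 τ (η - c2)) := by
  obtain ⟨hf, h0, h12, h1, h2, h3⟩ := h
  simp only [List.mem_cons, List.not_mem_nil, or_false, forall_eq_or_imp, forall_eq] at hf
  obtain ⟨f0, f1, f2, f3, f4, f5, f6, f7⟩ := hf
  obtain ⟨s1, s1'⟩ := sigmaFun_ne_zero_of_cd_ne_of_eq hτ (s := 2 * η - c1) (d := c1) (by ring)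
    (by ring) f0 f1 (ne_of_one_sub_div_ne_zero h0 h1)
  obtain ⟨s2, s2'⟩ := sigmaFun_ne_zero_of_cd_ne_of_eq hτ (s := 2 * η + c2) (d := -c2) (by ring)
    (by ring) f0 f4 (ne_of_one_sub_div_ne_zero h0 h2)
  obtain ⟨s3, s3'⟩ := sigmaFun_ne_zero_of_cd_ne_of_eq hτ (s := 2 * η + c1) (d := -(2 * η - c2))
    (by ring) (by ring) f7 f6 (ne_of_one_sub_div_ne_zero h12 h3)
  rw [s2Const, one_sub_div_div_one_sub_div h0, one_sub_div_div_one_sub_div h0,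
    one_sub_div_div_one_sub_div h12,
    cd_sub_cd_of_eq hτ (s := 2 * η - c2) (d := c2) (by ring) (by ring) f0 f2,
    cd_sub_cd_of_eq hτ (s := 2 * η - c1) (d := c1) (by ring) (by ring) f0 f1,
    cd_sub_cd_of_eq hτ (s := 2 * η + c1) (d := -c1) (by ring) (by ring) f0 f3,
    cd_sub_cd_of_eq hτ (s := 2 * η + c2) (d := -c2) (by ring) (by ring) f0 f4,
    cd_sub_cd_of_eq hτ (s := 2 * η + c2) (d := -(2 * η - c1)) (by ring) (by ring) f7 f5,
    cd_sub_cd_of_eq hτ (s := 2 * η + c1) (d := -(2 * η - c2)) (by ring) (by ring) f7 f6]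
  have hC := exp_div_sqrtModulus_ne_zero hτ
  simp only [sigmaFun_neg, neg_ne_zero] at *
  unfold CdFinite at *
  generalize exp (Real.pi * I * τ / 4) / sqrtModulus τ = C at *
  generalize sigmaFun τ (2 * η - c1) = q1 at *
  generalize sigmaFun τ (2 * η + c1) = q2 at *
  generalize sigmaFun τ (2 * η - c2) = q3 at *
  generalize sigmaFun τ (2 * η + c2) = q4 at *
  generalize sigmaFun τ c1 = q5 at *
  generalize sigmaFun τ c2 = q6 at *
  generalize jacobiT1 τ (2 * η + (c1 - c2) / 2) = t1 at *
  generalize jacobiT1 τ (2 * η - (c1 - c2) / 2) = t2 at *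
  field_simp

/-- On the invariant elliptic curve, `s₂` acts by a translation. -/
theorem s2_curve {τ : ℂ} (hτ : 0 < τ.im) {c1 c2 η : ℂ} (h : S2ConstRegular τ c1 c2 η) {a : ℂ}
    (ha1 : CdFinite τ (η + a)) (ha2 : CdFinite τ (η - a)) (ha : CdFinite τ (a + (c1 + c2) / 2)) :
    (cd τ (a + (c1 + c2) / 2) - cd τ (2 * η - (c1 - c2) / 2))
        * (cd τ (η + a) - cd τ (η + c1)) * (cd τ (η - a) - cd τ (η - c2))
      = s2Const τ c1 c2 η * (cd τ (a + (c1 + c2) / 2) - cd τ (2 * η + (c1 - c2) / 2))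
        * (cd τ (η + a) - cd τ (η + c2)) * (cd τ (η - a) - cd τ (η - c1)) := by
  rw [s2Const_eq hτ h]
  obtain ⟨hf, -⟩ := h
  simp only [List.mem_cons, List.not_mem_nil, or_false, forall_eq_or_imp, forall_eq] at hf
  obtain ⟨f0, f1, f2, f3, f4, f5, f6, f7⟩ := hf
  -- After factorisation both sides contain the same six values of `σ`; what remains are values of
  -- `Θ₁`, which make up the constant of `s₂`.
  rw [cd_sub_cd_of_eq hτ (s := 2 * η + a + c2) (d := -(2 * η - a - c1)) (by ring) (by ring) ha f5,
    cd_sub_cd_of_eq hτ (s := 2 * η + a + c1) (d := -(2 * η - a - c2)) (by ring) (by ring) ha f6,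
    cd_sub_cd_of_eq hτ (s := 2 * η + a + c1) (d := -(c1 - a)) (by ring) (by ring) ha1 f3,
    cd_sub_cd_of_eq hτ (s := 2 * η + a + c2) (d := -(c2 - a)) (by ring) (by ring) ha1 f4,
    cd_sub_cd_of_eq hτ (s := 2 * η - a - c1) (d := c1 - a) (by ring) (by ring) ha2 f1,
    cd_sub_cd_of_eq hτ (s := 2 * η - a - c2) (d := c2 - a) (by ring) (by ring) ha2 f2]
  simp only [sigmaFun_neg]
  unfold CdFinite at *
  generalize exp (Real.pi * I * τ / 4) / sqrtModulus τ = C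
  generalize jacobiT1 τ (2 * η + (c1 - c2) / 2) = t1 at *
  generalize jacobiT1 τ (2 * η - (c1 - c2) / 2) = t2 at *
  generalize jacobiT1 τ (a + (c1 + c2) / 2) = t3 at *
  field_simp

/-- With denominators cleared, the left side is a bidegree (1,1) form in `x, y`. It vanishes at the
curve points of `c₁` and `c₂` by inspection and at that of `a` by `s2_curve`, hence is a multiple of
`pP`. -/
theorem s2y_sub_mul {τ : ℂ} (hτ : 0 < τ.im) {c1 c2 η x y : ℂ} (h : S2Regular τ c1 c2 η x y)
    {a : ℂ} (ha1 : CdFinite τ (η + a)) (ha2 : CdFinite τ (η - a))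
    (ha : CdFinite τ (a + (c1 + c2) / 2)) :
    (s2y τ c1 c2 η x y - cd τ (a + (c1 + c2) / 2))
        * ((1 - s2Ratio τ c1 c2 η x y) * (x - cd τ (η + c1)) * (y - cd τ (η - c2)))
        * ((cd τ (η + a) - cd τ (η + c2)) * (cd τ (η - a) - cd τ (η - c1)))
      = (cd τ (2 * η - (c1 - c2) / 2) - cd τ (a + (c1 + c2) / 2)) * pP τ c1 c2 a η x y := by
  have hc := s2_curve hτ h.constRegular ha1 ha2 ha
  obtain ⟨-, -, -, -, -, -, hx1, hx2, hy1, hy2, hAB, hM⟩ := h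
  have hM' : s2Ratio τ c1 c2 η x y * (x - cd τ (η + c1)) * (y - cd τ (η - c2))
      = s2Const τ c1 c2 η * (x - cd τ (η + c2)) * (y - cd τ (η - c1)) := by
    rw [s2Ratio]
    rw [← sub_ne_zero] at hx1 hy2
    field_simp
  have hs : s2y τ c1 c2 η x y * (1 - s2Ratio τ c1 c2 η x y)
      = cd τ (2 * η - (c1 - c2) / 2)
        - s2Ratio τ c1 c2 η x y * cd τ (2 * η + (c1 - c2) / 2) := by
    rw [s2y, div_mul_cancel₀ _ (sub_ne_zero.2 hM.symm)]
  rw [pP]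
  generalize s2Ratio τ c1 c2 η x y = M at *
  generalize s2Const τ c1 c2 η = G at *
  generalize s2y τ c1 c2 η x y = Y at *
  generalize cd τ (2 * η - (c1 - c2) / 2) = A at *
  generalize cd τ (2 * η + (c1 - c2) / 2) = B at *
  generalize cd τ (a + (c1 + c2) / 2) = w at *
  generalize cd τ (η + c1) = p1 at *
  generalize cd τ (η + c2) = p2 at *
  generalize cd τ (η + a) = p3 at *
  generalize cd τ (η - c1) = m1 at *
  generalize cd τ (η - c2) = m2 at *
  generalize cd τ (η - a) = m3 at *
  linear_combination ((x - p1) * (y - m2) * (p3 - p2) * (m3 - m1)) * hs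
    + (-(B - w) * (p3 - p2) * (m3 - m1)) * hM' - ((x - p2) * (y - m1)) * hc

/-- On the invariant curve, the value of `s₂(y)`. -/
theorem s2y_curve {τ : ℂ} (hτ : 0 < τ.im) {c1 c2 η u : ℂ}
    (h : S2Regular τ c1 c2 η (cd τ (η + u)) (cd τ (η - u)))
    (hu1 : CdFinite τ (η + u)) (hu2 : CdFinite τ (η - u)) (hu : CdFinite τ (u + (c1 + c2) / 2)) :
    s2y τ c1 c2 η (cd τ (η + u)) (cd τ (η - u)) = cd τ (u + (c1 + c2) / 2) := by
  have hc := s2_curve hτ h.constRegular hu1 hu2 hu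
  obtain ⟨-, -, -, -, -, -, hx1, hx2, hy1, hy2, hAB, hM⟩ := h
  rw [s2y, div_eq_iff (sub_ne_zero.2 hM.symm)]
  rw [← sub_ne_zero] at hx1 hy2
  refine mul_left_cancel₀ hx1 (mul_left_cancel₀ hy2 ?_)
  have hM' : s2Ratio τ c1 c2 η (cd τ (η + u)) (cd τ (η - u)) * (cd τ (η + u) - cd τ (η + c1))
        * (cd τ (η - u) - cd τ (η - c2))
      = s2Const τ c1 c2 η * (cd τ (η + u) - cd τ (η + c2)) * (cd τ (η - u) - cd τ (η - c1)) := by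
    rw [s2Ratio]
    field_simp
  linear_combination (cd τ (u + (c1 + c2) / 2) - cd τ (2 * η + (c1 - c2) / 2)) * hM' - hc

/-! ### Two steps with disjoint pairs of parameters -/

/-- The value of `y` after the action of `s₂` with the parameters `a₁, a₂` and then with the
parameters `a₃, a₄`. -/
noncomputable def twoStepY (τ a1 a2 a3 a4 b X Y : ℂ) : ℂ :=
  s2y τ (a3 + (2 * b + a1 + a2) / 4) (a4 + (2 * b + a1 + a2) / 4) (b - (2 * b + a1 + a2) / 4) X
    (s2y τ a1 a2 b X Y)

/-- The formulas for both steps, and those of the resulting equation, have no poles and no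
vanishing denominators. -/
def TwoStepRegular (τ a1 a2 a3 a4 b X Y : ℂ) : Prop :=
  S2Regular τ a1 a2 b X Y
  ∧ S2Regular τ (a3 + (2 * b + a1 + a2) / 4) (a4 + (2 * b + a1 + a2) / 4)
      (b - (2 * b + a1 + a2) / 4) X (s2y τ a1 a2 b X Y)
  ∧ GPRegular τ a1 a2 a3 a4 b X Y
  ∧ cd τ (b + a3) ≠ cd τ (b + a2) ∧ cd τ (b + a4) ≠ cd τ (b + a2)
  ∧ cd τ (b - a3) ≠ cd τ (b - a1) ∧ cd τ (b - a4) ≠ cd τ (b - a1)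
  ∧ twoStepY τ a1 a2 a3 a4 b X Y ≠ 0

/-- The constant of the composite of two steps. -/
noncomputable def twoStepConst (τ a1 a2 a3 a4 b : ℂ) : ℂ :=
  jacobiT1 τ (b + a3 - (a1 + a2 + a3 + a4) / 2) * jacobiT1 τ (b - a3)
      * (sigmaFun τ (a4 - a1) * sigmaFun τ (a4 - a2))
    / (jacobiT1 τ (b + a4 - (a1 + a2 + a3 + a4) / 2) * jacobiT1 τ (b - a4)
      * (sigmaFun τ (a3 - a1) * sigmaFun τ (a3 - a2)))

theorem TwoStepRegular.cdFinite {τ : ℂ} (hτ : 0 < τ.im) {a1 a2 a3 a4 b X Y : ℂ}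
    (h : TwoStepRegular τ a1 a2 a3 a4 b X Y) :
    (CdFinite τ (a3 + (a1 + a2) / 2) ∧ CdFinite τ (a4 + (a1 + a2) / 2))
    ∧ (CdFinite τ (b + a3 - (a1 + a2 + a3 + a4) / 2)
      ∧ CdFinite τ (b + a4 - (a1 + a2 + a3 + a4) / 2)) := by
  obtain ⟨-, ⟨hf, -⟩, -⟩ := h
  simp only [List.mem_cons, List.not_mem_nil, or_false, forall_eq_or_imp, forall_eq] at hf
  obtain ⟨-, f1, f2, -, -, f5, f6, -⟩ := hf
  refine ⟨⟨?_, ?_⟩, ⟨?_, ?_⟩⟩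
  · rw [← cdFinite_neg hτ]
    convert f1 using 1
    ring
  · rw [← cdFinite_neg hτ]
    convert f2 using 1
    ring
  · convert f6 using 1
    ring
  · convert f5 using 1
    ring

/-- Solves `s2y_sub_mul` for `P`. The prefactor `-(C t₅/(t₂ t₄)) D` does not involve the third
parameter `a`, so it drops out of the quotient of the two instances `a = a₃` and `a = a₄`. -/
theorem solve_twoStep_factor {C s s' q r t1 t2 t3 t4 t5 t6 v D P : ℂ} (hC : C ≠ 0) (hs : s ≠ 0)
    (hs' : s' ≠ 0) (h1 : t1 ≠ 0) (h2 : t2 ≠ 0) (h3 : t3 ≠ 0) (h4 : t4 ≠ 0) (h5 : t5 ≠ 0)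
    (h6 : t6 ≠ 0)
    (h : v * D * (C * (s * r) / (t1 * t2) * (C * (s' * -q) / (t3 * t4)))
      = C * (s * s') / (t5 * t6) * P) :
    P = -(C * t5 / (t2 * t4)) * D * (v * (q * r) * t6 / (t1 * t3)) := by
  field_simp at h
  field_simp
  linear_combination -h

/-- The second action of `s₂` sees the intermediate value `v = s₂(y)` only through the quotient of
`v - cd(a₃ + (a₁ + a₂)/2)` and `v - cd(a₄ + (a₁ + a₂)/2)`; `s2y_sub_mul` expresses this quotient by
the polynomials `P`. -/
theorem twoStep_ratio {τ : ℂ} (hτ : 0 < τ.im) {a1 a2 a3 a4 b X Y : ℂ}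
    (h : TwoStepRegular τ a1 a2 a3 a4 b X Y) :
    pP τ a1 a2 a3 b X Y ≠ 0
    ∧ X - cd τ (b + a3) ≠ 0 ∧ X - cd τ (b + a4) ≠ 0
    ∧ cd τ (b + a4 - (a1 + a2 + a3 + a4) / 2) ≠ cd τ (b + a3 - (a1 + a2 + a3 + a4) / 2)
    ∧ twoStepY τ a1 a2 a3 a4 b X Y ≠ cd τ (b + a3 - (a1 + a2 + a3 + a4) / 2)
    ∧ (twoStepY τ a1 a2 a3 a4 b X Y - cd τ (b + a4 - (a1 + a2 + a3 + a4) / 2))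
        / (twoStepY τ a1 a2 a3 a4 b X Y - cd τ (b + a3 - (a1 + a2 + a3 + a4) / 2))
        * ((X - cd τ (b + a3)) / (X - cd τ (b + a4)))
      = twoStepConst τ a1 a2 a3 a4 b * (pP τ a1 a2 a3 b X Y / pP τ a1 a2 a4 b X Y) := by
  obtain ⟨⟨g3, g4⟩, ⟨gB, gA⟩⟩ := h.cdFinite hτ
  obtain ⟨h1, h2, ⟨-, hfin, hP4⟩, n32, n42, m31, m41, hne⟩ := h
  simp only [List.mem_cons, List.not_mem_nil, or_false, forall_eq_or_imp, forall_eq] at hfin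
  obtain ⟨⟨fm1, fp1⟩, ⟨fm2, fp2⟩, ⟨fm3, fp3⟩, ⟨fm4, fp4⟩⟩ := hfin
  have k3 := s2y_sub_mul hτ h1 fp3 fm3 g3
  have k4 := s2y_sub_mul hτ h1 fp4 fm4 g4
  have hS := (s2y_spec τ _ _ _ _ _ h2 _).2 rfl
  have hG := s2Const_eq hτ h2.constRegular
  rw [hG] at hS
  have e1 : b - (2 * b + a1 + a2) / 4 + (a3 + (2 * b + a1 + a2) / 4) = b + a3 := by ring
  have e2 : b - (2 * b + a1 + a2) / 4 + (a4 + (2 * b + a1 + a2) / 4) = b + a4 := by ring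
  have e3 : b - (2 * b + a1 + a2) / 4 - (a3 + (2 * b + a1 + a2) / 4) = -(a3 + (a1 + a2) / 2) := by
    ring
  have e4 : b - (2 * b + a1 + a2) / 4 - (a4 + (2 * b + a1 + a2) / 4) = -(a4 + (a1 + a2) / 2) := by
    ring
  have e5 : 2 * (b - (2 * b + a1 + a2) / 4)
      - (a3 + (2 * b + a1 + a2) / 4 - (a4 + (2 * b + a1 + a2) / 4)) / 2
      = b + a4 - (a1 + a2 + a3 + a4) / 2 := by ring
  have e6 : 2 * (b - (2 * b + a1 + a2) / 4)
      + (a3 + (2 * b + a1 + a2) / 4 - (a4 + (2 * b + a1 + a2) / 4)) / 2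
      = b + a3 - (a1 + a2 + a3 + a4) / 2 := by ring
  rw [← twoStepY, e1, e2, e3, e4, e5, e6, cd_neg hτ, cd_neg hτ, jacobiT1_neg hτ,
    jacobiT1_neg hτ] at hS
  obtain ⟨-, -, -, -, -, -, hx3, hx4, hy3, hy4, hAB, -⟩ := h2
  rw [e1] at hx3
  rw [e2] at hx4
  rw [e3, cd_neg hτ] at hy3
  rw [e4, cd_neg hτ] at hy4
  rw [e5, e6] at hAB
  obtain ⟨hf1, -, -, -, -, -, hx1, -, -, hy2, -, hM⟩ := h1
  simp only [List.mem_cons, List.not_mem_nil, or_false, forall_eq_or_imp, forall_eq] at hf1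
  obtain ⟨-, -, -, -, -, fA, -, -⟩ := hf1
  have hD : (1 - s2Ratio τ a1 a2 b X Y) * (X - cd τ (b + a1)) * (Y - cd τ (b - a2)) ≠ 0 :=
    mul_ne_zero (mul_ne_zero (sub_ne_zero.2 hM.symm) (sub_ne_zero.2 hx1)) (sub_ne_zero.2 hy2)
  obtain ⟨s1, s2⟩ := sigmaFun_ne_zero_of_cd_ne_of_eq hτ (s := 2 * b + a2 + a3) (d := a3 - a2)
    (by ring) (by ring) fp3 fp2 n32
  obtain ⟨s3, s4⟩ := sigmaFun_ne_zero_of_cd_ne_of_eq hτ (s := 2 * b + a2 + a4) (d := a4 - a2)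
    (by ring) (by ring) fp4 fp2 n42
  obtain ⟨s5, s6⟩ := sigmaFun_ne_zero_of_cd_ne_of_eq hτ (s := 2 * b - a1 - a3) (d := -(a3 - a1))
    (by ring) (by ring) fm3 fm1 m31
  obtain ⟨s7, s8⟩ := sigmaFun_ne_zero_of_cd_ne_of_eq hτ (s := 2 * b - a1 - a4) (d := -(a4 - a1))
    (by ring) (by ring) fm4 fm1 m41
  rw [cd_sub_cd_of_eq hτ (s := 2 * b + a2 + a3) (d := a3 - a2) (by ring) (by ring) fp3 fp2,
    cd_sub_cd_of_eq hτ (s := 2 * b - a1 - a3) (d := -(a3 - a1)) (by ring) (by ring) fm3 fm1,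
    cd_sub_cd_of_eq hτ (s := 2 * b + a2 + a3) (d := 2 * b - a1 - a3) (by ring) (by ring) fA g3]
    at k3
  rw [cd_sub_cd_of_eq hτ (s := 2 * b + a2 + a4) (d := a4 - a2) (by ring) (by ring) fp4 fp2,
    cd_sub_cd_of_eq hτ (s := 2 * b - a1 - a4) (d := -(a4 - a1)) (by ring) (by ring) fm4 fm1,
    cd_sub_cd_of_eq hτ (s := 2 * b + a2 + a4) (d := 2 * b - a1 - a4) (by ring) (by ring) fA g4]
    at k4
  have hC := exp_div_sqrtModulus_ne_zero hτ
  rw [← sub_ne_zero] at hx3 hx4 hy3 hy4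
  rw [sigmaFun_neg, neg_ne_zero] at s6 s8
  rw [sigmaFun_neg] at k3 k4
  have p3 := solve_twoStep_factor hC s1 s5 fp3 fp2 fm3 fm1 fA g3 k3
  have p4 := solve_twoStep_factor hC s3 s7 fp4 fp2 fm4 fm1 fA g4 k4
  unfold CdFinite at *
  have hE : -(exp (Real.pi * I * τ / 4) / sqrtModulus τ * jacobiT1 τ (2 * b - (a1 - a2) / 2)
      / (jacobiT1 τ (b + a2) * jacobiT1 τ (b - a1)))
      * ((1 - s2Ratio τ a1 a2 b X Y) * (X - cd τ (b + a1)) * (Y - cd τ (b - a2))) ≠ 0 :=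
    mul_ne_zero (neg_ne_zero.2 (div_ne_zero (mul_ne_zero hC fA) (mul_ne_zero fp2 fm1))) hD
  refine ⟨?_, hx3, hx4, hAB, hS.1, ?_⟩
  · rw [p3]
    exact mul_ne_zero hE (div_ne_zero (mul_ne_zero (mul_ne_zero hy3 (mul_ne_zero s6 s2)) g3)
      (mul_ne_zero fp3 fm3))
  · replace hS := hS.2
    rw [twoStepConst, p3, p4, mul_div_mul_left _ _ hE]
    clear p3 p4 k3 k4 hE hD
    generalize twoStepY τ a1 a2 a3 a4 b X Y - cd τ (b + a4 - (a1 + a2 + a3 + a4) / 2) = n at *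
    generalize twoStepY τ a1 a2 a3 a4 b X Y - cd τ (b + a3 - (a1 + a2 + a3 + a4) / 2) = d at *
    generalize s2y τ a1 a2 b X Y - cd τ (a3 + (a1 + a2) / 2) = v3 at *
    generalize s2y τ a1 a2 b X Y - cd τ (a4 + (a1 + a2) / 2) = v4 at *
    -- The quotient of the intermediate differences and its inverse are inserted so that the
    -- defining equation of the second `s₂` can be substituted.
    have e : n / d * ((X - cd τ (b + a3)) / (X - cd τ (b + a4)))
        = n / d * ((X - cd τ (b + a3)) / (X - cd τ (b + a4))) * (v4 / v3) * (v3 / v4) := by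
      field_simp
    rw [e, hS]
    generalize jacobiT1 τ (b + a3 - (a1 + a2 + a3 + a4) / 2) = t1 at *
    generalize jacobiT1 τ (b + a4 - (a1 + a2 + a3 + a4) / 2) = t2 at *
    generalize jacobiT1 τ (a3 + (a1 + a2) / 2) = t3 at *
    generalize jacobiT1 τ (a4 + (a1 + a2) / 2) = t4 at *
    field_simp

/-- The comparison arguments `a₂ + h`, `b - a₁`, `b + a₂ + S`, `2b + a₂ - h` are auxiliary: the
values of `σ` that they introduce, other than those at the differences `a₃ - aᵢ`, `a₄ - aᵢ` (`i = 1,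
2`), cancel between the four factors of `G`. -/
theorem gG_eq {τ : ℂ} (hτ : 0 < τ.im) {a1 a2 a3 a4 b : ℂ} (h : GRegular τ a1 a2 a3 a4 b) :
    gG τ a1 a2 a3 a4 b = twoStepConst τ a1 a2 a3 a4 b := by
  obtain ⟨hf, h1, h2, h3, h4, h5, h6, h7, h8⟩ := h
  simp only [List.mem_cons, List.not_mem_nil, or_false, forall_eq_or_imp, forall_eq] at hf
  obtain ⟨f0, f1, f2, f3, f4, f5, f6, f7, f8, f9⟩ := hf
  obtain ⟨s1, s1'⟩ := sigmaFun_ne_zero_of_cd_ne_of_eq hτ (s := a1 + 2 * a2 + a3)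
    (d := -(a3 - a2)) (by ring) (by ring) f0 f1 (ne_of_one_sub_div_ne_zero h1 h5)
  obtain ⟨s2, s2'⟩ := sigmaFun_ne_zero_of_cd_ne_of_eq hτ (s := 2 * b - a1 - a3) (d := a3 - a1)
    (by ring) (by ring) f3 f4 (ne_of_one_sub_div_ne_zero h2 h6)
  obtain ⟨s3, s3'⟩ := sigmaFun_ne_zero_of_cd_ne_of_eq hτ (s := 2 * b + a2 + a3)
    (d := a1 + 2 * a2 + a4) (by ring) (by ring) f6 f7 (ne_of_one_sub_div_ne_zero h3 h7)
  obtain ⟨s4, s4'⟩ := sigmaFun_ne_zero_of_cd_ne_of_eq hτ (s := 2 * b + a2 + a4)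
    (d := 2 * b - a1 - a4) (by ring) (by ring) f9 f2 (ne_of_one_sub_div_ne_zero h4 h8)
  rw [gG, twoStepConst, one_sub_div_div_one_sub_div h1, one_sub_div_div_one_sub_div h2,
    one_sub_div_div_one_sub_div h3, one_sub_div_div_one_sub_div h4,
    cd_sub_cd_of_eq hτ (s := a1 + 2 * a2 + a4) (d := -(a4 - a2)) (by ring) (by ring) f0 f2,
    cd_sub_cd_of_eq hτ (s := a1 + 2 * a2 + a3) (d := -(a3 - a2)) (by ring) (by ring) f0 f1,
    cd_sub_cd_of_eq hτ (s := 2 * b - a1 - a4) (d := a4 - a1) (by ring) (by ring) f3 f5,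
    cd_sub_cd_of_eq hτ (s := 2 * b - a1 - a3) (d := a3 - a1) (by ring) (by ring) f3 f4,
    cd_sub_cd_of_eq hτ (s := 2 * b + a2 + a4) (d := a1 + 2 * a2 + a3) (by ring) (by ring) f6 f8,
    cd_sub_cd_of_eq hτ (s := 2 * b + a2 + a3) (d := a1 + 2 * a2 + a4) (by ring) (by ring) f6 f7,
    cd_sub_cd_of_eq hτ (s := 2 * b + a2 + a3) (d := 2 * b - a1 - a3) (by ring) (by ring) f9 f1,
    cd_sub_cd_of_eq hτ (s := 2 * b + a2 + a4) (d := 2 * b - a1 - a4) (by ring) (by ring) f9 f2]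
  have hC := exp_div_sqrtModulus_ne_zero hτ
  rw [sigmaFun_neg, neg_ne_zero] at s1'
  rw [sigmaFun_neg, sigmaFun_neg]
  unfold CdFinite at *
  clear h1 h2 h3 h4 h5 h6 h7 h8
  generalize exp (Real.pi * I * τ / 4) / sqrtModulus τ = C at *
  generalize jacobiT1 τ (a2 + (a1 + a2) / 2) = t0 at *
  generalize jacobiT1 τ (a3 + (a1 + a2) / 2) = t1 at *
  generalize jacobiT1 τ (a4 + (a1 + a2) / 2) = t2 at *
  generalize jacobiT1 τ (b + a2 + (a1 + a2 + a3 + a4) / 2) = t6 at *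
  generalize jacobiT1 τ (b + a3 - (a1 + a2 + a3 + a4) / 2) = t7 at *
  generalize jacobiT1 τ (b + a4 - (a1 + a2 + a3 + a4) / 2) = t8 at *
  generalize jacobiT1 τ (2 * b + a2 - (a1 + a2) / 2) = t9 at *
  generalize sigmaFun τ (a1 + 2 * a2 + a3) = q1 at *
  generalize sigmaFun τ (a1 + 2 * a2 + a4) = q2 at *
  generalize sigmaFun τ (2 * b - a1 - a3) = q3 at *
  generalize sigmaFun τ (2 * b - a1 - a4) = q4 at *
  generalize sigmaFun τ (2 * b + a2 + a3) = q5 at *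
  generalize sigmaFun τ (2 * b + a2 + a4) = q6 at *
  field_simp

/-- The ratio of two values of `kcd(u) Y + 1` in terms of `-1 / (k Y)`. -/
theorem mQ_neg_inv {τ : ℂ} (hτ : 0 < τ.im) (u v : ℂ) {y : ℂ} (hy : y ≠ 0) :
    mQ τ u v (-1 / (modulus τ * y)) = (y - cd τ u) / (y - cd τ v) := by
  have hk := modulus_ne_zero hτ
  have e : ∀ w, modulus τ * cd τ w * (-1 / (modulus τ * y)) + 1 = (y - cd τ w) / y := by
    intro w
    field_simp
    ring
  rw [mQ, e, e, div_div_div_cancel_right₀ hy]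

theorem mQRegular_neg_inv {τ : ℂ} (hτ : 0 < τ.im) {u v y : ℂ} (hy : y ≠ 0) :
    MQRegular τ u v (-1 / (modulus τ * y)) ↔ CdFinite τ u ∧ CdFinite τ v ∧ y ≠ cd τ v := by
  have hk := modulus_ne_zero hτ
  have e : modulus τ * cd τ v * (-1 / (modulus τ * y)) + 1 = (y - cd τ v) / y := by
    field_simp
    ring
  rw [MQRegular, e, div_ne_zero_iff, sub_ne_zero]
  simp [hy]

theorem mQ_injective {τ : ℂ} (hτ : 0 < τ.im) {u v Y Z : ℂ} (huv : cd τ u ≠ cd τ v)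
    (hY : modulus τ * cd τ v * Y + 1 ≠ 0) (hZ : modulus τ * cd τ v * Z + 1 ≠ 0)
    (h : mQ τ u v Y = mQ τ u v Z) : Y = Z := by
  have hk := modulus_ne_zero hτ
  rw [mQ, mQ, div_eq_div_iff hY hZ] at h
  have h0 : modulus τ * (cd τ u - cd τ v) * (Y - Z) = 0 := by linear_combination h
  have h1 := (mul_eq_zero.1 h0).resolve_left (mul_ne_zero hk (sub_ne_zero.2 huv))
  exact sub_eq_zero.1 h1

/-- Existence is `twoStep_ratio` rewritten through `Z = -1/(kY)`. Uniqueness holds because the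
unknown enters by a Möbius map, nondegenerate since its two values of `cd` differ. -/
theorem twoStep_iff {τ : ℂ} (hτ : 0 < τ.im) {a1 a2 a3 a4 b X Y : ℂ}
    (h : TwoStepRegular τ a1 a2 a3 a4 b X Y) (Z : ℂ) :
    (MQRegular τ (b + a4 - (a1 + a2 + a3 + a4) / 2) (b + a3 - (a1 + a2 + a3 + a4) / 2) Z
      ∧ LQRegular τ (b + a3) (b + a4) X ∧ GPRegular τ a1 a2 a3 a4 b X Y
      ∧ mQ τ (b + a4 - (a1 + a2 + a3 + a4) / 2) (b + a3 - (a1 + a2 + a3 + a4) / 2) Z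
          * lQ τ (b + a3) (b + a4) X = gP τ a1 a2 a3 a4 b X Y)
      ↔ Z = -1 / (modulus τ * twoStepY τ a1 a2 a3 a4 b X Y) := by
  obtain ⟨-, hx3, hx4, hAB, hB, hr⟩ := twoStep_ratio hτ h
  obtain ⟨-, ⟨gB, gA⟩⟩ := h.cdFinite hτ
  have hGP : GPRegular τ a1 a2 a3 a4 b X Y := h.2.2.1
  have hy : twoStepY τ a1 a2 a3 a4 b X Y ≠ 0 := h.2.2.2.2.2.2.2
  have hm : MQRegular τ (b + a4 - (a1 + a2 + a3 + a4) / 2) (b + a3 - (a1 + a2 + a3 + a4) / 2)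
      (-1 / (modulus τ * twoStepY τ a1 a2 a3 a4 b X Y)) :=
    (mQRegular_neg_inv hτ hy).2 ⟨gA, gB, hB⟩
  have heq : mQ τ (b + a4 - (a1 + a2 + a3 + a4) / 2) (b + a3 - (a1 + a2 + a3 + a4) / 2)
      (-1 / (modulus τ * twoStepY τ a1 a2 a3 a4 b X Y))
          * lQ τ (b + a3) (b + a4) X = gP τ a1 a2 a3 a4 b X Y := by
    rw [mQ_neg_inv hτ _ _ hy, lQ, gP, gG_eq hτ hGP.1]
    exact hr
  constructor
  · rintro ⟨h1, -, -, h4⟩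
    rw [← heq] at h4
    exact mQ_injective hτ hAB h1.2.2 hm.2.2
      (mul_right_cancel₀ (div_ne_zero hx3 hx4 : lQ τ (b + a3) (b + a4) X ≠ 0) h4)
  · rintro rfl
    obtain ⟨-, hc, -⟩ := hGP
    simp only [List.mem_cons, List.not_mem_nil, or_false, forall_eq_or_imp, forall_eq] at hc
    exact ⟨hm, ⟨hc.2.2.1.2, hc.2.2.2.2, hx4⟩, h.2.2.1, heq⟩

/-! ### Evaluation of words -/

/-- The tuple of images of the coordinates under a word. -/
noncomputable def wordImage (τ : ℂ) (w : List Gen) (p : State) : State :=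
  w.foldl (fun p g => g.image τ p) p

/-- Letters act by substitution, so at a point the leftmost letter is applied first; on the Picard
lattice it is the rightmost. -/
theorem act_eq (τ : ℂ) (w : List Gen) (F : State → ℂ) (p : State) :
    act τ w F p = F (wordImage τ w p) := by
  induction w generalizing p with
  | nil => rfl
  | cons g w ih => exact ih (g.image τ p)

theorem wordImage_append (τ : ℂ) (v w : List Gen) (p : State) :
    wordImage τ (v ++ w) p = wordImage τ w (wordImage τ v p) :=
  List.foldl_append

theorem wordImage_cons (τ : ℂ) (g : Gen) (w : List Gen) (p : State) :
    wordImage τ (g :: w) p = wordImage τ w (g.image τ p) := rfl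

theorem wordRegular_append (τ : ℂ) (v w : List Gen) (p : State) :
    WordRegular τ (v ++ w) p ↔ WordRegular τ v p ∧ WordRegular τ w (wordImage τ v p) := by
  induction v generalizing p with
  | nil => exact ⟨fun h => ⟨trivial, h⟩, And.right⟩
  | cons g v ih =>
    rw [List.cons_append, WordRegular, WordRegular, ih, and_assoc]
    rfl

/-- The word whose square is `R_J1` up to permutations and `ι`'s. -/
def halfWord : List Gen :=
  ([5, 6, 4, 5, 3, 4, 8, 3, 7, 0, 6, 7, 5, 6, 4, 5] : List (Fin 9)).map Gen.s
    ++ (Gen.s 2 :: (([3, 4, 8, 3] : List (Fin 9)).map Gen.s ++ [Gen.s 2, Gen.s 1]))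

def permWord : List Gen := ([7, 0, 6, 7, 3, 4, 8, 3, 0, 4, 6, 8] : List (Fin 9)).map Gen.s

theorem RJ1_eq : RJ1 = halfWord ++ (halfWord ++ (permWord
    ++ [Gen.iota 3, Gen.iota 2, Gen.iota 1, Gen.iota 0])) := rfl

theorem wordImage_swapBlocks (τ : ℂ) (c : Fin 8 → ℂ) (v : ℂ × ℂ × ℂ) :
    wordImage τ (([5, 6, 4, 5, 3, 4, 8, 3, 7, 0, 6, 7, 5, 6, 4, 5] : List (Fin 9)).map Gen.s)
      (c, v) = (![c 4, c 5, c 6, c 7, c 0, c 1, c 2, c 3], v) := by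
  refine Prod.ext (funext fun i => ?_) rfl
  fin_cases i <;> rfl

theorem wordImage_swapPairs (τ : ℂ) (c : Fin 8 → ℂ) (v : ℂ × ℂ × ℂ) :
    wordImage τ (([3, 4, 8, 3] : List (Fin 9)).map Gen.s)
      (c, v) = (![c 2, c 3, c 0, c 1, c 4, c 5, c 6, c 7], v) := by
  refine Prod.ext (funext fun i => ?_) rfl
  fin_cases i <;> rfl

theorem wordImage_permWord (τ : ℂ) (c : Fin 8 → ℂ) (v : ℂ × ℂ × ℂ) :
    wordImage τ permWord (c, v) = (![c 3, c 2, c 1, c 0, c 7, c 6, c 5, c 4], v) := by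
  refine Prod.ext (funext fun i => ?_) rfl
  fin_cases i <;> rfl

/-- The sum `c₁ + c₂ + c₃ + c₄`. -/
def sumA (c : Fin 8 → ℂ) : ℂ := c 0 + c 1 + c 2 + c 3

/-- The sum `c₅ + c₆ + c₇ + c₈`. -/
def sumB (c : Fin 8 → ℂ) : ℂ := c 4 + c 5 + c 6 + c 7

/-- The value of `y` after the first half of `R_J1`. -/
noncomputable def firstY (τ : ℂ) : State → ℂ
  | (c, η, x, y) => twoStepY τ (c 4) (c 5) (c 6) (c 7) η x y

/-- The two letters `s₂` use the pairs `c₅, c₆` and `c₇, c₈`, brought to the front by permutations;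
the final `s₁` exchanges the coordinates, so that the second pass through the word acts on the old
`x`. -/
theorem wordImage_halfWord (τ : ℂ) (c : Fin 8 → ℂ) (η x y : ℂ) :
    wordImage τ halfWord (c, η, x, y)
      = (![sumB c / 4 - η - c 7, sumB c / 4 - η - c 6, sumB c / 4 - η - c 5,
            sumB c / 4 - η - c 4, η + c 0 + sumB c / 4, η + c 1 + sumB c / 4,
            η + c 2 + sumB c / 4, η + c 3 + sumB c / 4],
          sumB c / 4, twoStepY τ (c 4) (c 5) (c 6) (c 7) η x y, x) := by
  rw [halfWord, wordImage_append, wordImage_swapBlocks, wordImage_cons]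
  simp only [Gen.image]
  rw [wordImage_append, wordImage_swapPairs, wordImage_cons, wordImage_cons]
  refine Prod.ext (funext fun i => ?_) (Prod.ext ?_ (Prod.ext rfl rfl))
  · fin_cases i <;> simp [wordImage, Gen.image, sumB] <;> ring
  · simp [wordImage, Gen.image, sumB]
    ring

theorem wordRegular_halfWord (τ : ℂ) {c : Fin 8 → ℂ} {η x y : ℂ}
    (h1 : S2Regular τ (c 4) (c 5) η x y)
    (h2 : S2Regular τ (c 6 + (2 * η + c 4 + c 5) / 4) (c 7 + (2 * η + c 4 + c 5) / 4)
      (η - (2 * η + c 4 + c 5) / 4) x (s2y τ (c 4) (c 5) η x y)) :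
    WordRegular τ halfWord (c, η, x, y) := by
  rw [halfWord, wordRegular_append, wordImage_swapBlocks]
  refine ⟨⟨trivial, trivial, trivial, trivial, trivial, trivial, trivial, trivial, trivial,
    trivial, trivial, trivial, trivial, trivial, trivial, trivial, trivial⟩, h1, ?_⟩
  rw [wordRegular_append]
  refine ⟨⟨trivial, trivial, trivial, trivial, trivial⟩, ?_⟩
  simp only [Gen.image]
  rw [wordImage_swapPairs]
  exact ⟨h2, trivial, trivial⟩

/-- The value of `x` after the second half of `R_J1`. -/
noncomputable def secondX (τ : ℂ) : State → ℂ
  | (c, η, x, y) => twoStepY τ (η + c 0 + sumB c / 4) (η + c 1 + sumB c / 4)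
      (η + c 2 + sumB c / 4) (η + c 3 + sumB c / 4) (sumB c / 4) (firstY τ (c, η, x, y)) x

/-- Regularity of the formulas for both halves of `R_J1`. -/
def HalfStepRegular (τ : ℂ) : State → Prop
  | (c, η, x, y) => TwoStepRegular τ (c 4) (c 5) (c 6) (c 7) η x y
    ∧ TwoStepRegular τ (η + c 0 + sumB c / 4) (η + c 1 + sumB c / 4)
      (η + c 2 + sumB c / 4) (η + c 3 + sumB c / 4) (sumB c / 4) (firstY τ (c, η, x, y)) x

/-- The images of the parameters `c` under `R_J1`. -/
noncomputable def stepC (τ : ℂ) (c : Fin 8 → ℂ) : Fin 8 → ℂ := fun i =>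
  if i.val < 4 then -c i + (sumA c - sumB c) / 4 - ellKappa τ
  else -c i + (sumA c + 3 * sumB c) / 4 - ellKappa τ

/-- The image of `η` under `R_J1`. -/
noncomputable def stepEta (c : Fin 8 → ℂ) (η : ℂ) : ℂ := η + (sumA c + sumB c) / 4

theorem wordImage_RJ1 (τ : ℂ) (c : Fin 8 → ℂ) (η x y : ℂ) :
    wordImage τ RJ1 (c, η, x, y) = (stepC τ c, stepEta c η,
      -1 / (modulus τ * secondX τ (c, η, x, y)), -1 / (modulus τ * firstY τ (c, η, x, y))) := by
  rw [RJ1_eq, wordImage_append, wordImage_halfWord, wordImage_append, wordImage_halfWord,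
    wordImage_append, wordImage_permWord]
  refine Prod.ext (funext fun i => ?_) (Prod.ext ?_ (Prod.ext ?_ ?_))
  · fin_cases i <;> simp [wordImage, Gen.image, sumB, sumA, stepC, ellKappa] <;> ring
  · simp [wordImage, Gen.image, sumB, sumA, stepEta]
    ring
  · simp only [wordImage, Gen.image, List.foldl, mul_neg, div_neg, neg_div]
    rfl
  · simp only [wordImage, Gen.image, List.foldl, mul_neg, div_neg, neg_div]
    rfl

theorem wordRegular_RJ1 {τ : ℂ} {p : State} (h : HalfStepRegular τ p) :
    WordRegular τ RJ1 p := by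
  obtain ⟨c, η, x, y⟩ := p
  obtain ⟨h1, h2⟩ := h
  have hy : twoStepY τ (c 4) (c 5) (c 6) (c 7) η x y ≠ 0 := h1.2.2.2.2.2.2.2
  have hx : secondX τ (c, η, x, y) ≠ 0 := h2.2.2.2.2.2.2.2
  rw [RJ1_eq, wordRegular_append, wordImage_halfWord, wordRegular_append, wordImage_halfWord,
    wordRegular_append, wordImage_permWord]
  refine ⟨wordRegular_halfWord τ h1.1 h1.2.1, wordRegular_halfWord τ h2.1 h2.2.1,
    ⟨trivial, trivial, trivial, trivial, trivial, trivial, trivial, trivial, trivial,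
    trivial, trivial, trivial, trivial⟩, trivial, trivial, ?_, ?_, trivial⟩
  · exact neg_ne_zero.2 hy
  · exact neg_ne_zero.2 hx

/-! ### Action on the Picard lattice -/

theorem picAct_append (v w : List Gen) (x : Pic) :
    picAct (v ++ w) x = picAct v (picAct w x) :=
  List.foldr_append

theorem picAct_cons (g : Gen) (w : List Gen) (x : Pic) :
    picAct (g :: w) x = g.picAct (picAct w x) := rfl

theorem picReflection_swap {i : Fin 9} {a b : Fin 8} (h : simpleRoot i = picE a - picE b)
    (hab : a ≠ b) (v : Pic) : picReflection i v = (v.1, v.2 ∘ Equiv.swap a b) := by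
  have hf : picForm v (simpleRoot i) = v.2 b - v.2 a := by
    rw [h]
    simp [picForm, picE, mul_sub, Finset.sum_sub_distrib, Pi.single_apply]
  rw [picReflection, hf, h]
  refine Prod.ext ?_ (funext fun j => ?_)
  · simp [picE]
  · rcases eq_or_ne j a with rfl | ha
    · simp [picE, hab]
    · rcases eq_or_ne j b with rfl | hb
      · simp [picE, hab.symm]
      · simp [picE, ha, hb, Equiv.swap_apply_of_ne_of_ne ha hb]

theorem picReflection_zero (v : Pic) : picReflection 0 v = (v.1, v.2 ∘ Equiv.swap 6 7) :=
  picReflection_swap rfl (by decide) v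

theorem picReflection_three (v : Pic) : picReflection 3 v = (v.1, v.2 ∘ Equiv.swap 1 2) :=
  picReflection_swap rfl (by decide) v

theorem picReflection_four (v : Pic) : picReflection 4 v = (v.1, v.2 ∘ Equiv.swap 2 3) :=
  picReflection_swap rfl (by decide) v

theorem picReflection_five (v : Pic) : picReflection 5 v = (v.1, v.2 ∘ Equiv.swap 3 4) :=
  picReflection_swap rfl (by decide) v

theorem picReflection_six (v : Pic) : picReflection 6 v = (v.1, v.2 ∘ Equiv.swap 4 5) :=
  picReflection_swap rfl (by decide) v

theorem picReflection_seven (v : Pic) : picReflection 7 v = (v.1, v.2 ∘ Equiv.swap 5 6) :=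
  picReflection_swap rfl (by decide) v

theorem picReflection_eight (v : Pic) : picReflection 8 v = (v.1, v.2 ∘ Equiv.swap 0 1) :=
  picReflection_swap rfl (by decide) v

theorem picReflection_one (v : Pic) : picReflection 1 v = (![v.1 1, v.1 0], v.2) := by
  have hf : picForm v (simpleRoot 1) = v.1 0 - v.1 1 := by
    simp [simpleRoot, picForm, picH]
    ring
  rw [picReflection, hf]
  refine Prod.ext (funext fun j => ?_) (funext fun j => ?_)
  · fin_cases j <;> simp [simpleRoot, picH]
  · simp [simpleRoot, picH]

theorem picReflection_two (v : Pic) : picReflection 2 v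
    = (![v.1 0 + (v.1 1 + v.2 0 + v.2 1), v.1 1],
      ![-v.1 1 - v.2 1, -v.1 1 - v.2 0, v.2 2, v.2 3, v.2 4, v.2 5, v.2 6, v.2 7]) := by
  have hf : picForm v (simpleRoot 2) = v.1 1 + v.2 0 + v.2 1 := by
    simp [simpleRoot, picForm, picH, picE, Fin.sum_univ_eight]
    ring
  rw [picReflection, hf]
  refine Prod.ext (funext fun j => ?_) (funext fun j => ?_)
  · fin_cases j <;> simp [simpleRoot, picH, picE]
  · fin_cases j <;> simp [simpleRoot, picH, picE] <;> ring

theorem picAct_swapBlocks (v : Pic) :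
    picAct (([5, 6, 4, 5, 3, 4, 8, 3, 7, 0, 6, 7, 5, 6, 4, 5] : List (Fin 9)).map Gen.s) v
      = (v.1, ![v.2 4, v.2 5, v.2 6, v.2 7, v.2 0, v.2 1, v.2 2, v.2 3]) := by
  simp only [List.map, picAct, List.foldr, Gen.picAct, picReflection_zero, picReflection_three,
    picReflection_four, picReflection_five, picReflection_six, picReflection_seven,
    picReflection_eight]
  refine Prod.ext rfl (funext fun i => ?_)
  fin_cases i <;> rfl

theorem picAct_swapPairs (v : Pic) :
    picAct (([3, 4, 8, 3] : List (Fin 9)).map Gen.s) v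
      = (v.1, ![v.2 2, v.2 3, v.2 0, v.2 1, v.2 4, v.2 5, v.2 6, v.2 7]) := by
  simp only [List.map, picAct, List.foldr, Gen.picAct, picReflection_three,
    picReflection_four, picReflection_eight]
  refine Prod.ext rfl (funext fun i => ?_)
  fin_cases i <;> rfl

theorem picAct_permWord (v : Pic) :
    picAct permWord v
      = (v.1, ![v.2 3, v.2 2, v.2 1, v.2 0, v.2 7, v.2 6, v.2 5, v.2 4]) := by
  simp only [permWord, List.map, picAct, List.foldr, Gen.picAct, picReflection_zero,
    picReflection_three, picReflection_four, picReflection_six, picReflection_seven,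
    picReflection_eight]
  refine Prod.ext rfl (funext fun i => ?_)
  fin_cases i <;> rfl

theorem picAct_halfWord (v : Pic) : picAct halfWord v
    = (![v.1 1 + 2 * v.1 0 + v.2 0 + v.2 1 + v.2 2 + v.2 3, v.1 0],
      ![v.2 4, v.2 5, v.2 6, v.2 7,
        -v.1 0 - v.2 3, -v.1 0 - v.2 2, -v.1 0 - v.2 1, -v.1 0 - v.2 0]) := by
  rw [halfWord, picAct_append, picAct_cons, picAct_append, picAct_swapPairs, picAct_swapBlocks,
    picAct_cons, picAct_cons]
  simp only [Gen.picAct, picReflection_one, picReflection_two, picAct, List.foldr]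
  refine Prod.ext (funext fun i => ?_) (funext fun i => ?_)
  · fin_cases i
    · simp
      ring
    · simp
  · fin_cases i <;> simp

theorem picAct_RJ1 (v : Pic) : picAct RJ1 v
    = (![2 * (v.1 1 + 2 * v.1 0 + v.2 0 + v.2 1 + v.2 2 + v.2 3) + v.1 0
          + v.2 4 + v.2 5 + v.2 6 + v.2 7,
        v.1 1 + 2 * v.1 0 + v.2 0 + v.2 1 + v.2 2 + v.2 3],
      ![-v.1 0 - v.2 0, -v.1 0 - v.2 1, -v.1 0 - v.2 2, -v.1 0 - v.2 3,
        -(v.1 1 + 2 * v.1 0 + v.2 0 + v.2 1 + v.2 2 + v.2 3) - v.2 4,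
        -(v.1 1 + 2 * v.1 0 + v.2 0 + v.2 1 + v.2 2 + v.2 3) - v.2 5,
        -(v.1 1 + 2 * v.1 0 + v.2 0 + v.2 1 + v.2 2 + v.2 3) - v.2 6,
        -(v.1 1 + 2 * v.1 0 + v.2 0 + v.2 1 + v.2 2 + v.2 3) - v.2 7]) := by
  have hι : picAct [Gen.iota 3, Gen.iota 2, Gen.iota 1, Gen.iota 0] v = v := rfl
  rw [RJ1_eq, picAct_append, picAct_append, picAct_append, hι, picAct_permWord, picAct_halfWord,
    picAct_halfWord]
  refine Prod.ext (funext fun i => ?_) (funext fun i => ?_)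
  · fin_cases i <;> simp <;> ring
  · fin_cases i <;> simp <;> ring

theorem TJ1_eq : TJ1 = RJ1 ++ RJ1 := rfl

theorem picAct_TJ1 (v : Pic) :
    picAct TJ1 v = kacTranslation (2 • picH 0 - picE 4 - picE 5 - picE 6 - picE 7) v := by
  -- `(β|β) = -4`, so the integer division in the Kac translation is exact.
  have h1 : picForm (2 • picH 0 - picE 4 - picE 5 - picE 6 - picE 7)
      (2 • picH 0 - picE 4 - picE 5 - picE 6 - picE 7) / 2 = -2 := by decide
  have h2 : picForm picDelta v = 2 * v.1 0 + 2 * v.1 1 + ∑ i, v.2 i := by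
    simp [picForm, picDelta, picH, picE, Fin.sum_univ_eight]
    ring
  have h3 : picForm (2 • picH 0 - picE 4 - picE 5 - picE 6 - picE 7) v
      = 2 * v.1 1 + v.2 4 + v.2 5 + v.2 6 + v.2 7 := by
    simp [picForm, picH, picE, Fin.sum_univ_eight]
    ring
  rw [TJ1_eq, picAct_append, picAct_RJ1, picAct_RJ1, kacTranslation, h1, h2, h3,
    Fin.sum_univ_eight]
  refine Prod.ext (funext fun i => ?_) (funext fun i => ?_)
  · fin_cases i <;> simp [picDelta, picH, picE, Fin.sum_univ_eight] <;> ring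
  · fin_cases i <;> simp [picDelta, picH, picE, Fin.sum_univ_eight] <;> ring

/-- The closed form replaces the long word by one linear map, which leaves a finite integer check.
-/
theorem picAct_RJ1_simpleRoot (i : Fin 9) :
    picAct RJ1 (simpleRoot i) = ∑ j, matrixRJ1 i j • simpleRoot j := by
  rw [picAct_RJ1]
  revert i
  decide

theorem picAct_TJ1_simpleRoot (i : Fin 9) :
    picAct TJ1 (simpleRoot i)
      = simpleRoot i + (![0, -2, 0, 0, 0, 1, 0, 0, 0] : Fin 9 → ℤ) i • picDelta := by
  rw [picAct_TJ1]
  revert i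
  decide

theorem not_isRootTranslation_RJ1 : ¬ IsRootTranslation RJ1 := by
  rintro ⟨m, hm⟩
  -- `α₃ ↦ -α₃` would require `-2α₃` to be a multiple of `δ`: the coefficient of `H₀` makes the
  -- multiple zero, that of `E₂` contradicts this.
  have h := hm 3
  rw [picAct_RJ1] at h
  have h1 := congrFun (congrArg Prod.fst h) 0
  have h2 := congrFun (congrArg Prod.snd h) 1
  simp [simpleRoot, picDelta, picH, picE, Fin.sum_univ_eight] at h1 h2
  omega

/-! ### Action on the parameters -/

theorem sumA_stepC (τ : ℂ) (c : Fin 8 → ℂ) : sumA (stepC τ c) = -sumB c - 4 * ellKappa τ := by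
  simp [sumA, sumB, stepC]
  ring

theorem sumB_stepC (τ : ℂ) (c : Fin 8 → ℂ) :
    sumB (stepC τ c) = sumA c + 2 * sumB c - 4 * ellKappa τ := by
  simp [sumA, sumB, stepC]
  ring

theorem lamFun_eq (p : State) : lamFun p = (sumA p.1 + sumB p.1) / 2 := by
  rw [lamFun, Fin.sum_univ_eight, sumA, sumB]
  ring

theorem cFun_wordImage_RJ1 (τ : ℂ) (p : State) (i : Fin 8) :
    cFun i (wordImage τ RJ1 p) = stepC τ p.1 i := by
  obtain ⟨c, η, x, y⟩ := p
  rw [wordImage_RJ1]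
  rfl

theorem etaFun_wordImage_RJ1 (τ : ℂ) (p : State) :
    etaFun (wordImage τ RJ1 p) = stepEta p.1 (etaFun p) := by
  obtain ⟨c, η, x, y⟩ := p
  rw [wordImage_RJ1]
  rfl

theorem fst_wordImage_RJ1 (τ : ℂ) (p : State) : (wordImage τ RJ1 p).1 = stepC τ p.1 :=
  funext fun i => cFun_wordImage_RJ1 τ p i

theorem stepC_of_lt (τ : ℂ) (c : Fin 8 → ℂ) {i : Fin 8} (hi : i.val < 4) :
    stepC τ c i = -c i + (sumA c - sumB c) / 4 - ellKappa τ := if_pos hi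

theorem stepC_of_le (τ : ℂ) (c : Fin 8 → ℂ) {i : Fin 8} (hi : 4 ≤ i.val) :
    stepC τ c i = -c i + (sumA c + 3 * sumB c) / 4 - ellKappa τ := if_neg (not_lt.2 hi)

theorem not_isParamTranslation_RJ1 (τ : ℂ) : ¬ IsParamTranslation τ RJ1 := by
  rintro ⟨f, g, h⟩
  -- Two points with `λ = 0` but different `c₁`: as `R` negates `c₁`, the displacements differ by 2.
  have h0 := (h (0, 0, 0, 0)).1 0
  have h1 := (h (![1, -1, 0, 0, 0, 0, 0, 0], 0, 0, 0)).1 0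
  have e0 : lamFun (0, 0, 0, 0) = 0 := by simp [lamFun]
  have e1 : lamFun (![1, -1, 0, 0, 0, 0, 0, 0], 0, 0, 0) = 0 := by
    simp [lamFun, Fin.sum_univ_eight]
  rw [act_eq, cFun_wordImage_RJ1, stepC_of_lt τ _ (by decide), e0] at h0
  rw [act_eq, cFun_wordImage_RJ1, stepC_of_lt τ _ (by decide), e1] at h1
  simp [cFun, sumA, sumB] at h0 h1
  rw [← h0] at h1
  have h2 : (2 : ℂ) = 0 := by linear_combination -h1
  norm_num at h2

theorem wordImage_TJ1 (τ : ℂ) (p : State) :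
    wordImage τ TJ1 p = wordImage τ RJ1 (wordImage τ RJ1 p) := by
  rw [TJ1_eq, wordImage_append]

theorem cFun_wordImage_TJ1_of_lt (τ : ℂ) (p : State) {i : Fin 8} (hi : i.val < 4) :
    cFun i (wordImage τ TJ1 p) = cFun i p - lamFun p := by
  rw [wordImage_TJ1, cFun_wordImage_RJ1, fst_wordImage_RJ1, stepC_of_lt τ _ hi, sumA_stepC,
    sumB_stepC, stepC_of_lt τ _ hi, lamFun_eq, cFun]
  ring

theorem cFun_wordImage_TJ1_of_le (τ : ℂ) (p : State) {i : Fin 8} (hi : 4 ≤ i.val) :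
    cFun i (wordImage τ TJ1 p) = cFun i p + lamFun p - 4 * ellKappa τ := by
  rw [wordImage_TJ1, cFun_wordImage_RJ1, fst_wordImage_RJ1, stepC_of_le τ _ hi, sumA_stepC,
    sumB_stepC, stepC_of_le τ _ hi, lamFun_eq, cFun]
  ring

theorem etaFun_wordImage_TJ1 (τ : ℂ) (p : State) :
    etaFun (wordImage τ TJ1 p) = etaFun p + lamFun p - 2 * ellKappa τ := by
  rw [wordImage_TJ1, etaFun_wordImage_RJ1, fst_wordImage_RJ1, etaFun_wordImage_RJ1, stepEta,
    stepEta, sumA_stepC, sumB_stepC, lamFun_eq]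
  ring

theorem lamFun_image_s (τ : ℂ) (i : Fin 9) (p : State) :
    lamFun ((Gen.s i).image τ p) = lamFun p := by
  obtain ⟨c, η, x, y⟩ := p
  have hswap : ∀ a b : Fin 8, lamFun (swapParam a b (c, η, x, y)) = lamFun (c, η, x, y) := by
    intro a b
    rw [lamFun, lamFun]
    exact congrArg (· / 2) (Equiv.sum_comp (Equiv.swap a b) c)
  fin_cases i
  · exact hswap 6 7
  · rfl
  · simp [lamFun, Gen.image, Fin.sum_univ_eight]
    ring
  · exact hswap 1 2
  · exact hswap 2 3
  · exact hswap 3 4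
  · exact hswap 4 5
  · exact hswap 5 6
  · exact hswap 0 1

theorem lamFun_wordImage (τ : ℂ) (w : List Gen) (p : State) (hw : ∀ g ∈ w, ∃ i, g = Gen.s i) :
    lamFun (wordImage τ w p) = lamFun p := by
  induction w generalizing p with
  | nil => rfl
  | cons g w ih =>
    obtain ⟨i, rfl⟩ := hw g List.mem_cons_self
    rw [wordImage_cons, ih _ fun g hg => hw g (List.mem_cons_of_mem _ hg), lamFun_image_s]

/-! ### The equations for the two halves of `T_J1` -/

/-- The first equation determines `yt`. Then `-1/(k yt)` is the intermediate value `firstY`, and the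
second equation is again of the form treated in `twoStep_iff`. -/
theorem halfStepEquation_iff {τ : ℂ} (hτ : 0 < τ.im) {c : Fin 8 → ℂ} {η x y : ℂ}
    (h : HalfStepRegular τ (c, η, x, y)) (xt yt : ℂ) :
    HalfStepEquation τ c η x y xt yt
      ↔ xt = -1 / (modulus τ * secondX τ (c, η, x, y))
        ∧ yt = -1 / (modulus τ * firstY τ (c, η, x, y)) := by
  obtain ⟨h1, h2⟩ := h
  have hk := modulus_ne_zero hτ
  have i1 := twoStep_iff hτ h1 yt
  have i2 := twoStep_iff hτ h2 xt
  have hy : firstY τ (c, η, x, y) ≠ 0 := h1.2.2.2.2.2.2.2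
  -- These two arguments come out as the negatives of the stated ones; evenness of `cd` removes the
  -- sign.
  have e1 : sumB c / 4 + (η + c 3 + sumB c / 4) - (η + c 0 + sumB c / 4 + (η + c 1 + sumB c / 4)
      + (η + c 2 + sumB c / 4) + (η + c 3 + sumB c / 4)) / 2
      = -(η - c 3 + (c 0 + c 1 + c 2 + c 3) / 2) := by ring
  have e2 : sumB c / 4 + (η + c 2 + sumB c / 4) - (η + c 0 + sumB c / 4 + (η + c 1 + sumB c / 4)
      + (η + c 2 + sumB c / 4) + (η + c 3 + sumB c / 4)) / 2
      = -(η - c 2 + (c 0 + c 1 + c 2 + c 3) / 2) := by ring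
  have e3 : sumB c / 4 + (η + c 2 + sumB c / 4) = η + c 2 + (c 4 + c 5 + c 6 + c 7) / 2 := by
    rw [sumB]
    ring
  have e4 : sumB c / 4 + (η + c 3 + sumB c / 4) = η + c 3 + (c 4 + c 5 + c 6 + c 7) / 2 := by
    rw [sumB]
    ring
  rw [e1, e2, e3, e4] at i2
  simp only [MQRegular, mQ, cd_neg hτ, cdFinite_neg hτ] at i2
  rw [HalfStepEquation]
  have hyt : ∀ y' : ℂ, y' ≠ 0 → -1 / (modulus τ * (-1 / (modulus τ * y'))) = y' := by
    intro y' hy'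
    field_simp
  constructor
  · rintro ⟨a1, a2, a3, a4, a5, a6⟩
    have hyy : yt = -1 / (modulus τ * firstY τ (c, η, x, y)) := i1.1 a1
    subst hyy
    rw [hyt _ hy] at a5 a6
    rw [mQ_neg_inv hτ _ _ hy] at a6
    refine ⟨i2.1 ⟨a3, ?_, a5, a6⟩, rfl⟩
    obtain ⟨b1, b2, b3⟩ := (mQRegular_neg_inv hτ hy).1 a4
    exact ⟨b1, b2, sub_ne_zero.2 b3⟩
  · rintro ⟨hx, hyy⟩
    refine ⟨i1.2 hyy, ?_⟩
    subst hyy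
    obtain ⟨a3, ⟨b1, b2, b3⟩, a5, a6⟩ := i2.2 hx
    rw [hyt _ hy, mQ_neg_inv hτ _ _ hy]
    exact ⟨div_ne_zero (by norm_num) (mul_ne_zero hk hy), a3,
      (mQRegular_neg_inv hτ hy).2 ⟨b1, b2, sub_ne_zero.1 b3⟩, a5, a6⟩

theorem cd_eq_of_eq_add {τ : ℂ} (hτ : 0 < τ.im) {u v : ℂ} (n : ℤ)
    (h : u = v + n * (2 * ellKappa τ)) : cd τ u = cd τ v := by
  have hp : Function.Periodic (cd τ) (2 * ellKappa τ) := cd_add_two_ellKappa hτ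
  rw [h]
  exact hp.int_mul n v

theorem cdFinite_eq_of_eq_add {τ : ℂ} (hτ : 0 < τ.im) {u v : ℂ} (n : ℤ)
    (h : u = v + n * (2 * ellKappa τ)) : CdFinite τ u = CdFinite τ v := by
  have hp : Function.Periodic (CdFinite τ) (2 * ellKappa τ) :=
    fun u => propext (cdFinite_add_two_ellKappa hτ u)
  rw [h]
  exact hp.int_mul n v

/-- A simultaneous shift of all `aᵢ` and `b` by `nκ` changes every argument of `cd` by a multiple of
`2κ`, although `nκ` itself need not be a period. -/
theorem gP_and_gPRegular_shift {τ : ℂ} (hτ : 0 < τ.im) (n : ℤ)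
    {a1 a2 a3 a4 b a1' a2' a3' a4' b' : ℂ}
    (h1 : a1' = a1 + n * ellKappa τ) (h2 : a2' = a2 + n * ellKappa τ)
    (h3 : a3' = a3 + n * ellKappa τ) (h4 : a4' = a4 + n * ellKappa τ)
    (hb : b' = b + n * ellKappa τ) (X Y : ℂ) :
    gP τ a1' a2' a3' a4' b' X Y = gP τ a1 a2 a3 a4 b X Y
      ∧ GPRegular τ a1' a2' a3' a4' b' X Y = GPRegular τ a1 a2 a3 a4 b X Y := by
  subst h1 h2 h3 h4 hb
  have em : ∀ a, b + n * ellKappa τ - (a + n * ellKappa τ) = b - a := fun a => by ring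
  have ep : ∀ a, b + n * ellKappa τ + (a + n * ellKappa τ) = b + a + n * (2 * ellKappa τ) :=
    fun a => by ring
  have eh : ∀ a, a + n * ellKappa τ + (a1 + n * ellKappa τ + (a2 + n * ellKappa τ)) / 2
      = a + (a1 + a2) / 2 + n * (2 * ellKappa τ) := fun a => by ring
  have eS : ∀ a, b + n * ellKappa τ + (a + n * ellKappa τ)
      + (a1 + n * ellKappa τ + (a2 + n * ellKappa τ) + (a3 + n * ellKappa τ)
        + (a4 + n * ellKappa τ)) / 2
      = b + a + (a1 + a2 + a3 + a4) / 2 + (2 * n : ℤ) * (2 * ellKappa τ) := fun a => by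
    push_cast
    ring
  have eS' : ∀ a, b + n * ellKappa τ + (a + n * ellKappa τ)
      - (a1 + n * ellKappa τ + (a2 + n * ellKappa τ) + (a3 + n * ellKappa τ)
        + (a4 + n * ellKappa τ)) / 2
      = b + a - (a1 + a2 + a3 + a4) / 2 := fun a => by ring
  have e2 : 2 * (b + n * ellKappa τ) + (a2 + n * ellKappa τ)
      - (a1 + n * ellKappa τ + (a2 + n * ellKappa τ)) / 2
      = 2 * b + a2 - (a1 + a2) / 2 + n * (2 * ellKappa τ) := by ring
  have ec : ∀ (u : ℂ) (m : ℤ), cd τ (u + m * (2 * ellKappa τ)) = cd τ u :=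
    fun u m => cd_eq_of_eq_add hτ m rfl
  have ef : ∀ (u : ℂ) (m : ℤ), CdFinite τ (u + m * (2 * ellKappa τ)) = CdFinite τ u :=
    fun u m => cdFinite_eq_of_eq_add hτ m rfl
  have hP : ∀ a, pP τ (a1 + n * ellKappa τ) (a2 + n * ellKappa τ) (a + n * ellKappa τ)
      (b + n * ellKappa τ) X Y = pP τ a1 a2 a b X Y := by
    intro a
    simp only [pP, em, ep, ec]
  constructor
  · rw [gP, gP, hP, hP]
    simp only [gG, eS, eS', em, e2, eh, ec]
  · simp only [GPRegular, GRegular, hP, List.mem_cons, List.not_mem_nil, or_false,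
      forall_eq_or_imp, forall_eq, eS, eS', em, e2, eh]
    simp only [ep, ec, ef]

theorem mQ_and_mQRegular_shift {τ : ℂ} (hτ : 0 < τ.im) (n : ℤ) {u v u' v' : ℂ}
    (hu : u = u' + n * (2 * ellKappa τ)) (hv : v = v' + n * (2 * ellKappa τ)) (Y : ℂ) :
    mQ τ u v Y = mQ τ u' v' Y ∧ MQRegular τ u v Y = MQRegular τ u' v' Y := by
  rw [mQ, mQ, MQRegular, MQRegular, cd_eq_of_eq_add hτ n hu, cd_eq_of_eq_add hτ n hv,
    cdFinite_eq_of_eq_add hτ n hu, cdFinite_eq_of_eq_add hτ n hv]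
  exact ⟨rfl, rfl⟩

theorem lQ_and_lQRegular_shift {τ : ℂ} (hτ : 0 < τ.im) (n : ℤ) {u v u' v' : ℂ}
    (hu : u = u' + n * (2 * ellKappa τ)) (hv : v = v' + n * (2 * ellKappa τ)) (X : ℂ) :
    lQ τ u v X = lQ τ u' v' X ∧ LQRegular τ u v X = LQRegular τ u' v' X := by
  rw [lQ, lQ, LQRegular, LQRegular, cd_eq_of_eq_add hτ n hu, cd_eq_of_eq_add hτ n hv,
    cdFinite_eq_of_eq_add hτ n hu, cdFinite_eq_of_eq_add hτ n hv]
  exact ⟨rfl, rfl⟩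

/-- The stated arguments are those of the half step at the image parameters, moved by `0`, `2κ` or
`4κ`; the parameters of `Φ` are moved by `κ` in the third equation and by `2κ` in the fourth. -/
theorem fullStepEquation_iff {τ : ℂ} (hτ : 0 < τ.im) (c : Fin 8 → ℂ) (η xt yt xb yb : ℂ) :
    FullStepEquation τ c η xt yt xb yb
      ↔ HalfStepEquation τ (stepC τ c) (stepEta c η) xt yt xb yb := by
  have hA := sumA_stepC τ c
  have hB := sumB_stepC τ c
  have c0 : stepC τ c 0 = _ := stepC_of_lt τ c (by decide)
  have c1 : stepC τ c 1 = _ := stepC_of_lt τ c (by decide)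
  have c2 : stepC τ c 2 = _ := stepC_of_lt τ c (by decide)
  have c3 : stepC τ c 3 = _ := stepC_of_lt τ c (by decide)
  have c4 : stepC τ c 4 = _ := stepC_of_le τ c (by decide)
  have c5 : stepC τ c 5 = _ := stepC_of_le τ c (by decide)
  have c6 : stepC τ c 6 = _ := stepC_of_le τ c (by decide)
  have c7 : stepC τ c 7 = _ := stepC_of_le τ c (by decide)
  have hη : stepEta c η = η + (sumA c + sumB c) / 4 := rfl
  have hsA : ∀ c : Fin 8 → ℂ, c 0 + c 1 + c 2 + c 3 = sumA c := fun _ => rfl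
  have hsB : ∀ c : Fin 8 → ℂ, c 4 + c 5 + c 6 + c 7 = sumB c := fun _ => rfl
  simp only [FullStepEquation, HalfStepEquation, hsA, hsB]
  rw [hA, hB, c0, c1, c2, c3, c4, c5, c6, c7, hη]
  clear hA hB c0 c1 c2 c3 c4 c5 c6 c7 hη hsA hsB
  generalize sumA c = A
  generalize sumB c = B
  obtain ⟨e1, e2⟩ := mQ_and_mQRegular_shift hτ 0 (u := η - c 7 + ellKappa τ)
    (v := η - c 6 + ellKappa τ)
    (u' := η + (A + B) / 4 + (-c 7 + (A + 3 * B) / 4 - ellKappa τ)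
      - (A + 2 * B - 4 * ellKappa τ) / 2)
    (v' := η + (A + B) / 4 + (-c 6 + (A + 3 * B) / 4 - ellKappa τ)
      - (A + 2 * B - 4 * ellKappa τ) / 2) (by push_cast; ring) (by push_cast; ring) yb
  obtain ⟨e3, e4⟩ := lQ_and_lQRegular_shift hτ 1
    (u := η - c 6 + B / 2 + (A + B) / 2 + ellKappa τ)
    (v := η - c 7 + B / 2 + (A + B) / 2 + ellKappa τ)
    (u' := η + (A + B) / 4 + (-c 6 + (A + 3 * B) / 4 - ellKappa τ))
    (v' := η + (A + B) / 4 + (-c 7 + (A + 3 * B) / 4 - ellKappa τ))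
    (by push_cast; ring) (by push_cast; ring) xt
  obtain ⟨e5, e6⟩ := gP_and_gPRegular_shift hτ 1
    (a1' := (B - 2 * c 4 + (A + B) / 2) / 2) (a2' := (B - 2 * c 5 + (A + B) / 2) / 2)
    (a3' := (B - 2 * c 6 + (A + B) / 2) / 2) (a4' := (B - 2 * c 7 + (A + B) / 2) / 2)
    (b' := η + (A + B) / 2 / 2 + ellKappa τ)
    (a1 := -c 4 + (A + 3 * B) / 4 - ellKappa τ) (a2 := -c 5 + (A + 3 * B) / 4 - ellKappa τ)
    (a3 := -c 6 + (A + 3 * B) / 4 - ellKappa τ) (a4 := -c 7 + (A + 3 * B) / 4 - ellKappa τ)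
    (b := η + (A + B) / 4) (by push_cast; ring) (by push_cast; ring) (by push_cast; ring)
    (by push_cast; ring) (by push_cast; ring) xt yt
  obtain ⟨e7, e8⟩ := mQ_and_mQRegular_shift hτ 1 (u := η + c 3 + ellKappa τ)
    (v := η + c 2 + ellKappa τ)
    (u' := η + (A + B) / 4 - (-c 3 + (A - B) / 4 - ellKappa τ) + (-B - 4 * ellKappa τ) / 2)
    (v' := η + (A + B) / 4 - (-c 2 + (A - B) / 4 - ellKappa τ) + (-B - 4 * ellKappa τ) / 2)
    (by push_cast; ring) (by push_cast; ring) xb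
  obtain ⟨e9, e10⟩ := mQ_and_mQRegular_shift hτ 2
    (u := η - c 2 + 2 * ((A + B) / 2) + ellKappa τ)
    (v := η - c 3 + 2 * ((A + B) / 2) + ellKappa τ)
    (u' := η + (A + B) / 4 + (-c 2 + (A - B) / 4 - ellKappa τ)
      + (A + 2 * B - 4 * ellKappa τ) / 2)
    (v' := η + (A + B) / 4 + (-c 3 + (A - B) / 4 - ellKappa τ)
      + (A + 2 * B - 4 * ellKappa τ) / 2)
    (by push_cast; ring) (by push_cast; ring) yb
  obtain ⟨e11, e12⟩ := gP_and_gPRegular_shift hτ 2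
    (a1' := η - c 0 + A / 4 + (A + B) / 2) (a2' := η - c 1 + A / 4 + (A + B) / 2)
    (a3' := η - c 2 + A / 4 + (A + B) / 2) (a4' := η - c 3 + A / 4 + (A + B) / 2)
    (b' := (B + 2 * ((A + B) / 2)) / 4 + ellKappa τ)
    (a1 := η + (A + B) / 4 + (-c 0 + (A - B) / 4 - ellKappa τ)
      + (A + 2 * B - 4 * ellKappa τ) / 4)
    (a2 := η + (A + B) / 4 + (-c 1 + (A - B) / 4 - ellKappa τ)
      + (A + 2 * B - 4 * ellKappa τ) / 4)
    (a3 := η + (A + B) / 4 + (-c 2 + (A - B) / 4 - ellKappa τ)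
      + (A + 2 * B - 4 * ellKappa τ) / 4)
    (a4 := η + (A + B) / 4 + (-c 3 + (A - B) / 4 - ellKappa τ)
      + (A + 2 * B - 4 * ellKappa τ) / 4)
    (b := (A + 2 * B - 4 * ellKappa τ) / 4) (by push_cast; ring) (by push_cast; ring)
    (by push_cast; ring) (by push_cast; ring) (by push_cast; ring) (-1 / (modulus τ * yb)) xt
  rw [e1, e2, e3, e4, e5, e6, e7, e8, e9, e10, e11, e12]

/-! ### The reduced equation in terms of `cd` -/

theorem cn_eq_cd_mul_dn {τ : ℂ} (hτ : 0 < τ.im) {u : ℂ} (hs : SnFinite τ u)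
    (hc : CdFinite τ u) : cn τ u = cd τ u * dn τ u ∧ dn τ u ≠ 0 := by
  have hd : dn τ u ≠ 0 := div_ne_zero (mul_ne_zero (sqrtCoModulus_ne_zero hτ) hc) hs
  exact ⟨by rw [cd_eq_cn_div_dn τ u hd, div_mul_cancel₀ _ hd], hd⟩

theorem sn_dn_sq_eq {τ : ℂ} (hτ : 0 < τ.im) {u : ℂ} (hs : SnFinite τ u) (hc : CdFinite τ u) :
    1 - modulus τ ^ 2 * cd τ u ^ 2 ≠ 0
    ∧ sn τ u ^ 2 = (1 - cd τ u ^ 2) / (1 - modulus τ ^ 2 * cd τ u ^ 2)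
    ∧ dn τ u ^ 2 = (1 - modulus τ ^ 2) / (1 - modulus τ ^ 2 * cd τ u ^ 2) := by
  obtain ⟨h1, hd⟩ := cn_eq_cd_mul_dn hτ hs hc
  have h2 := sn_sq_add_cn_sq hτ hs
  have h3 := dn_sq_add_sn_sq hτ hs
  rw [h1] at h2
  have h4 : dn τ u ^ 2 * (1 - modulus τ ^ 2 * cd τ u ^ 2) = 1 - modulus τ ^ 2 := by
    linear_combination h3 - modulus τ ^ 2 * h2
  have h5 : 1 - modulus τ ^ 2 * cd τ u ^ 2 ≠ 0 := by
    intro h0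
    rw [h0, mul_zero] at h4
    exact one_sub_modulus_sq_ne_zero hτ h4.symm
  refine ⟨h5, (eq_div_iff h5).2 ?_, (eq_div_iff h5).2 h4⟩
  linear_combination h2 - cd τ u ^ 2 * h3

/-- Numerator and denominator of the reduced equation, in terms of `cd`. -/
theorem rcg_eq {τ : ℂ} (hτ : 0 < τ.im) {z γ : ℂ} (hs : SnFinite τ z) (hc : CdFinite τ z)
    (hs' : SnFinite τ γ) (hc' : CdFinite τ γ) : ∃ ρ : ℂ, ρ ≠ 0 ∧ ∀ X Y,
    rcgNum (modulus τ) (sn τ z) (cn τ z) (dn τ z) (sn τ γ) (cn τ γ) (dn τ γ) X Y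
      = ρ * (cd τ γ * (1 - modulus τ ^ 2 * cd τ z ^ 4) * X * Y
        - cd τ z * (cd τ γ ^ 2 - cd τ z ^ 2)
        - cd τ z * (1 - modulus τ ^ 2 * cd τ z ^ 2 * cd τ γ ^ 2) * X ^ 2)
    ∧ rcgDen (modulus τ) (sn τ z) (cn τ z) (dn τ z) (sn τ γ) (cn τ γ) (dn τ γ) X Y
      = ρ * (modulus τ ^ 2 * (cd τ z * (cd τ γ ^ 2 - cd τ z ^ 2)) * X ^ 2 * Y
        - cd τ γ * (1 - modulus τ ^ 2 * cd τ z ^ 4) * X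
        + cd τ z * (1 - modulus τ ^ 2 * cd τ z ^ 2 * cd τ γ ^ 2) * Y) := by
  obtain ⟨h1, -⟩ := cn_eq_cd_mul_dn hτ hs hc
  obtain ⟨h1', -⟩ := cn_eq_cd_mul_dn hτ hs' hc'
  obtain ⟨h2, h3, h4⟩ := sn_dn_sq_eq hτ hs hc
  obtain ⟨h2', h3', h4'⟩ := sn_dn_sq_eq hτ hs' hc'
  have hk := one_sub_modulus_sq_ne_zero hτ
  rw [h1, h1']
  generalize cd τ z = C at *
  generalize cd τ γ = G at *
  generalize modulus τ = k at *
  generalize sn τ z = s at *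
  generalize sn τ γ = s' at *
  generalize dn τ z = d at *
  generalize dn τ γ = d' at *
  have e1 : 1 - k ^ 2 * s ^ 4 = (1 - k ^ 2) * (1 - k ^ 2 * C ^ 4) / (1 - k ^ 2 * C ^ 2) ^ 2 := by
    rw [show s ^ 4 = (s ^ 2) ^ 2 by ring, h3]
    field_simp
    ring
  have e2 : 1 - k ^ 2 * s' ^ 2 * s ^ 2 = (1 - k ^ 2) * (1 - k ^ 2 * C ^ 2 * G ^ 2)
      / ((1 - k ^ 2 * C ^ 2) * (1 - k ^ 2 * G ^ 2)) := by
    rw [h3, h3']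
    field_simp
    ring
  have e3 : (G * d') ^ 2 - (C * d) ^ 2 = (1 - k ^ 2) * (G ^ 2 - C ^ 2)
      / ((1 - k ^ 2 * C ^ 2) * (1 - k ^ 2 * G ^ 2)) := by
    rw [eq_div_iff h2] at h4
    rw [eq_div_iff h2'] at h4'
    rw [eq_div_iff (mul_ne_zero h2 h2')]
    linear_combination G ^ 2 * (1 - k ^ 2 * C ^ 2) * h4' - C ^ 2 * (1 - k ^ 2 * G ^ 2) * h4
  -- The factor that numerator and denominator share after `sn²` and `dn²` are replaced by rational
  -- functions of `cd²`. Thus the quotient depends on `z` and `γ` through `cd` only, and shifts by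
  -- `2κ` leave it unchanged wherever the functions are finite.
  refine ⟨(1 - k ^ 2) ^ 2 / ((1 - k ^ 2 * C ^ 2) ^ 2 * (1 - k ^ 2 * G ^ 2)),
    div_ne_zero (pow_ne_zero _ hk) (mul_ne_zero (pow_ne_zero _ h2) h2'), fun X Y => ⟨?_, ?_⟩⟩
  · rw [rcgNum, e1, e2, e3, show ∀ t X Y : ℂ, t * (G * d') * d' * X * Y = t * G * d' ^ 2 * X * Y
      by intros; ring, show ∀ t : ℂ, t * (C * d) * d = t * C * d ^ 2 by intros; ring,
      show ∀ t : ℂ, t * (C * d) * d = t * C * d ^ 2 by intros; ring, h4, h4']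
    field_simp
  · rw [rcgDen, e1, e2, e3, show ∀ t X : ℂ, t * (G * d') * d' * X = t * G * d' ^ 2 * X
      by intros; ring, show ∀ t : ℂ, t * (C * d) * d = t * C * d ^ 2 by intros; ring,
      show ∀ t : ℂ, t * (C * d) * d = t * C * d ^ 2 by intros; ring, h4, h4']
    field_simp

/-! ### Two steps with special parameters -/

theorem sigmaFun_sub_four_ellK {τ : ℂ} (hτ : 0 < τ.im) (w : ℂ) :
    sigmaFun τ (w - 4 * ellK τ) = -sigmaFun τ w := by
  rw [← neg_eq_iff_eq_neg, ← sigmaFun_add_four_ellK hτ, sub_add_cancel]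

theorem sigmaFun_special {τ : ℂ} (hτ : 0 < τ.im) {e : ℂ} (he : e = 1 ∨ e = -1) :
    sigmaFun τ (e * (ellIK' τ - 2 * ellK τ)) = -sigmaFun τ (e * ellKappa τ)
    ∧ sigmaFun τ (e * ellKappa τ) ≠ 0 ∧ sigmaFun τ (e * ellIK' τ) ≠ 0
    ∧ sigmaFun τ (e * (2 * ellK τ)) ≠ 0 := by
  have h1 : sigmaFun τ (ellIK' τ - 2 * ellK τ) = -sigmaFun τ (ellKappa τ) := by
    rw [← sigmaFun_sub_four_ellK hτ, ellKappa]
    ring_nf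
  rcases he with rfl | rfl
  · simp only [one_mul]
    exact ⟨h1, sigmaFun_ellKappa_ne_zero hτ, sigmaFun_ellIK'_ne_zero hτ,
      sigmaFun_two_ellK_ne_zero hτ⟩
  · simp only [neg_one_mul, sigmaFun_neg, neg_ne_zero, h1]
    exact ⟨trivial, sigmaFun_ellKappa_ne_zero hτ, sigmaFun_ellIK'_ne_zero hτ,
      sigmaFun_two_ellK_ne_zero hτ⟩

theorem jacobiT1_sub_two_ellK {τ : ℂ} (hτ : 0 < τ.im) (u : ℂ) :
    jacobiT1 τ (u - 2 * ellK τ) = jacobiT1 τ u := by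
  rw [← jacobiT1_add_two_ellK hτ, sub_add_cancel]

theorem cd_sub_two_ellK {τ : ℂ} (hτ : 0 < τ.im) (u : ℂ) :
    cd τ (u - 2 * ellK τ) = -cd τ u := by
  rw [← neg_eq_iff_eq_neg, ← cd_add_two_ellK hτ, sub_add_cancel]

theorem cd_sub_ellIK' {τ : ℂ} (hτ : 0 < τ.im) (u : ℂ) :
    cd τ (u - ellIK' τ) = 1 / (modulus τ * cd τ u) := by
  rw [← cd_neg hτ, neg_sub, sub_eq_neg_add, cd_add_ellIK' hτ, cd_neg hτ]

theorem cd_sub_ellKappa {τ : ℂ} (hτ : 0 < τ.im) (u : ℂ) :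
    cd τ (u - ellKappa τ) = -1 / (modulus τ * cd τ u) := by
  rw [← cd_neg hτ, neg_sub, sub_eq_neg_add, cd_add_ellKappa hτ, cd_neg hτ]

theorem cd_add_sign {τ : ℂ} (hτ : 0 < τ.im) {e : ℂ} (he : e = 1 ∨ e = -1) (u : ℂ) :
    cd τ (u + e * (2 * ellK τ)) = -cd τ u ∧ cd τ (u + e * ellIK' τ) = 1 / (modulus τ * cd τ u)
    ∧ cd τ (u + e * ellKappa τ) = -1 / (modulus τ * cd τ u) := by
  rcases he with rfl | rfl
  · simp only [one_mul]
    exact ⟨cd_add_two_ellK hτ u, cd_add_ellIK' hτ u, cd_add_ellKappa hτ u⟩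
  · simp only [neg_one_mul, ← sub_eq_add_neg]
    exact ⟨cd_sub_two_ellK hτ u, cd_sub_ellIK' hτ u, cd_sub_ellKappa hτ u⟩

/-- The arguments of `Θ₁` agree modulo its period `2K`. The sign comes from `σ`: `iK' - 2K` and `κ`
differ by `4K`, under which `σ` is antiperiodic. -/
theorem twoStepConst_special {τ : ℂ} (hτ : 0 < τ.im) {e : ℂ} (he : e = 1 ∨ e = -1) {a b : ℂ}
    (h1 : CdFinite τ (b + (a + e * ellKappa τ)
      - (a + (a + e * (2 * ellK τ)) + (a + e * ellIK' τ) + (a + e * ellKappa τ)) / 2))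
    (h2 : CdFinite τ (b - (a + e * ellKappa τ))) :
    twoStepConst τ a (a + e * (2 * ellK τ)) (a + e * ellIK' τ) (a + e * ellKappa τ) b = -1 := by
  obtain ⟨s1, s2, s3, -⟩ := sigmaFun_special hτ he
  have ht : ∀ u, jacobiT1 τ (u - e * (2 * ellK τ)) = jacobiT1 τ u := by
    rcases he with rfl | rfl
    · simp only [one_mul]
      exact jacobiT1_sub_two_ellK hτ
    · simp only [neg_one_mul, sub_neg_eq_add]
      exact jacobiT1_add_two_ellK hτ
  unfold CdFinite at h1 h2
  rw [twoStepConst]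
  rw [← ht] at h1
  have e1 : b + (a + e * ellIK' τ)
      - (a + (a + e * (2 * ellK τ)) + (a + e * ellIK' τ) + (a + e * ellKappa τ)) / 2
      = b + (a + e * ellKappa τ)
      - (a + (a + e * (2 * ellK τ)) + (a + e * ellIK' τ) + (a + e * ellKappa τ)) / 2
      - e * (2 * ellK τ) := by
    rw [ellKappa]
    ring
  have e2 : b - (a + e * ellKappa τ) = b - (a + e * ellIK' τ) - e * (2 * ellK τ) := by
    rw [ellKappa]
    ring
  have e3 : a + e * ellKappa τ - (a + e * (2 * ellK τ)) = e * ellIK' τ := by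
    rw [ellKappa]
    ring
  have e4 : a + e * ellIK' τ - (a + e * (2 * ellK τ)) = e * (ellIK' τ - 2 * ellK τ) := by ring
  rw [e2] at h2
  rw [e1, e2, e3, e4, add_sub_cancel_left, add_sub_cancel_left, s1, ht, ht]
  rw [ht] at h1 h2
  generalize jacobiT1 τ (b - (a + e * ellIK' τ)) = t at *
  generalize jacobiT1 τ (b + (a + e * ellKappa τ)
    - (a + (a + e * (2 * ellK τ)) + (a + e * ellIK' τ) + (a + e * ellKappa τ)) / 2) = t' at *
  generalize sigmaFun τ (e * ellIK' τ) = t1 at *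
  generalize sigmaFun τ (e * ellKappa τ) = t2 at *
  field_simp

/-- Clearing denominators leaves an equation linear in `y`. If the coefficient on the right
vanished, both products would coincide and `2y(X - p)P'` would be zero. -/
theorem solve_of_cross_ratio {y m X p p' P P' : ℂ} (hy : y ≠ 0) (hB : y ≠ -m) (h1 : X - p ≠ 0)
    (h2 : X - p' ≠ 0) (h4 : P' ≠ 0)
    (h : (y - m) / (y - -m) * ((X - p) / (X - p')) = -1 * (P / P')) :
    y * ((X - p) * P' + (X - p') * P) = m * ((X - p) * P' - (X - p') * P)
    ∧ (X - p) * P' - (X - p') * P ≠ 0 := by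
  rw [← sub_ne_zero] at hB
  rw [div_mul_div_comm, ← mul_div_assoc, div_eq_div_iff (mul_ne_zero hB h2) h4] at h
  have e : y * ((X - p) * P' + (X - p') * P) = m * ((X - p) * P' - (X - p') * P) := by
    linear_combination h
  refine ⟨e, fun h0 => ?_⟩
  have h5 : (X - p') * P = (X - p) * P' := by linear_combination -h0
  have h6 : (2 * y) * ((X - p) * P') = 0 := by linear_combination h - (y + m) * h5
  exact mul_ne_zero (mul_ne_zero two_ne_zero hy) (mul_ne_zero h1 h4) h6

/-- All values of `cd` are `±` or inverses up to `k` of `p` and `q`, and the constant is `-1`; the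
cross-ratio relation thus collapses to the linear relation between `y` and the numerator and
denominator of the reduced equation. -/
theorem twoStep_special {τ : ℂ} (hτ : 0 < τ.im) {e : ℂ} (he : e = 1 ∨ e = -1) {a b X Y : ℂ}
    (h : TwoStepRegular τ a (a + e * (2 * ellK τ)) (a + e * ellIK' τ) (a + e * ellKappa τ) b X Y)
    {p q : ℂ} (hp : cd τ (b + (a + e * ellIK' τ)) = p) (hq : cd τ (b - (a + e * ellIK' τ)) = q) :
    p ≠ 0 ∧ q ≠ 0 ∧ cd τ (b + a) = 1 / (modulus τ * p) ∧ cd τ (b - a) = 1 / (modulus τ * q)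
    ∧ ∃ y, twoStepY τ a (a + e * (2 * ellK τ)) (a + e * ellIK' τ) (a + e * ellKappa τ) b X Y = y
    ∧ y ≠ 0
    ∧ (p * (q ^ 2 - p ^ 2) * modulus τ ^ 2 * X ^ 2 * Y - q * (1 - modulus τ ^ 2 * p ^ 4) * X
        + p * (1 - modulus τ ^ 2 * p ^ 2 * q ^ 2) * Y) ≠ 0
    ∧ (p * (q ^ 2 - p ^ 2) * modulus τ ^ 2 * X ^ 2 * Y - q * (1 - modulus τ ^ 2 * p ^ 4) * X
        + p * (1 - modulus τ ^ 2 * p ^ 2 * q ^ 2) * Y)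
      = -modulus τ * y * (q * (1 - modulus τ ^ 2 * p ^ 4) * X * Y - p * (q ^ 2 - p ^ 2)
        - p * (1 - modulus τ ^ 2 * p ^ 2 * q ^ 2) * X ^ 2) := by
  obtain ⟨-, hx3, hx4, hAB, hB, hr⟩ := twoStep_ratio hτ h
  obtain ⟨-, ⟨gB, gA⟩⟩ := h.cdFinite hτ
  obtain ⟨-, -, ⟨-, hfin, hP4⟩, n32, n42, m31, m41, hne⟩ := h
  simp only [List.mem_cons, List.not_mem_nil, or_false, forall_eq_or_imp, forall_eq] at hfin
  have hk := modulus_ne_zero hτ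
  rw [twoStepConst_special hτ he gA hfin.2.2.2.1] at hr
  obtain ⟨t1, t2, t3⟩ := cd_add_sign hτ he (b + a)
  obtain ⟨u1, u2, u3⟩ := cd_add_sign hτ (e := -e)
    (by rcases he with rfl | rfl <;> simp) (b - a)
  have eA : b + (a + e * ellKappa τ) - (a + (a + e * (2 * ellK τ)) + (a + e * ellIK' τ)
      + (a + e * ellKappa τ)) / 2 = b - a := by
    rw [ellKappa]
    ring
  have eB : b + (a + e * ellIK' τ) - (a + (a + e * (2 * ellK τ)) + (a + e * ellIK' τ)
      + (a + e * ellKappa τ)) / 2 = b - a + -e * (2 * ellK τ) := by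
    rw [ellKappa]
    ring
  have em : ∀ t, b - (a + e * t) = b - a + -e * t := fun t => by ring
  rw [eA, eB, u1] at hr hAB
  rw [eB, u1] at hB
  simp only [pP, ← add_assoc, em, t1, t2, t3, u1, u2, u3] at *
  generalize twoStepY τ a (a + e * (2 * ellK τ)) (a + e * ellIK' τ) (a + e * ellKappa τ) b X Y = y
    at *
  -- If this value were 0, then so would be `cd(b + a₂)`, and also `cd(b + a₃)` by the convention
  -- `1/0 = 0`, against regularity; the next claim is similar.
  have hs : cd τ (b + a) ≠ 0 := by
    intro h0
    rw [h0] at n32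
    simp at n32
  have hm : cd τ (b - a) ≠ 0 := by
    intro h0
    rw [h0] at m31
    simp at m31
  subst hp hq
  generalize cd τ (b + a) = s at *
  generalize cd τ (b - a) = m at *
  generalize modulus τ = k at *
  refine ⟨one_div_ne_zero (mul_ne_zero hk hs), one_div_ne_zero (mul_ne_zero hk hm), by field_simp,
    by field_simp, y, rfl, hne, ?_, ?_⟩
  · obtain ⟨-, h2⟩ := solve_of_cross_ratio hne hB hx3 hx4 hP4 hr
    intro h0
    refine h2 ?_
    -- The coefficient from `solve_of_cross_ratio` equals `-4s²m` times the denominator, after `p =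
    -- 1/(ks)` and `q = 1/(km)`.
    refine Eq.trans ?_ (mul_eq_zero_of_right (-(4 * s ^ 2 * m)) h0)
    field_simp
    ring
  · obtain ⟨h1, -⟩ := solve_of_cross_ratio hne hB hx3 hx4 hP4 hr
    refine mul_left_cancel₀ (mul_ne_zero (by norm_num : (4 : ℂ) ≠ 0) (mul_ne_zero (pow_ne_zero 2 hs)
      (pow_ne_zero 2 hm))) ?_
    refine Eq.trans ?_ (neg_inj.2 h1.symm |>.trans ?_)
    · field_simp
      ring
    · field_simp
      ring

theorem rcgHalf_twoStepY {τ : ℂ} (hτ : 0 < τ.im) {e : ℂ} (he : e = 1 ∨ e = -1) {a b X Y z γ : ℂ}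
    (h : TwoStepRegular τ a (a + e * (2 * ellK τ)) (a + e * ellIK' τ) (a + e * ellKappa τ) b X Y)
    (hs : SnFinite τ z) (hc : CdFinite τ z) (hs' : SnFinite τ γ) (hc' : CdFinite τ γ)
    (hz : cd τ z = cd τ (b + a + ellKappa τ)) (hγ : cd τ γ = cd τ (a - b + ellKappa τ)) :
    RCGHalf τ z γ X Y (-1 / (modulus τ * twoStepY τ a (a + e * (2 * ellK τ)) (a + e * ellIK' τ)
      (a + e * ellKappa τ) b X Y)) := by
  obtain ⟨hp, hq, ha, hm, y, hy, hne, h0, h1⟩ := twoStep_special hτ he h rfl rfl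
  obtain ⟨ρ, hρ, hr⟩ := rcg_eq hτ hs hc hs' hc'
  have hk := modulus_ne_zero hτ
  rw [cd_add_ellKappa hτ, ha] at hz
  rw [cd_add_ellKappa hτ, ← neg_sub, cd_neg hτ, hm] at hγ
  rw [hy, RCGHalf, (hr X Y).1, (hr X Y).2, hz, hγ]
  clear hr
  generalize cd τ (b + (a + e * ellIK' τ)) = p at *
  generalize cd τ (b - (a + e * ellIK' τ)) = q at *
  generalize modulus τ = k at *
  have e1 : ∀ t, t ≠ 0 → -1 / (k * (1 / (k * t))) = -t := by
    intro t ht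
    field_simp
  rw [e1 p hp, e1 q hq]
  have e2 : ρ * (k ^ 2 * (-p * ((-q) ^ 2 - (-p) ^ 2)) * X ^ 2 * Y
      - -q * (1 - k ^ 2 * (-p) ^ 4) * X + -p * (1 - k ^ 2 * (-p) ^ 2 * (-q) ^ 2) * Y)
      = -ρ * (p * (q ^ 2 - p ^ 2) * k ^ 2 * X ^ 2 * Y - q * (1 - k ^ 2 * p ^ 4) * X
        + p * (1 - k ^ 2 * p ^ 2 * q ^ 2) * Y) := by ring
  have e3 : ρ * (k ^ 2 * (-p * ((-q) ^ 2 - (-p) ^ 2)) * X ^ 2 * Y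
      - -q * (1 - k ^ 2 * (-p) ^ 4) * X + -p * (1 - k ^ 2 * (-p) ^ 2 * (-q) ^ 2) * Y) ≠ 0 := by
    rw [e2]
    exact mul_ne_zero (neg_ne_zero.2 hρ) h0
  refine ⟨hs, hs', e3, ?_⟩
  rw [div_eq_div_iff (mul_ne_zero hk hne) e3]
  linear_combination ρ * h1

/-- Needed for the second half, where the equation contains `ỹ = -1/(kX)` in place of the
intermediate value `X`. This inversion together with a shift of `z` by `κ` multiplies numerator and
denominator by the same factor. -/
theorem rcgHalf_twoStepY_inv {τ : ℂ} (hτ : 0 < τ.im) {e : ℂ} (he : e = 1 ∨ e = -1)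
    {a b X Y z γ : ℂ} (hX : X ≠ 0)
    (h : TwoStepRegular τ a (a + e * (2 * ellK τ)) (a + e * ellIK' τ) (a + e * ellKappa τ) b X Y)
    (hs : SnFinite τ z) (hc : CdFinite τ z) (hs' : SnFinite τ γ) (hc' : CdFinite τ γ)
    (hz : cd τ z = cd τ (b + a)) (hγ : cd τ γ = cd τ (a - b + ellKappa τ)) :
    RCGHalf τ z γ (-1 / (modulus τ * X)) Y (-1 / (modulus τ * twoStepY τ a
      (a + e * (2 * ellK τ)) (a + e * ellIK' τ) (a + e * ellKappa τ) b X Y)) := by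
  obtain ⟨hp, hq, ha, hm, y, hy, hne, h0, h1⟩ := twoStep_special hτ he h rfl rfl
  obtain ⟨ρ, hρ, hr⟩ := rcg_eq hτ hs hc hs' hc'
  have hk := modulus_ne_zero hτ
  rw [ha] at hz
  rw [cd_add_ellKappa hτ, ← neg_sub, cd_neg hτ, hm] at hγ
  rw [hy, RCGHalf, (hr _ Y).1, (hr _ Y).2, hz, hγ]
  clear hr
  generalize cd τ (b + (a + e * ellIK' τ)) = p at *
  generalize cd τ (b - (a + e * ellIK' τ)) = q at *
  generalize modulus τ = k at *
  have e1 : ∀ t, t ≠ 0 → -1 / (k * (1 / (k * t))) = -t := by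
    intro t ht
    field_simp
  rw [e1 q hq]
  set d := p * (q ^ 2 - p ^ 2) * k ^ 2 * X ^ 2 * Y - q * (1 - k ^ 2 * p ^ 4) * X
    + p * (1 - k ^ 2 * p ^ 2 * q ^ 2) * Y with hd
  have hc0 : -ρ / (k ^ 3 * p ^ 4 * X ^ 2) ≠ 0 := div_ne_zero (neg_ne_zero.2 hρ)
    (mul_ne_zero (mul_ne_zero (pow_ne_zero 3 hk) (pow_ne_zero 4 hp)) (pow_ne_zero 2 hX))
  have e2 : ρ * (k ^ 2 * (1 / (k * p) * ((-q) ^ 2 - (1 / (k * p)) ^ 2)) * (-1 / (k * X)) ^ 2 * Y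
      - -q * (1 - k ^ 2 * (1 / (k * p)) ^ 4) * (-1 / (k * X))
      + 1 / (k * p) * (1 - k ^ 2 * (1 / (k * p)) ^ 2 * (-q) ^ 2) * Y)
      = -ρ / (k ^ 3 * p ^ 4 * X ^ 2) * d := by
    rw [hd]
    field_simp
    ring
  have e3 : ρ * (-q * (1 - k ^ 2 * (1 / (k * p)) ^ 4) * (-1 / (k * X)) * Y
      - 1 / (k * p) * ((-q) ^ 2 - (1 / (k * p)) ^ 2)
      - 1 / (k * p) * (1 - k ^ 2 * (1 / (k * p)) ^ 2 * (-q) ^ 2) * (-1 / (k * X)) ^ 2)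
      = -ρ / (k ^ 3 * p ^ 4 * X ^ 2) * (q * (1 - k ^ 2 * p ^ 4) * X * Y - p * (q ^ 2 - p ^ 2)
        - p * (1 - k ^ 2 * p ^ 2 * q ^ 2) * X ^ 2) := by
    field_simp
    ring
  rw [e2, e3]
  refine ⟨hs, hs', mul_ne_zero hc0 h0, ?_⟩
  rw [mul_div_mul_left _ _ hc0, div_eq_div_iff (mul_ne_zero hk hne) h0]
  linear_combination -h1

/-! ### Genericity near a base point -/

section Genericity

variable {E : Type} [NormedAddCommGroup E] [NormedSpace ℂ E]

/-- The property holds outside the zero set of an entire function that does not vanish at `p₀`. -/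
def GenAt (p0 : E) (P : E → Prop) : Prop :=
  ∃ F : E → ℂ, (∀ p, AnalyticAt ℂ F p) ∧ F p0 ≠ 0 ∧ ∀ p, F p ≠ 0 → P p

/-- The function is a quotient of entire functions, the denominator of which does not vanish
at `p₀`, outside the zeros of this denominator. -/
def MeroAt (p0 : E) (f : E → ℂ) : Prop :=
  ∃ N D : E → ℂ, (∀ p, AnalyticAt ℂ N p) ∧ (∀ p, AnalyticAt ℂ D p) ∧ D p0 ≠ 0
    ∧ ∀ p, D p ≠ 0 → f p = N p / D p

variable {p0 : E}

theorem GenAt.generically {P : E → Prop} (h : GenAt p0 P) : Generically P := by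
  obtain ⟨F, h1, h2, h3⟩ := h
  exact ⟨F, fun p _ => h1 p, ⟨p0, h2⟩, h3⟩

theorem GenAt.mono {P Q : E → Prop} (h : GenAt p0 P) (hPQ : ∀ p, P p → Q p) : GenAt p0 Q := by
  obtain ⟨F, h1, h2, h3⟩ := h
  exact ⟨F, h1, h2, fun p hp => hPQ p (h3 p hp)⟩

/-- The common base point makes the product of the two entire functions nonzero at once; no identity
theorem in several variables is needed. -/
theorem GenAt.and {P Q : E → Prop} (hP : GenAt p0 P) (hQ : GenAt p0 Q) :
    GenAt p0 fun p => P p ∧ Q p := by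
  obtain ⟨F, h1, h2, h3⟩ := hP
  obtain ⟨G, k1, k2, k3⟩ := hQ
  exact ⟨fun p => F p * G p, fun p => (h1 p).mul (k1 p), mul_ne_zero h2 k2,
    fun p hp => ⟨h3 p (left_ne_zero_of_mul hp), k3 p (right_ne_zero_of_mul hp)⟩⟩

theorem GenAt.of_entire {f : E → ℂ} (hf : ∀ p, AnalyticAt ℂ f p) (h : f p0 ≠ 0) :
    GenAt p0 fun p => f p ≠ 0 :=
  ⟨f, hf, h, fun _ => id⟩

theorem MeroAt.of_entire {f : E → ℂ} (hf : ∀ p, AnalyticAt ℂ f p) : MeroAt p0 f :=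
  ⟨f, fun _ => 1, hf, fun _ => analyticAt_const, one_ne_zero, fun _ _ => (div_one _).symm⟩

theorem MeroAt.const (c : ℂ) : MeroAt p0 fun _ : E => c :=
  .of_entire fun _ => analyticAt_const

theorem MeroAt.add {f g : E → ℂ} (hf : MeroAt p0 f) (hg : MeroAt p0 g) :
    MeroAt p0 fun p => f p + g p := by
  obtain ⟨N, D, h1, h2, h3, h4⟩ := hf
  obtain ⟨N', D', k1, k2, k3, k4⟩ := hg
  refine ⟨fun p => N p * D' p + D p * N' p, fun p => D p * D' p, fun p => by fun_prop,
    fun p => by fun_prop, mul_ne_zero h3 k3, fun p hp => ?_⟩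
  have hD := left_ne_zero_of_mul hp
  have hD' := right_ne_zero_of_mul hp
  simp only [h4 p hD, k4 p hD', div_add_div _ _ hD hD']

theorem MeroAt.neg {f : E → ℂ} (hf : MeroAt p0 f) : MeroAt p0 fun p => -f p := by
  obtain ⟨N, D, h1, h2, h3, h4⟩ := hf
  exact ⟨fun p => -N p, D, fun p => by fun_prop, h2, h3, fun p hp => by
    simp only [h4 p hp, neg_div]⟩

theorem MeroAt.sub {f g : E → ℂ} (hf : MeroAt p0 f) (hg : MeroAt p0 g) :
    MeroAt p0 fun p => f p - g p := by
  simpa only [sub_eq_add_neg] using hf.add hg.neg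

theorem MeroAt.mul {f g : E → ℂ} (hf : MeroAt p0 f) (hg : MeroAt p0 g) :
    MeroAt p0 fun p => f p * g p := by
  obtain ⟨N, D, h1, h2, h3, h4⟩ := hf
  obtain ⟨N', D', k1, k2, k3, k4⟩ := hg
  refine ⟨fun p => N p * N' p, fun p => D p * D' p, fun p => by fun_prop,
    fun p => by fun_prop, mul_ne_zero h3 k3, fun p hp => ?_⟩
  simp only [h4 p (left_ne_zero_of_mul hp), k4 p (right_ne_zero_of_mul hp), div_mul_div_comm]

theorem num_ne_zero_of_eq_div {E : Type} {p0 : E} {f N D : E → ℂ} (h3 : D p0 ≠ 0)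
    (h4 : ∀ p, D p ≠ 0 → f p = N p / D p) (h : f p0 ≠ 0) : N p0 ≠ 0 := by
  rw [h4 p0 h3] at h
  exact (div_ne_zero_iff.1 h).1

theorem MeroAt.div {f g : E → ℂ} (hf : MeroAt p0 f) (hg : MeroAt p0 g) (h0 : g p0 ≠ 0) :
    MeroAt p0 fun p => f p / g p := by
  obtain ⟨N, D, h1, h2, h3, h4⟩ := hf
  obtain ⟨N', D', k1, k2, k3, k4⟩ := hg
  have hN := num_ne_zero_of_eq_div k3 k4 h0
  -- The superfluous factor `D'` keeps the new denominator from being nonzero where the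
  -- representation of `g` is not valid.
  refine ⟨fun p => N p * D' p * D' p, fun p => D p * N' p * D' p, fun p => by fun_prop,
    fun p => by fun_prop, mul_ne_zero (mul_ne_zero h3 hN) k3, fun p hp => ?_⟩
  have hD' := right_ne_zero_of_mul hp
  simp only [h4 p (left_ne_zero_of_mul (left_ne_zero_of_mul hp)), k4 p hD', div_div_div_eq]
  field_simp

theorem MeroAt.ne_zero {f : E → ℂ} (hf : MeroAt p0 f) (h : f p0 ≠ 0) :
    GenAt p0 fun p => f p ≠ 0 := by
  obtain ⟨N, D, h1, h2, h3, h4⟩ := hf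
  refine ⟨fun p => N p * D p, fun p => by fun_prop, mul_ne_zero (num_ne_zero_of_eq_div h3 h4 h) h3,
    fun p hp => ?_⟩
  simp only [h4 p (right_ne_zero_of_mul hp)]
  exact div_ne_zero (left_ne_zero_of_mul hp) (right_ne_zero_of_mul hp)

theorem MeroAt.ne {f g : E → ℂ} (hf : MeroAt p0 f) (hg : MeroAt p0 g) (h : f p0 ≠ g p0) :
    GenAt p0 fun p => f p ≠ g p :=
  ((hf.sub hg).ne_zero (sub_ne_zero.2 h)).mono fun _ => sub_ne_zero.1

variable {τ : ℂ}

theorem analyticAt_comp_of_differentiable {g : ℂ → ℂ} (hg : Differentiable ℂ g) {a : E → ℂ}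
    (ha : ∀ p, AnalyticAt ℂ a p) (p : E) : AnalyticAt ℂ (fun p => g (a p)) p :=
  (hg.analyticAt (a p)).comp (ha p)

theorem GenAt.cdFinite (hτ : 0 < τ.im) {a : E → ℂ} (ha : ∀ p, AnalyticAt ℂ a p)
    (h : CdFinite τ (a p0)) : GenAt p0 fun p => CdFinite τ (a p) :=
  .of_entire (analyticAt_comp_of_differentiable (differentiable_jacobiT1 hτ) ha) h

theorem GenAt.snFinite (hτ : 0 < τ.im) {a : E → ℂ} (ha : ∀ p, AnalyticAt ℂ a p)
    (h : SnFinite τ (a p0)) : GenAt p0 fun p => SnFinite τ (a p) :=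
  .of_entire (analyticAt_comp_of_differentiable (differentiable_jacobiT hτ) ha) h

theorem MeroAt.cd (hτ : 0 < τ.im) {a : E → ℂ} (ha : ∀ p, AnalyticAt ℂ a p)
    (h : CdFinite τ (a p0)) : MeroAt p0 fun p => cd τ (a p) := by
  have h1 := analyticAt_comp_of_differentiable (differentiable_jacobiT1 hτ) ha
  exact ⟨fun p => jacobiH1 τ (a p), fun p => sqrtModulus τ * jacobiT1 τ (a p),
    analyticAt_comp_of_differentiable (differentiable_jacobiH1 hτ) ha, fun p => by fun_prop,
    mul_ne_zero (sqrtModulus_ne_zero hτ) h, fun _ _ => rfl⟩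

variable {c1 c2 η x y a1 a2 a3 a4 b : E → ℂ}

theorem MeroAt.s2Ratio (hτ : 0 < τ.im) (h1 : ∀ p, AnalyticAt ℂ c1 p)
    (h2 : ∀ p, AnalyticAt ℂ c2 p) (hη : ∀ p, AnalyticAt ℂ η p) (hx : MeroAt p0 x)
    (hy : MeroAt p0 y) (h : S2Regular τ (c1 p0) (c2 p0) (η p0) (x p0) (y p0)) :
    MeroAt p0 fun p => s2Ratio τ (c1 p) (c2 p) (η p) (x p) (y p) := by
  obtain ⟨hf, r1, r2, r3, r4, r5, r6, -, -, r9, -, -⟩ := h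
  simp only [List.mem_cons, List.not_mem_nil, or_false, forall_eq_or_imp, forall_eq] at hf
  obtain ⟨f0, f1, f2, f3, f4, f5, f6, f7⟩ := hf
  rw [← sub_ne_zero] at r6 r9
  unfold EllipticPainleve.s2Ratio s2Const
  repeat' first
    | exact hx
    | exact hy
    | with_reducible apply MeroAt.const
    | with_reducible apply MeroAt.sub
    | with_reducible apply MeroAt.mul
    | with_reducible apply MeroAt.div
    | with_reducible apply MeroAt.cd hτ
  all_goals first | assumption | exact fun p => by fun_prop (disch := norm_num)

theorem MeroAt.s2y (hτ : 0 < τ.im) (h1 : ∀ p, AnalyticAt ℂ c1 p)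
    (h2 : ∀ p, AnalyticAt ℂ c2 p) (hη : ∀ p, AnalyticAt ℂ η p) (hx : MeroAt p0 x)
    (hy : MeroAt p0 y) (h : S2Regular τ (c1 p0) (c2 p0) (η p0) (x p0) (y p0)) :
    MeroAt p0 fun p => s2y τ (c1 p) (c2 p) (η p) (x p) (y p) := by
  have hr := MeroAt.s2Ratio hτ h1 h2 hη hx hy h
  obtain ⟨hf, -, -, -, -, -, -, -, -, -, -, hM⟩ := h
  simp only [List.mem_cons, List.not_mem_nil, or_false, forall_eq_or_imp, forall_eq] at hf
  obtain ⟨-, -, -, -, -, f5, f6, -⟩ := hf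
  have hA := MeroAt.cd (p0 := p0) hτ (a := fun p => 2 * η p - (c1 p - c2 p) / 2)
    (fun p => by fun_prop (disch := norm_num)) f5
  have hB := MeroAt.cd (p0 := p0) hτ (a := fun p => 2 * η p + (c1 p - c2 p) / 2)
    (fun p => by fun_prop (disch := norm_num)) f6
  exact (hA.sub (hr.mul hB)).div ((MeroAt.const 1).sub hr) (sub_ne_zero.2 hM.symm)

theorem GenAt.s2Regular (hτ : 0 < τ.im) (h1 : ∀ p, AnalyticAt ℂ c1 p)
    (h2 : ∀ p, AnalyticAt ℂ c2 p) (hη : ∀ p, AnalyticAt ℂ η p) (hx : MeroAt p0 x)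
    (hy : MeroAt p0 y) (h : S2Regular τ (c1 p0) (c2 p0) (η p0) (x p0) (y p0)) :
    GenAt p0 fun p => S2Regular τ (c1 p) (c2 p) (η p) (x p) (y p) := by
  have hr := MeroAt.s2Ratio hτ h1 h2 hη hx hy h
  obtain ⟨hf, r1, r2, r3, r4, r5, r6, r7, r8, r9, r10, r11⟩ := h
  unfold S2Regular
  simp only [List.mem_cons, List.not_mem_nil, or_false, forall_eq_or_imp, forall_eq] at hf ⊢
  obtain ⟨f0, f1, f2, f3, f4, f5, f6, f7⟩ := hf
  refine GenAt.and ?_ (GenAt.and (MeroAt.ne_zero ?_ r1) (GenAt.and (MeroAt.ne_zero ?_ r2)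
    (GenAt.and (MeroAt.ne_zero ?_ r3) (GenAt.and (MeroAt.ne_zero ?_ r4)
    (GenAt.and (MeroAt.ne_zero ?_ r5) (GenAt.and (MeroAt.ne ?_ ?_ r6)
    (GenAt.and (MeroAt.ne ?_ ?_ r7) (GenAt.and (MeroAt.ne ?_ ?_ r8) (GenAt.and (MeroAt.ne ?_ ?_ r9)
    (GenAt.and (MeroAt.ne ?_ ?_ r10) (MeroAt.ne hr (.const 1) r11)))))))))))
  · repeat' with_reducible apply GenAt.and
    all_goals apply GenAt.cdFinite hτ
    all_goals first | assumption | exact fun p => by fun_prop (disch := norm_num)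
  all_goals
    repeat' first
      | exact hx
      | exact hy
      | with_reducible apply MeroAt.const
      | with_reducible apply MeroAt.sub
      | with_reducible apply MeroAt.mul
      | with_reducible apply MeroAt.div
      | with_reducible apply MeroAt.cd hτ
  all_goals first | assumption | exact fun p => by fun_prop (disch := norm_num)

theorem MeroAt.pP (hτ : 0 < τ.im) (h1 : ∀ p, AnalyticAt ℂ a1 p)
    (h2 : ∀ p, AnalyticAt ℂ a2 p) (h3 : ∀ p, AnalyticAt ℂ a3 p) (hb : ∀ p, AnalyticAt ℂ b p)
    (hx : MeroAt p0 x) (hy : MeroAt p0 y)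
    (f1 : CdFinite τ (b p0 - a1 p0) ∧ CdFinite τ (b p0 + a1 p0))
    (f2 : CdFinite τ (b p0 - a2 p0) ∧ CdFinite τ (b p0 + a2 p0))
    (f3 : CdFinite τ (b p0 - a3 p0) ∧ CdFinite τ (b p0 + a3 p0)) :
    MeroAt p0 fun p => pP τ (a1 p) (a2 p) (a3 p) (b p) (x p) (y p) := by
  have m1 := MeroAt.cd (p0 := p0) hτ (a := fun p => b p - a1 p) (fun p => by fun_prop) f1.1
  have m2 := MeroAt.cd (p0 := p0) hτ (a := fun p => b p - a2 p) (fun p => by fun_prop) f2.1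
  have m3 := MeroAt.cd (p0 := p0) hτ (a := fun p => b p - a3 p) (fun p => by fun_prop) f3.1
  have p1 := MeroAt.cd (p0 := p0) hτ (a := fun p => b p + a1 p) (fun p => by fun_prop) f1.2
  have p2 := MeroAt.cd (p0 := p0) hτ (a := fun p => b p + a2 p) (fun p => by fun_prop) f2.2
  have p3 := MeroAt.cd (p0 := p0) hτ (a := fun p => b p + a3 p) (fun p => by fun_prop) f3.2
  unfold EllipticPainleve.pP
  repeat' first
    | assumption
    | with_reducible apply MeroAt.sub
    | with_reducible apply MeroAt.mul
    | with_reducible apply MeroAt.add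

theorem GenAt.gPRegular (hτ : 0 < τ.im) (h1 : ∀ p, AnalyticAt ℂ a1 p)
    (h2 : ∀ p, AnalyticAt ℂ a2 p) (h3 : ∀ p, AnalyticAt ℂ a3 p) (h4 : ∀ p, AnalyticAt ℂ a4 p)
    (hb : ∀ p, AnalyticAt ℂ b p) (hx : MeroAt p0 x) (hy : MeroAt p0 y)
    (h : GPRegular τ (a1 p0) (a2 p0) (a3 p0) (a4 p0) (b p0) (x p0) (y p0)) :
    GenAt p0 fun p => GPRegular τ (a1 p) (a2 p) (a3 p) (a4 p) (b p) (x p) (y p) := by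
  obtain ⟨hG, hf, hP⟩ := h
  unfold GPRegular
  simp only [GRegular, List.mem_cons, List.not_mem_nil, or_false, forall_eq_or_imp, forall_eq]
    at hG hf ⊢
  refine GenAt.and ?_ (GenAt.and ?_ (MeroAt.ne_zero ?_ hP))
  · obtain ⟨⟨f1, f2, f3, f4, f5, f6, f7, f8, f9, f10⟩, hG⟩ := hG
    obtain ⟨r1, r2, r3, r4, r5, r6, r7, r8⟩ := hG
    refine GenAt.and ?_ (GenAt.and (MeroAt.ne_zero ?_ r1) (GenAt.and (MeroAt.ne_zero ?_ r2)
      (GenAt.and (MeroAt.ne_zero ?_ r3) (GenAt.and (MeroAt.ne_zero ?_ r4)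
      (GenAt.and (MeroAt.ne_zero ?_ r5) (GenAt.and (MeroAt.ne_zero ?_ r6)
      (GenAt.and (MeroAt.ne_zero ?_ r7) (MeroAt.ne_zero ?_ r8))))))))
    · repeat' with_reducible apply GenAt.and
      all_goals apply GenAt.cdFinite hτ
      all_goals first | assumption | exact fun p => by fun_prop (disch := norm_num)
    all_goals
      repeat' first
        | with_reducible apply MeroAt.const
        | with_reducible apply MeroAt.sub
        | with_reducible apply MeroAt.div
        | with_reducible apply MeroAt.cd hτ
    all_goals first | assumption | exact fun p => by fun_prop (disch := norm_num)
  · obtain ⟨⟨f1, f2⟩, ⟨f3, f4⟩, ⟨f5, f6⟩, ⟨f7, f8⟩⟩ := hf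
    repeat' with_reducible apply GenAt.and
    all_goals apply GenAt.cdFinite hτ
    all_goals first | assumption | exact fun p => by fun_prop (disch := norm_num)
  · exact MeroAt.pP hτ h1 h2 h4 hb hx hy hf.1 hf.2.1 hf.2.2.2

theorem MeroAt.twoStepY (hτ : 0 < τ.im) (h1 : ∀ p, AnalyticAt ℂ a1 p)
    (h2 : ∀ p, AnalyticAt ℂ a2 p) (h3 : ∀ p, AnalyticAt ℂ a3 p) (h4 : ∀ p, AnalyticAt ℂ a4 p)
    (hb : ∀ p, AnalyticAt ℂ b p) (hx : MeroAt p0 x) (hy : MeroAt p0 y)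
    (h : TwoStepRegular τ (a1 p0) (a2 p0) (a3 p0) (a4 p0) (b p0) (x p0) (y p0)) :
    MeroAt p0 fun p => twoStepY τ (a1 p) (a2 p) (a3 p) (a4 p) (b p) (x p) (y p) := by
  unfold EllipticPainleve.twoStepY
  refine MeroAt.s2y hτ ?_ ?_ ?_ hx (MeroAt.s2y hτ h1 h2 hb hx hy h.1) h.2.1 <;>
    exact fun p => by fun_prop (disch := norm_num)

theorem GenAt.twoStepRegular (hτ : 0 < τ.im) (h1 : ∀ p, AnalyticAt ℂ a1 p)
    (h2 : ∀ p, AnalyticAt ℂ a2 p) (h3 : ∀ p, AnalyticAt ℂ a3 p) (h4 : ∀ p, AnalyticAt ℂ a4 p)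
    (hb : ∀ p, AnalyticAt ℂ b p) (hx : MeroAt p0 x) (hy : MeroAt p0 y)
    (h : TwoStepRegular τ (a1 p0) (a2 p0) (a3 p0) (a4 p0) (b p0) (x p0) (y p0)) :
    GenAt p0 fun p => TwoStepRegular τ (a1 p) (a2 p) (a3 p) (a4 p) (b p) (x p) (y p) := by
  have hY := MeroAt.twoStepY hτ h1 h2 h3 h4 hb hx hy h
  obtain ⟨r1, r2, r3, r4, r5, r6, r7, r8⟩ := h
  have hf := r3.2.1
  simp only [List.mem_cons, List.not_mem_nil, or_false, forall_eq_or_imp, forall_eq] at hf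
  obtain ⟨⟨f1, -⟩, ⟨-, f4⟩, ⟨f5, f6⟩, ⟨f7, f8⟩⟩ := hf
  unfold TwoStepRegular
  refine GenAt.and (GenAt.s2Regular hτ h1 h2 hb hx hy r1) (GenAt.and
    (GenAt.s2Regular hτ ?_ ?_ ?_ hx (MeroAt.s2y hτ h1 h2 hb hx hy r1) r2)
    (GenAt.and (GenAt.gPRegular hτ h1 h2 h3 h4 hb hx hy r3) (GenAt.and (MeroAt.ne ?_ ?_ r4)
    (GenAt.and (MeroAt.ne ?_ ?_ r5) (GenAt.and (MeroAt.ne ?_ ?_ r6)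
    (GenAt.and (MeroAt.ne ?_ ?_ r7) (hY.ne_zero r8)))))))
  all_goals try with_reducible apply MeroAt.cd hτ
  all_goals first | assumption | exact fun p => by fun_prop (disch := norm_num)

/-- A family of points the parameters of which are entire and the coordinates of which are
meromorphic near the base point. -/
def MeroStateAt (p0 : E) (σ : E → State) : Prop :=
  (∀ i p, AnalyticAt ℂ (fun q => (σ q).1 i) p) ∧ (∀ p, AnalyticAt ℂ (fun q => (σ q).2.1) p)
  ∧ MeroAt p0 (fun q => (σ q).2.2.1) ∧ MeroAt p0 (fun q => (σ q).2.2.2)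

variable {σ : E → State}

theorem MeroStateAt.firstY (hτ : 0 < τ.im) (hσ : MeroStateAt p0 σ)
    (h : HalfStepRegular τ (σ p0)) : MeroAt p0 fun q => firstY τ (σ q) :=
  MeroAt.twoStepY hτ (hσ.1 4) (hσ.1 5) (hσ.1 6) (hσ.1 7) hσ.2.1 hσ.2.2.1 hσ.2.2.2 h.1

theorem MeroStateAt.analyticAt_sumB (hσ : MeroStateAt p0 σ) (p : E) :
    AnalyticAt ℂ (fun q => sumB (σ q).1 / 4) p := by
  have h4 := hσ.1 4
  have h5 := hσ.1 5
  have h6 := hσ.1 6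
  have h7 := hσ.1 7
  unfold sumB
  fun_prop (disch := norm_num)

theorem MeroStateAt.analyticAt_add (hσ : MeroStateAt p0 σ) (i : Fin 8) (p : E) :
    AnalyticAt ℂ (fun q => (σ q).2.1 + (σ q).1 i + sumB (σ q).1 / 4) p :=
  ((hσ.2.1 p).add (hσ.1 i p)).add (hσ.analyticAt_sumB p)

theorem MeroStateAt.secondX (hτ : 0 < τ.im) (hσ : MeroStateAt p0 σ)
    (h : HalfStepRegular τ (σ p0)) : MeroAt p0 fun q => secondX τ (σ q) :=
  MeroAt.twoStepY hτ (hσ.analyticAt_add 0) (hσ.analyticAt_add 1) (hσ.analyticAt_add 2)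
    (hσ.analyticAt_add 3) hσ.analyticAt_sumB (hσ.firstY hτ h) hσ.2.2.1 h.2

theorem MeroStateAt.halfStepRegular (hτ : 0 < τ.im) (hσ : MeroStateAt p0 σ)
    (h : HalfStepRegular τ (σ p0)) : GenAt p0 fun q => HalfStepRegular τ (σ q) :=
  (GenAt.twoStepRegular hτ (hσ.1 4) (hσ.1 5) (hσ.1 6) (hσ.1 7) hσ.2.1 hσ.2.2.1 hσ.2.2.2 h.1).and
    (GenAt.twoStepRegular hτ (hσ.analyticAt_add 0) (hσ.analyticAt_add 1) (hσ.analyticAt_add 2)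
      (hσ.analyticAt_add 3) hσ.analyticAt_sumB (hσ.firstY hτ h) hσ.2.2.1 h.2)

theorem HalfStepRegular.ne_zero {p : State} (h : HalfStepRegular τ p) :
    firstY τ p ≠ 0 ∧ secondX τ p ≠ 0 :=
  ⟨h.1.2.2.2.2.2.2.2, h.2.2.2.2.2.2.2.2⟩

/-- Regularity at the single point `σ p0` suffices, which permits iteration along an orbit. -/
theorem MeroStateAt.wordImage_RJ1 (hτ : 0 < τ.im) (hσ : MeroStateAt p0 σ)
    (h : HalfStepRegular τ (σ p0)) : MeroStateAt p0 fun q => wordImage τ RJ1 (σ q) := by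
  have hk := modulus_ne_zero hτ
  have h0 := hσ.1 0
  have h1 := hσ.1 1
  have h2 := hσ.1 2
  have h3 := hσ.1 3
  have h4 := hσ.1 4
  have h5 := hσ.1 5
  have h6 := hσ.1 6
  have h7 := hσ.1 7
  have hη := hσ.2.1
  have e : ∀ q, wordImage τ RJ1 (σ q) = (stepC τ (σ q).1, stepEta (σ q).1 (σ q).2.1,
      -1 / (modulus τ * EllipticPainleve.secondX τ (σ q)),
      -1 / (modulus τ * EllipticPainleve.firstY τ (σ q))) :=
    fun q => EllipticPainleve.wordImage_RJ1 τ _ _ _ _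
  simp only [e]
  refine ⟨fun i p => ?_, fun p => ?_, ?_, ?_⟩
  · have hi := hσ.1 i
    simp only [stepC, sumA, sumB]
    split_ifs <;> fun_prop (disch := norm_num)
  · simp only [stepEta, sumA, sumB]
    fun_prop (disch := norm_num)
  · exact (MeroAt.const _).div ((MeroAt.const _).mul (hσ.secondX hτ h))
      (mul_ne_zero hk h.ne_zero.2)
  · exact (MeroAt.const _).div ((MeroAt.const _).mul (hσ.firstY hτ h))
      (mul_ne_zero hk h.ne_zero.1)

end Genericity

theorem _root_.AnalyticAt.fst_and_snd {E F G : Type} [NormedAddCommGroup E] [NormedSpace ℂ E]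
    [NormedAddCommGroup F] [NormedSpace ℂ F] [NormedAddCommGroup G] [NormedSpace ℂ G]
    {f : E → F × G} {p : E} (hf : AnalyticAt ℂ f p) :
    AnalyticAt ℂ (fun q => (f q).1) p ∧ AnalyticAt ℂ (fun q => (f q).2) p :=
  ⟨analyticAt_fst.fun_comp hf, analyticAt_snd.fun_comp hf⟩

theorem meroStateAt_id (p0 : State) : MeroStateAt p0 fun p => p := by
  have h := fun p : State => (analyticAt_id (𝕜 := ℂ) (z := p)).fst_and_snd
  refine ⟨fun i p => ?_, fun p => (h p).2.fst_and_snd.1, .of_entire fun p =>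
    (h p).2.fst_and_snd.2.fst_and_snd.1, .of_entire fun p => (h p).2.fst_and_snd.2.fst_and_snd.2⟩
  exact ((ContinuousLinearMap.proj (R := ℂ) (φ := fun _ : Fin 8 => ℂ) i).analyticAt p.1).fun_comp
    analyticAt_fst

theorem meroStateAt_specialState (τ : ℂ) (q0 : ℂ × ℂ × ℂ × ℂ × ℂ) :
    MeroStateAt q0 (specialState τ) := by
  have h := fun p : ℂ × ℂ × ℂ × ℂ × ℂ => (analyticAt_id (𝕜 := ℂ) (z := p)).fst_and_snd
  have h1 := fun p => (h p).1
  have h2 := fun p => (h p).2.fst_and_snd.1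
  have h3 := fun p => (h p).2.fst_and_snd.2.fst_and_snd
  refine ⟨fun i p => ?_, fun p => (h3 p).1, .of_entire fun p => (h3 p).2.fst_and_snd.1,
    .of_entire fun p => (h3 p).2.fst_and_snd.2⟩
  fin_cases i
  exacts [h1 p, (h1 p).add analyticAt_const, (h1 p).add analyticAt_const,
    (h1 p).add analyticAt_const, h2 p, (h2 p).add analyticAt_const, (h2 p).add analyticAt_const,
    (h2 p).add analyticAt_const]

/-! ### Generic points on the invariant curve -/

theorem sigmaFun_ne_zero_of_eq_or {τ : ℂ} {v w : ℂ} (h : sigmaFun τ w ≠ 0)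
    (e : v = w ∨ v = -w) : sigmaFun τ v ≠ 0 := by
  rcases e with rfl | rfl
  · exact h
  · rwa [sigmaFun_neg, neg_ne_zero]

theorem one_sub_div_ne_zero {a b : ℂ} (hb : b ≠ 0) (h : b ≠ a) : 1 - a / b ≠ 0 := by
  rw [one_sub_div_eq hb]
  exact div_ne_zero (sub_ne_zero.2 h) hb

/-- No linear combination of `a, b, u, P, Q` with rational coefficients which involves `a`, `b`
or `u` is a zero of the theta functions. -/
def TripleGeneric (τ P Q a b u : ℂ) : Prop :=
  ∀ l m n r s : ℚ, l ≠ 0 ∨ m ≠ 0 ∨ n ≠ 0 →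
    ThetaGeneric τ (l * a + m * b + n * u + r * P + s * Q)

section Curve

variable {τ P Q a b u : ℂ}

theorem TripleGeneric.cdFinite (hg : TripleGeneric τ P Q a b u) (l m n r s : ℚ)
    (h : l ≠ 0 ∨ m ≠ 0 ∨ n ≠ 0) {w : ℂ} (hw : w = l * a + m * b + n * u + r * P + s * Q) :
    CdFinite τ w := by
  rw [hw]
  exact (hg l m n r s h).2.1

theorem TripleGeneric.cd_ne_zero (hg : TripleGeneric τ P Q a b u) (hτ : 0 < τ.im) (l m n r s : ℚ)
    (h : l ≠ 0 ∨ m ≠ 0 ∨ n ≠ 0) {w : ℂ} (hw : w = l * a + m * b + n * u + r * P + s * Q) :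
    cd τ w ≠ 0 := by
  rw [hw]
  exact EllipticPainleve.cd_ne_zero hτ (hg l m n r s h).2.1 (hg l m n r s h).2.2.1

theorem TripleGeneric.sigmaFun_ne_zero (hg : TripleGeneric τ P Q a b u) (l m n r s : ℚ)
    (h : l ≠ 0 ∨ m ≠ 0 ∨ n ≠ 0) {w : ℂ} (hw : w = l * a + m * b + n * u + r * P + s * Q) :
    sigmaFun τ w ≠ 0 := by
  rw [hw]
  exact (hg l m n r s h).2.2.2

theorem TripleGeneric.s2Regular (hg : TripleGeneric τ P Q a b u) (hτ : 0 < τ.im)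
    (hP : sigmaFun τ P ≠ 0) : S2Regular τ a (a + P) b (cd τ (b + u)) (cd τ (b - u)) := by
  have hf : ∀ v ∈ [b, b - a, b - (a + P), b + a, b + (a + P), 2 * b - (a - (a + P)) / 2,
      2 * b + (a - (a + P)) / 2, (a + (a + P)) / 2], CdFinite τ v := by
    simp only [List.mem_cons, List.not_mem_nil, or_false, forall_eq_or_imp, forall_eq]
    exact ⟨(hg.cdFinite 0 1 0 0 0 (by norm_num) (by push_cast; ring)),
    (hg.cdFinite (-1) 1 0 0 0 (by norm_num) (by push_cast; ring)),
    (hg.cdFinite (-1) 1 0 (-1) 0 (by norm_num) (by push_cast; ring)),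
    (hg.cdFinite 1 1 0 0 0 (by norm_num) (by push_cast; ring)),
    (hg.cdFinite 1 1 0 1 0 (by norm_num) (by push_cast; ring)),
    (hg.cdFinite 0 2 0 (1/2) 0 (by norm_num) (by push_cast; ring)),
    (hg.cdFinite 0 2 0 (-1/2) 0 (by norm_num) (by push_cast; ring)),
    (hg.cdFinite 1 0 0 (1/2) 0 (by norm_num) (by push_cast; ring))⟩
  have h1 : cd τ b ≠ 0 :=
    hg.cd_ne_zero hτ 0 1 0 0 0 (by norm_num) (by push_cast; ring)
  have h2 : cd τ ((a + (a + P)) / 2) ≠ 0 :=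
    hg.cd_ne_zero hτ 1 0 0 (1/2) 0 (by norm_num) (by push_cast; ring)
  have h3 : 1 - cd τ (b - a) / cd τ b ≠ 0 :=
    one_sub_div_ne_zero (hg.cd_ne_zero hτ 0 1 0 0 0 (by norm_num) (by push_cast; ring))
      (cd_ne_cd hτ (hg.cdFinite 0 1 0 0 0 (by norm_num) (by push_cast; ring))
      (hg.cdFinite (-1) 1 0 0 0 (by norm_num) (by push_cast; ring))
      (hg.sigmaFun_ne_zero (-1) 2 0 0 0 (by norm_num) (by push_cast; ring))
      (hg.sigmaFun_ne_zero 1 0 0 0 0 (by norm_num) (by push_cast; ring)))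
  have h4 : 1 - cd τ (b + (a + P)) / cd τ b ≠ 0 :=
    one_sub_div_ne_zero (hg.cd_ne_zero hτ 0 1 0 0 0 (by norm_num) (by push_cast; ring))
      (cd_ne_cd hτ (hg.cdFinite 0 1 0 0 0 (by norm_num) (by push_cast; ring))
      (hg.cdFinite 1 1 0 1 0 (by norm_num) (by push_cast; ring))
      (hg.sigmaFun_ne_zero 1 2 0 1 0 (by norm_num) (by push_cast; ring))
      (hg.sigmaFun_ne_zero (-1) 0 0 (-1) 0 (by norm_num) (by push_cast; ring)))
  have h5 : 1 - cd τ (2 * b + (a - (a + P)) / 2) / cd τ ((a + (a + P)) / 2) ≠ 0 :=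
    one_sub_div_ne_zero (hg.cd_ne_zero hτ 1 0 0 (1/2) 0 (by norm_num) (by push_cast; ring))
      (cd_ne_cd hτ (hg.cdFinite 1 0 0 (1/2) 0 (by norm_num) (by push_cast; ring))
      (hg.cdFinite 0 2 0 (-1/2) 0 (by norm_num) (by push_cast; ring))
      (hg.sigmaFun_ne_zero 1 2 0 0 0 (by norm_num) (by push_cast; ring))
      (hg.sigmaFun_ne_zero 1 (-2) 0 1 0 (by norm_num) (by push_cast; ring)))
  have h6 : cd τ (b + u) ≠ cd τ (b + a) :=
    cd_ne_cd hτ (hg.cdFinite 0 1 1 0 0 (by norm_num) (by push_cast; ring))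
      (hg.cdFinite 1 1 0 0 0 (by norm_num) (by push_cast; ring))
      (hg.sigmaFun_ne_zero 1 2 1 0 0 (by norm_num) (by push_cast; ring))
      (hg.sigmaFun_ne_zero (-1) 0 1 0 0 (by norm_num) (by push_cast; ring))
  have h7 : cd τ (b + u) ≠ cd τ (b + (a + P)) :=
    cd_ne_cd hτ (hg.cdFinite 0 1 1 0 0 (by norm_num) (by push_cast; ring))
      (hg.cdFinite 1 1 0 1 0 (by norm_num) (by push_cast; ring))
      (hg.sigmaFun_ne_zero 1 2 1 1 0 (by norm_num) (by push_cast; ring))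
      (hg.sigmaFun_ne_zero (-1) 0 1 (-1) 0 (by norm_num) (by push_cast; ring))
  have h8 : cd τ (b - u) ≠ cd τ (b - a) :=
    cd_ne_cd hτ (hg.cdFinite 0 1 (-1) 0 0 (by norm_num) (by push_cast; ring))
      (hg.cdFinite (-1) 1 0 0 0 (by norm_num) (by push_cast; ring))
      (hg.sigmaFun_ne_zero (-1) 2 (-1) 0 0 (by norm_num) (by push_cast; ring))
      (hg.sigmaFun_ne_zero 1 0 (-1) 0 0 (by norm_num) (by push_cast; ring))
  have h9 : cd τ (b - u) ≠ cd τ (b - (a + P)) :=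
    cd_ne_cd hτ (hg.cdFinite 0 1 (-1) 0 0 (by norm_num) (by push_cast; ring))
      (hg.cdFinite (-1) 1 0 (-1) 0 (by norm_num) (by push_cast; ring))
      (hg.sigmaFun_ne_zero (-1) 2 (-1) (-1) 0 (by norm_num) (by push_cast; ring))
      (hg.sigmaFun_ne_zero 1 0 (-1) 1 0 (by norm_num) (by push_cast; ring))
  have h10 : cd τ (2 * b - (a - (a + P)) / 2) ≠ cd τ (2 * b + (a - (a + P)) / 2) :=
    cd_ne_cd hτ (hg.cdFinite 0 2 0 (1/2) 0 (by norm_num) (by push_cast; ring))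
      (hg.cdFinite 0 2 0 (-1/2) 0 (by norm_num) (by push_cast; ring))
      (hg.sigmaFun_ne_zero 0 4 0 0 0 (by norm_num) (by push_cast; ring))
      (sigmaFun_ne_zero_of_eq_or hP (.inl (by ring)))
  -- If the ratio were 1, the relation of `s2_curve` would force the two values `cd(2η ± (c₁ -
  -- c₂)/2)` to agree.
  refine ⟨hf, h1, h2, h3, h4, h5, h6, h7, h8, h9, h10, fun hM => ?_⟩
  have hu1 : CdFinite τ (b + u) := hg.cdFinite 0 1 1 0 0 (by norm_num) (by push_cast; ring)
  have hu2 : CdFinite τ (b - u) := hg.cdFinite 0 1 (-1) 0 0 (by norm_num) (by push_cast; ring)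
  have hc := s2_curve hτ ⟨hf, h1, h2, h3, h4, h5⟩ hu1 hu2
    (hg.cdFinite 1 0 1 (1/2) 0 (by norm_num) (by push_cast; ring))
  rw [← sub_ne_zero] at h6 h7 h8 h9 h10
  rw [s2Ratio, mul_assoc, div_mul_div_comm, ← mul_div_assoc, div_eq_one_iff_eq (mul_ne_zero h6 h9)]
    at hM
  refine mul_ne_zero h10 (mul_ne_zero h6 h9) ?_
  linear_combination -hc - (cd τ (u + (a + (a + P)) / 2)
    - cd τ (2 * b + (a - (a + P)) / 2)) * hM

theorem TripleGeneric.gRegular (hg : TripleGeneric τ P Q a b u) (hτ : 0 < τ.im)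
    (hQ : sigmaFun τ Q ≠ 0) (hQP : sigmaFun τ (Q - P) ≠ 0) :
    GRegular τ a (a + P) (a + Q) (a + (P + Q)) b := by
  unfold GRegular
  simp only [List.mem_cons, List.not_mem_nil, or_false, forall_eq_or_imp, forall_eq]
  exact ⟨⟨(hg.cdFinite 2 0 0 (3/2) 0 (by norm_num) (by push_cast; ring)),
    (hg.cdFinite 2 0 0 (1/2) 1 (by norm_num) (by push_cast; ring)),
    (hg.cdFinite 2 0 0 (3/2) 1 (by norm_num) (by push_cast; ring)),
    (hg.cdFinite (-1) 1 0 0 0 (by norm_num) (by push_cast; ring)),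
    (hg.cdFinite (-1) 1 0 0 (-1) (by norm_num) (by push_cast; ring)),
    (hg.cdFinite (-1) 1 0 (-1) (-1) (by norm_num) (by push_cast; ring)),
    (hg.cdFinite 3 1 0 2 1 (by norm_num) (by push_cast; ring)),
    (hg.cdFinite (-1) 1 0 (-1) 0 (by norm_num) (by push_cast; ring)),
    (hg.cdFinite (-1) 1 0 0 0 (by norm_num) (by push_cast; ring)),
    (hg.cdFinite 0 2 0 (1/2) 0 (by norm_num) (by push_cast; ring))⟩,
    (hg.cd_ne_zero hτ 2 0 0 (3/2) 0 (by norm_num) (by push_cast; ring)),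
    (hg.cd_ne_zero hτ (-1) 1 0 0 0 (by norm_num) (by push_cast; ring)),
    (hg.cd_ne_zero hτ 3 1 0 2 1 (by norm_num) (by push_cast; ring)),
    (hg.cd_ne_zero hτ 0 2 0 (1/2) 0 (by norm_num) (by push_cast; ring)),
    (one_sub_div_ne_zero (hg.cd_ne_zero hτ 2 0 0 (3/2) 0 (by norm_num) (by push_cast; ring))
      (cd_ne_cd hτ (hg.cdFinite 2 0 0 (3/2) 0 (by norm_num) (by push_cast; ring))
      (hg.cdFinite 2 0 0 (1/2) 1 (by norm_num) (by push_cast; ring))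
      (hg.sigmaFun_ne_zero 4 0 0 2 1 (by norm_num) (by push_cast; ring))
      (sigmaFun_ne_zero_of_eq_or hQP (.inr (by ring))))),
    (one_sub_div_ne_zero (hg.cd_ne_zero hτ (-1) 1 0 0 0 (by norm_num) (by push_cast; ring))
      (cd_ne_cd hτ (hg.cdFinite (-1) 1 0 0 0 (by norm_num) (by push_cast; ring))
      (hg.cdFinite (-1) 1 0 0 (-1) (by norm_num) (by push_cast; ring))
      (hg.sigmaFun_ne_zero (-2) 2 0 0 (-1) (by norm_num) (by push_cast; ring))
      (sigmaFun_ne_zero_of_eq_or hQ (.inl (by ring))))),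
    (one_sub_div_ne_zero (hg.cd_ne_zero hτ 3 1 0 2 1 (by norm_num) (by push_cast; ring))
      (cd_ne_cd hτ (hg.cdFinite 3 1 0 2 1 (by norm_num) (by push_cast; ring))
      (hg.cdFinite (-1) 1 0 (-1) 0 (by norm_num) (by push_cast; ring))
      (hg.sigmaFun_ne_zero 2 2 0 1 1 (by norm_num) (by push_cast; ring))
      (hg.sigmaFun_ne_zero 4 0 0 3 1 (by norm_num) (by push_cast; ring)))),
    (one_sub_div_ne_zero (hg.cd_ne_zero hτ 0 2 0 (1/2) 0 (by norm_num) (by push_cast; ring))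
      (cd_ne_cd hτ (hg.cdFinite 0 2 0 (1/2) 0 (by norm_num) (by push_cast; ring))
      (hg.cdFinite 2 0 0 (3/2) 1 (by norm_num) (by push_cast; ring))
      (hg.sigmaFun_ne_zero 2 2 0 2 1 (by norm_num) (by push_cast; ring))
      (hg.sigmaFun_ne_zero (-2) 2 0 (-1) (-1) (by norm_num) (by push_cast; ring))))⟩

theorem TripleGeneric.cdFinite_sub_add (hg : TripleGeneric τ P Q a b u) :
    ∀ c ∈ [a, a + P, a + Q, a + (P + Q)], CdFinite τ (b - c) ∧ CdFinite τ (b + c) := by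
  simp only [List.mem_cons, List.not_mem_nil, or_false, forall_eq_or_imp, forall_eq]
  exact ⟨⟨(hg.cdFinite (-1) 1 0 0 0 (by norm_num) (by push_cast; ring)),
    (hg.cdFinite 1 1 0 0 0 (by norm_num) (by push_cast; ring))⟩,
    ⟨(hg.cdFinite (-1) 1 0 (-1) 0 (by norm_num) (by push_cast; ring)),
    (hg.cdFinite 1 1 0 1 0 (by norm_num) (by push_cast; ring))⟩,
    ⟨(hg.cdFinite (-1) 1 0 0 (-1) (by norm_num) (by push_cast; ring)),
    (hg.cdFinite 1 1 0 0 1 (by norm_num) (by push_cast; ring))⟩,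
    ⟨(hg.cdFinite (-1) 1 0 (-1) (-1) (by norm_num) (by push_cast; ring)),
    (hg.cdFinite 1 1 0 1 1 (by norm_num) (by push_cast; ring))⟩⟩

theorem TripleGeneric.cd_ne (hg : TripleGeneric τ P Q a b u) (hτ : 0 < τ.im)
    (hQ : sigmaFun τ Q ≠ 0) (hQP : sigmaFun τ (Q - P) ≠ 0) (hPQ : sigmaFun τ (P + Q) ≠ 0) :
    cd τ (b + (a + Q)) ≠ cd τ (b + (a + P)) ∧ cd τ (b + (a + (P + Q))) ≠ cd τ (b + (a + P))
    ∧ cd τ (b - (a + Q)) ≠ cd τ (b - a) ∧ cd τ (b - (a + (P + Q))) ≠ cd τ (b - a) :=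
  ⟨(cd_ne_cd hτ (hg.cdFinite 1 1 0 0 1 (by norm_num) (by push_cast; ring))
      (hg.cdFinite 1 1 0 1 0 (by norm_num) (by push_cast; ring))
      (hg.sigmaFun_ne_zero 2 2 0 1 1 (by norm_num) (by push_cast; ring))
      (sigmaFun_ne_zero_of_eq_or hQP (.inl (by ring)))),
    (cd_ne_cd hτ (hg.cdFinite 1 1 0 1 1 (by norm_num) (by push_cast; ring))
      (hg.cdFinite 1 1 0 1 0 (by norm_num) (by push_cast; ring))
      (hg.sigmaFun_ne_zero 2 2 0 2 1 (by norm_num) (by push_cast; ring))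
      (sigmaFun_ne_zero_of_eq_or hQ (.inl (by ring)))),
    (cd_ne_cd hτ (hg.cdFinite (-1) 1 0 0 (-1) (by norm_num) (by push_cast; ring))
      (hg.cdFinite (-1) 1 0 0 0 (by norm_num) (by push_cast; ring))
      (hg.sigmaFun_ne_zero (-2) 2 0 0 (-1) (by norm_num) (by push_cast; ring))
      (sigmaFun_ne_zero_of_eq_or hQ (.inr (by ring)))),
    (cd_ne_cd hτ (hg.cdFinite (-1) 1 0 (-1) (-1) (by norm_num) (by push_cast; ring))
      (hg.cdFinite (-1) 1 0 0 0 (by norm_num) (by push_cast; ring))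
      (hg.sigmaFun_ne_zero (-2) 2 0 (-1) (-1) (by norm_num) (by push_cast; ring))
      (sigmaFun_ne_zero_of_eq_or hPQ (.inr (by ring))))⟩

theorem TripleGeneric.s2y_eq (hg : TripleGeneric τ P Q a b u) (hτ : 0 < τ.im)
    (hP : sigmaFun τ P ≠ 0) :
    s2y τ a (a + P) b (cd τ (b + u)) (cd τ (b - u)) = cd τ (u + (a + (a + P)) / 2) :=
  s2y_curve hτ (hg.s2Regular hτ hP) (hg.cdFinite 0 1 1 0 0 (by norm_num) (by push_cast; ring))
    (hg.cdFinite 0 1 (-1) 0 0 (by norm_num) (by push_cast; ring))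
    (hg.cdFinite 1 0 1 (1/2) 0 (by norm_num) (by push_cast; ring))

/-- The first `s₂` acts on `(a, b, u)` by an invertible rational affine map modulo `P, Q`. The new
`u` keeps `b + u`, matching the fixed coordinate `x`, and gives the new `y` up to the evenness of
`cd`. -/
theorem TripleGeneric.step (hg : TripleGeneric τ P Q a b u) :
    TripleGeneric τ P Q (a + Q + (2 * b + a + (a + P)) / 4) (b - (2 * b + a + (a + P)) / 4)
      (u + (2 * b + a + (a + P)) / 4) := by
  intro l m n r s h
  convert hg (3 * l / 2 - m / 2 + n / 2) (l / 2 + m / 2 + n / 2) n (l / 4 - m / 4 + n / 4 + r)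
    (l + s) ?_ using 1
  · push_cast
    ring
  · by_contra! h0
    obtain ⟨h1, h2, rfl⟩ := h0
    have hl : l = 0 := by linarith
    have hm : m = 0 := by linarith
    simp [hl, hm] at h

theorem TripleGeneric.twoStep (hg : TripleGeneric τ P Q a b u) (hτ : 0 < τ.im)
    (hP : sigmaFun τ P ≠ 0) (hQ : sigmaFun τ Q ≠ 0) (hQP : sigmaFun τ (Q - P) ≠ 0)
    (hPQ : sigmaFun τ (P + Q) ≠ 0) :
    TwoStepRegular τ a (a + P) (a + Q) (a + (P + Q)) b (cd τ (b + u)) (cd τ (b - u))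
    ∧ twoStepY τ a (a + P) (a + Q) (a + (P + Q)) b (cd τ (b + u)) (cd τ (b - u))
      = cd τ (b + u + 2 * a + (P + Q)) := by
  have r1 := hg.s2Regular hτ hP
  have y1 := hg.s2y_eq hτ hP
  have r2 := hg.step.s2Regular hτ hP
  have y2 := hg.step.s2y_eq hτ hP
  have e1 : a + Q + (2 * b + a + (a + P)) / 4 + P = a + (P + Q) + (2 * b + a + (a + P)) / 4 := by
    ring
  have e2 : b - (2 * b + a + (a + P)) / 4 + (u + (2 * b + a + (a + P)) / 4) = b + u := by ring
  have e3 : b - (2 * b + a + (a + P)) / 4 - (u + (2 * b + a + (a + P)) / 4)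
      = -(u + (a + (a + P)) / 2) := by ring
  have e4 : u + (2 * b + a + (a + P)) / 4 + (a + Q + (2 * b + a + (a + P)) / 4
      + (a + (P + Q) + (2 * b + a + (a + P)) / 4)) / 2 = b + u + 2 * a + (P + Q) := by ring
  rw [e1, e2, e3, cd_neg hτ, ← y1] at r2 y2
  rw [e4] at y2
  have hY : twoStepY τ a (a + P) (a + Q) (a + (P + Q)) b (cd τ (b + u)) (cd τ (b - u))
      = cd τ (b + u + 2 * a + (P + Q)) := y2
  obtain ⟨n1, n2, n3, n4⟩ := hg.cd_ne hτ hQ hQP hPQ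
  refine ⟨⟨r1, r2, ⟨hg.gRegular hτ hQ hQP, hg.cdFinite_sub_add, ?_⟩, n1, n2, n3, n4, ?_⟩, hY⟩
  -- Nonvanishing of `P(a₁, a₂, a₄)`: otherwise the value of `s₂(y)`, known on the curve, would
  -- equal `cd(a₄ + (a₁ + a₂)/2)`.
  · have k := s2y_sub_mul hτ r1 (a := a + (P + Q))
      (hg.cdFinite 1 1 0 1 1 (by norm_num) (by push_cast; ring))
      (hg.cdFinite (-1) 1 0 (-1) (-1) (by norm_num) (by push_cast; ring))
      (hg.cdFinite 2 0 0 (3/2) 1 (by norm_num) (by push_cast; ring))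
    obtain ⟨-, -, -, -, -, -, hx1, -, -, hy2, -, hM⟩ := r1
    refine fun h0 => mul_ne_zero (mul_ne_zero ?_ (mul_ne_zero (mul_ne_zero
      (sub_ne_zero.2 hM.symm) (sub_ne_zero.2 hx1)) (sub_ne_zero.2 hy2)))
      (mul_ne_zero (sub_ne_zero.2 n2) (sub_ne_zero.2 n4)) (k.trans (mul_eq_zero_of_right _ h0))
    rw [y1]
    exact sub_ne_zero.2 (cd_ne_cd hτ
      (hg.cdFinite 1 0 1 (1/2) 0 (by norm_num) (by push_cast; ring))
      (hg.cdFinite 2 0 0 (3/2) 1 (by norm_num) (by push_cast; ring))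
      (hg.sigmaFun_ne_zero 3 0 1 2 1 (by norm_num) (by push_cast; ring))
      (hg.sigmaFun_ne_zero (-1) 0 1 (-1) (-1) (by norm_num) (by push_cast; ring)))
  · rw [hY]
    exact hg.cd_ne_zero hτ 2 1 1 1 1 (by norm_num) (by push_cast; ring)

end Curve

/-! ### Rationally generic quadruples and special states with a sign -/

/-- No linear combination of `c₁, c₅, η, u, K, iK'` with rational coefficients which involves one
of the first four numbers is a zero of the theta functions. -/
def QuadGeneric (τ c1 c5 η u : ℂ) : Prop :=
  ∀ l m n o r s : ℚ, l ≠ 0 ∨ m ≠ 0 ∨ n ≠ 0 ∨ o ≠ 0 →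
    ThetaGeneric τ (l * c1 + m * c5 + n * η + o * u + r * ellK τ + s * ellIK' τ)

/-- Each affine condition excludes the preimage of a countable set under an injective map; countably
many of them cannot exhaust `ℂ`. -/
theorem exists_forall_thetaGeneric {τ : ℂ} (hτ : 0 < τ.im) {ι : Type} [Countable ι] (B : ι → ℂ) :
    ∃ t : ℂ, ∀ (l : ℚ) (i : ι), l ≠ 0 → ThetaGeneric τ (l * t + B i) := by
  have hc : (⋃ li : {l : ℚ // l ≠ 0} × ι,
      (fun t : ℂ => (li.1.1 : ℂ) * t + B li.2) ⁻¹' {w | ¬ ThetaGeneric τ w}).Countable := by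
    refine Set.countable_iUnion fun li => (countable_not_thetaGeneric hτ).preimage_of_injOn ?_
    intro s _ t _ h
    exact mul_left_cancel₀ (Rat.cast_ne_zero.2 li.1.2) (add_right_cancel h)
  obtain ⟨t, ht⟩ := (hc.dense_compl ℝ).nonempty
  refine ⟨t, fun l i hl => ?_⟩
  by_contra h
  exact ht (Set.mem_iUnion.2 ⟨(⟨l, hl⟩, i), h⟩)

/-- The numbers are chosen one after another, each against all rational combinations of its
predecessors with `K` and `iK'`; a given combination is handled at its last nonzero coefficient. -/
theorem exists_quadGeneric {τ : ℂ} (hτ : 0 < τ.im) : ∃ c1 c5 η u, QuadGeneric τ c1 c5 η u := by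
  obtain ⟨c1, h1⟩ := exists_forall_thetaGeneric hτ (ι := ℚ × ℚ)
    fun i => i.1 * ellK τ + i.2 * ellIK' τ
  obtain ⟨c5, h2⟩ := exists_forall_thetaGeneric hτ (ι := ℚ × ℚ × ℚ)
    fun i => i.1 * c1 + i.2.1 * ellK τ + i.2.2 * ellIK' τ
  obtain ⟨η, h3⟩ := exists_forall_thetaGeneric hτ (ι := ℚ × ℚ × ℚ × ℚ)
    fun i => i.1 * c1 + i.2.1 * c5 + i.2.2.1 * ellK τ + i.2.2.2 * ellIK' τ
  obtain ⟨u, h4⟩ := exists_forall_thetaGeneric hτ (ι := ℚ × ℚ × ℚ × ℚ × ℚ)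
    fun i => i.1 * c1 + i.2.1 * c5 + i.2.2.1 * η + i.2.2.2.1 * ellK τ + i.2.2.2.2 * ellIK' τ
  refine ⟨c1, c5, η, u, fun l m n o r s h => ?_⟩
  by_cases ho : o = 0
  · by_cases hn : n = 0
    · by_cases hm : m = 0
      · have hl : l ≠ 0 := by simpa [ho, hn, hm] using h
        convert h1 l (r, s) hl using 1
        simp only [ho, hn, hm, Rat.cast_zero]
        ring
      · convert h2 m (l, r, s) hm using 1
        simp only [ho, hn, Rat.cast_zero]
        ring
    · convert h3 n (l, m, r, s) hn using 1
      simp only [ho, Rat.cast_zero]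
      ring
  · convert h4 o (l, m, n, r, s) ho using 1
    ring

section Signed

variable {τ e c1 c5 η u : ℂ}

theorem QuadGeneric.triple (hg : QuadGeneric τ c1 c5 η u) (he : e = 1 ∨ e = -1) :
    TripleGeneric τ (e * (2 * ellK τ)) (e * ellIK' τ) c5 η u := by
  intro l m n r s h
  rcases he with rfl | rfl
  · convert hg 0 l m n (2 * r) s (.inr h) using 1
    push_cast
    ring
  · convert hg 0 l m n (-2 * r) (-s) (.inr h) using 1
    push_cast
    ring

/-- These are the data of the second half: `b` is a quarter of the sum of the last four parameters,
and the curve parameter is adjusted so that `b - u` becomes minus the old `η + u`. -/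
theorem QuadGeneric.triple' (hg : QuadGeneric τ c1 c5 η u) (he : e = 1 ∨ e = -1) :
    TripleGeneric τ (e * (2 * ellK τ)) (e * ellIK' τ) (η + c1 + (c5 + e * ellKappa τ / 2))
      (c5 + e * ellKappa τ / 2) (η + u + (c5 + e * ellKappa τ / 2)) := by
  intro l m n r s h
  have h' : l ≠ 0 ∨ l + m + n ≠ 0 ∨ l + n ≠ 0 ∨ n ≠ 0 := by
    by_contra! h0
    obtain ⟨rfl, h1, -, rfl⟩ := h0
    have hm : m = 0 := by linarith
    simp [hm] at h
  rw [ellKappa]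
  rcases he with rfl | rfl
  · convert hg l (l + m + n) (l + n) n (l + m + n + 2 * r) ((l + m + n) / 2 + s) h' using 1
    push_cast
    ring
  · convert hg l (l + m + n) (l + n) n (-(l + m + n) - 2 * r) (-(l + m + n) / 2 - s) h' using 1
    push_cast
    ring

/-- The new numbers are those produced by `R` on the invariant curve. Their coefficient matrix in
the old ones is invertible, which is what `h'` verifies. -/
theorem QuadGeneric.step (hg : QuadGeneric τ c1 c5 η u) (he : e = 1 ∨ e = -1) :
    QuadGeneric τ (-c5 - ellKappa τ) (2 * c5 + c1 + (2 * e - 1) * ellKappa τ)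
      (η + c1 + c5 + e * ellKappa τ)
      (u + 2 * η + c1 + 3 * c5 + (2 * e - 1) * ellKappa τ) := by
  intro l m n o r s h
  have h' : m + n + o ≠ 0 ∨ -l + 2 * m + n + 3 * o ≠ 0 ∨ n + 2 * o ≠ 0 ∨ o ≠ 0 := by
    by_contra! h0
    obtain ⟨h1, h2, h3, rfl⟩ := h0
    have hn : n = 0 := by linarith
    have hm : m = 0 := by linarith
    have hl : l = 0 := by linarith
    simp [hm, hn, hl] at h
  rw [ellKappa]
  rcases he with rfl | rfl
  · convert hg (m + n + o) (-l + 2 * m + n + 3 * o) (n + 2 * o) o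
      (-2 * l + 2 * m + 2 * n + 2 * o + r) (-l + m + n + o + s) h' using 1
    push_cast
    ring
  · convert hg (m + n + o) (-l + 2 * m + n + 3 * o) (n + 2 * o) o
      (-2 * l - 6 * m - 2 * n - 6 * o + r) (-l - 3 * m - n - 3 * o + s) h' using 1
    push_cast
    ring

/-- The point with special parameters the differences of which have the sign `e`. -/
noncomputable def signedState (τ e c1 c5 : ℂ) (v : ℂ × ℂ × ℂ) : State :=
  (![c1, c1 + e * (2 * ellK τ), c1 + e * ellIK' τ, c1 + e * ellKappa τ,
     c5, c5 + e * (2 * ellK τ), c5 + e * ellIK' τ, c5 + e * ellKappa τ], v)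

theorem sumA_signedState (τ e c1 c5 : ℂ) (v : ℂ × ℂ × ℂ) :
    sumA (signedState τ e c1 c5 v).1 = 4 * c1 + 2 * (e * ellKappa τ) := by
  simp [signedState, sumA, ellKappa]
  ring

theorem sumB_signedState (τ e c1 c5 : ℂ) (v : ℂ × ℂ × ℂ) :
    sumB (signedState τ e c1 c5 v).1 = 4 * c5 + 2 * (e * ellKappa τ) := by
  simp [signedState, sumB, ellKappa]
  ring

theorem wordImage_RJ1_signedState (τ e c1 c5 η x y : ℂ) :
    wordImage τ RJ1 (signedState τ e c1 c5 (η, x, y))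
      = signedState τ (-e) (-c5 - ellKappa τ) (2 * c5 + c1 + (2 * e - 1) * ellKappa τ)
        (η + c1 + c5 + e * ellKappa τ,
          -1 / (modulus τ * secondX τ (signedState τ e c1 c5 (η, x, y))),
          -1 / (modulus τ * firstY τ (signedState τ e c1 c5 (η, x, y)))) := by
  have h := wordImage_RJ1 τ (signedState τ e c1 c5 (η, x, y)).1 η x y
  refine h.trans (Prod.ext (funext fun i => ?_) (Prod.ext ?_ rfl))
  · simp only [stepC, sumA_signedState, sumB_signedState]
    fin_cases i <;> simp [signedState] <;> ring
  · rw [stepEta, sumA_signedState, sumB_signedState]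
    simp only [signedState]
    ring

theorem firstY_signedState (τ e c1 c5 η x y : ℂ) :
    firstY τ (signedState τ e c1 c5 (η, x, y)) = twoStepY τ c5 (c5 + e * (2 * ellK τ))
      (c5 + e * ellIK' τ) (c5 + e * ellKappa τ) η x y := rfl

theorem sumB_signedState_div (τ e c1 c5 : ℂ) (v : ℂ × ℂ × ℂ) :
    sumB (signedState τ e c1 c5 v).1 / 4 = c5 + e * ellKappa τ / 2
    ∧ ∀ η t : ℂ, η + (c1 + t) + sumB (signedState τ e c1 c5 v).1 / 4
      = η + c1 + (c5 + e * ellKappa τ / 2) + t := by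
  rw [sumB_signedState]
  exact ⟨by ring, fun η t => by ring⟩

theorem secondX_signedState (τ e c1 c5 η x y : ℂ) :
    secondX τ (signedState τ e c1 c5 (η, x, y))
      = twoStepY τ (η + c1 + (c5 + e * ellKappa τ / 2))
        (η + c1 + (c5 + e * ellKappa τ / 2) + e * (2 * ellK τ))
        (η + c1 + (c5 + e * ellKappa τ / 2) + e * ellIK' τ)
        (η + c1 + (c5 + e * ellKappa τ / 2) + e * ellKappa τ) (c5 + e * ellKappa τ / 2)
        (firstY τ (signedState τ e c1 c5 (η, x, y))) x := by
  obtain ⟨h1, h2⟩ := sumB_signedState_div τ e c1 c5 (η, x, y)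
  have h3 := h2 η 0
  rw [add_zero, add_zero] at h3
  rw [← h2, ← h2, ← h2, ← h3, ← h1]
  rfl

theorem halfStepRegular_signedState (τ e c1 c5 η x y : ℂ) :
    HalfStepRegular τ (signedState τ e c1 c5 (η, x, y))
      ↔ TwoStepRegular τ c5 (c5 + e * (2 * ellK τ)) (c5 + e * ellIK' τ) (c5 + e * ellKappa τ) η x y
      ∧ TwoStepRegular τ (η + c1 + (c5 + e * ellKappa τ / 2))
        (η + c1 + (c5 + e * ellKappa τ / 2) + e * (2 * ellK τ))
        (η + c1 + (c5 + e * ellKappa τ / 2) + e * ellIK' τ)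
        (η + c1 + (c5 + e * ellKappa τ / 2) + e * ellKappa τ) (c5 + e * ellKappa τ / 2)
        (firstY τ (signedState τ e c1 c5 (η, x, y))) x := by
  obtain ⟨h1, h2⟩ := sumB_signedState_div τ e c1 c5 (η, x, y)
  have h3 := h2 η 0
  rw [add_zero, add_zero] at h3
  rw [← h2, ← h2, ← h2, ← h3, ← h1]
  rfl

theorem QuadGeneric.halfStepRegular (hg : QuadGeneric τ c1 c5 η u) (hτ : 0 < τ.im)
    (he : e = 1 ∨ e = -1) :
    HalfStepRegular τ (signedState τ e c1 c5 (η, cd τ (η + u), cd τ (η - u)))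
    ∧ firstY τ (signedState τ e c1 c5 (η, cd τ (η + u), cd τ (η - u)))
      = cd τ (η + u + 2 * c5 + e * ellKappa τ)
    ∧ secondX τ (signedState τ e c1 c5 (η, cd τ (η + u), cd τ (η - u)))
      = cd τ (3 * η + u + 4 * c5 + 2 * c1 + 3 * (e * ellKappa τ)) := by
  obtain ⟨s1, s2, s3, s4⟩ := sigmaFun_special hτ he
  have eκ : e * (2 * ellK τ) + e * ellIK' τ = e * ellKappa τ := by
    rw [ellKappa]
    ring
  have hQP : sigmaFun τ (e * ellIK' τ - e * (2 * ellK τ)) ≠ 0 := by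
    rw [← mul_sub, s1]
    exact neg_ne_zero.2 s2
  rw [← eκ] at s2
  obtain ⟨r1, y1⟩ := (hg.triple he).twoStep hτ s4 s3 hQP s2
  obtain ⟨r2, y2⟩ := (hg.triple' he).twoStep hτ s4 s3 hQP s2
  rw [eκ] at r1 y1 r2 y2
  have e1 : c5 + e * ellKappa τ / 2 + (η + u + (c5 + e * ellKappa τ / 2))
      = η + u + 2 * c5 + e * ellKappa τ := by ring
  have e2 : c5 + e * ellKappa τ / 2 - (η + u + (c5 + e * ellKappa τ / 2)) = -(η + u) := by ring
  have e3 : η + u + 2 * c5 + e * ellKappa τ + 2 * (η + c1 + (c5 + e * ellKappa τ / 2))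
      + e * ellKappa τ = 3 * η + u + 4 * c5 + 2 * c1 + 3 * (e * ellKappa τ) := by ring
  rw [e1, e2, cd_neg hτ] at r2 y2
  rw [e3] at y2
  rw [halfStepRegular_signedState, secondX_signedState, firstY_signedState, y1]
  exact ⟨⟨r1, r2⟩, rfl, y2⟩

/-- The inversions `-1/(k ·)` made by the `ι`'s are shifts of the argument of `cd` by `κ`, so the
image stays on the curve of the new parameters. -/
theorem QuadGeneric.wordImage_RJ1 (hg : QuadGeneric τ c1 c5 η u) (hτ : 0 < τ.im)
    (he : e = 1 ∨ e = -1) : ∃ c1' c5' η' u', QuadGeneric τ c1' c5' η' u' ∧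
    wordImage τ RJ1 (signedState τ e c1 c5 (η, cd τ (η + u), cd τ (η - u)))
      = signedState τ (-e) c1' c5' (η', cd τ (η' + u'), cd τ (η' - u')) := by
  obtain ⟨-, h1, h2⟩ := hg.halfStepRegular hτ he
  refine ⟨_, _, _, _, hg.step he, ?_⟩
  rw [wordImage_RJ1_signedState, h1, h2, ← cd_sub_ellKappa hτ, ← cd_sub_ellKappa hτ]
  rw [← cd_neg hτ (η + u + 2 * c5 + e * ellKappa τ - ellKappa τ)]
  congr 4 <;> ring

end Signed

theorem RJ1Pow_succ (n : ℕ) : RJ1Pow (n + 1) = RJ1Pow n ++ RJ1 := by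
  rw [RJ1Pow, List.replicate_succ', List.flatten_append, List.flatten_singleton, RJ1Pow]

/-- There are special parameters, and a point, all images of which are regular. -/
theorem exists_halfStepRegular {τ : ℂ} (hτ : 0 < τ.im) : ∃ c1 c5 η u : ℂ,
    QuadGeneric τ c1 c5 η u ∧ ∀ n, HalfStepRegular τ (wordImage τ (RJ1Pow n)
      (specialState τ (c1, c5, η, cd τ (η + u), cd τ (η - u)))) := by
  obtain ⟨c1, c5, η, u, hg⟩ := exists_quadGeneric hτ
  refine ⟨c1, c5, η, u, hg, fun n => ?_⟩
  -- The invariant carried along the orbit: generic curve point, with the sign of the differences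
  -- alternating.
  have h : ∃ e c1' c5' η' u', (e = 1 ∨ e = -1) ∧ QuadGeneric τ c1' c5' η' u' ∧
      wordImage τ (RJ1Pow n) (specialState τ (c1, c5, η, cd τ (η + u), cd τ (η - u)))
        = signedState τ e c1' c5' (η', cd τ (η' + u'), cd τ (η' - u')) := by
    induction n with
    | zero =>
      refine ⟨1, c1, c5, η, u, .inl rfl, hg, ?_⟩
      simp only [signedState, one_mul]
      rfl
    | succ n ih =>
      obtain ⟨e, c1', c5', η', u', he, hg', h⟩ := ih
      obtain ⟨c1'', c5'', η'', u'', hg'', h'⟩ := hg'.wordImage_RJ1 hτ he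
      refine ⟨-e, c1'', c5'', η'', u'', ?_, hg'', ?_⟩
      · rcases he with rfl | rfl <;> simp
      · rw [RJ1Pow_succ, wordImage_append, h, h']
  obtain ⟨e, c1', c5', η', u', he, hg', h⟩ := h
  rw [h]
  exact (hg'.halfStepRegular hτ he).1

/-! ### The two equations as actions of words -/

theorem halfStepEquation_iff_wordImage {τ : ℂ} (hτ : 0 < τ.im) {p : State}
    (h : HalfStepRegular τ p) (xt yt : ℂ) :
    HalfStepEquation τ p.1 (etaFun p) (xFun p) (yFun p) xt yt
      ↔ xt = xFun (wordImage τ RJ1 p) ∧ yt = yFun (wordImage τ RJ1 p) := by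
  obtain ⟨c, η, x, y⟩ := p
  rw [wordImage_RJ1]
  exact halfStepEquation_iff hτ h xt yt

/-- Two applications of the half-step statement, the second at the image of `p` under `R`. -/
theorem ellipticPainleveEquation_iff {τ : ℂ} (hτ : 0 < τ.im) {p : State}
    (h : HalfStepRegular τ p) (h' : HalfStepRegular τ (wordImage τ RJ1 p)) (xt yt xb yb : ℂ) :
    EllipticPainleveEquation τ p xt yt xb yb
      ↔ xt = xFun (wordImage τ RJ1 p) ∧ yt = yFun (wordImage τ RJ1 p)
        ∧ xb = xFun (wordImage τ TJ1 p) ∧ yb = yFun (wordImage τ TJ1 p) := by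
  rw [EllipticPainleveEquation, halfStepEquation_iff_wordImage hτ h, fullStepEquation_iff hτ,
    and_assoc, ← fst_wordImage_RJ1, ← etaFun_wordImage_RJ1, wordImage_TJ1,
    ← halfStepEquation_iff_wordImage hτ h']
  refine and_congr_right fun hx => and_congr_right fun hy => ?_
  rw [hx, hy]

theorem wordRegular_TJ1 {τ : ℂ} {p : State} (h : HalfStepRegular τ p)
    (h' : HalfStepRegular τ (wordImage τ RJ1 p)) : WordRegular τ TJ1 p := by
  rw [TJ1_eq, wordRegular_append]
  exact ⟨wordRegular_RJ1 h, wordRegular_RJ1 h'⟩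

theorem RCGHalf.unique {τ z γ X Y Z Z' : ℂ} (h : RCGHalf τ z γ X Y Z)
    (h' : RCGHalf τ z γ X Y Z') : Z = Z' :=
  h.2.2.2.trans h'.2.2.2.symm

theorem rcgEquation_iff {τ γe γo z x y xt yt : ℂ} (h : RCGEquation τ γe γo z x y xt yt)
    (xt' yt' : ℂ) : RCGEquation τ γe γo z x y xt' yt' ↔ xt' = xt ∧ yt' = yt := by
  constructor
  · rintro ⟨h1, h2⟩
    obtain rfl := h1.unique h.1
    exact ⟨h2.unique h.2, rfl⟩
  · rintro ⟨rfl, rfl⟩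
    exact h

/-! ### The reduced equation for special parameters -/

/-- The integers absorb the multiples of `2κ` that accumulate along an orbit; `cd`, and hence the
equation, does not see them. -/
theorem rcgEquation_signedState {τ : ℂ} (hτ : 0 < τ.im) {e c1 c5 η x y γe γo z : ℂ}
    (he : e = 1 ∨ e = -1) (h : HalfStepRegular τ (signedState τ e c1 c5 (η, x, y)))
    {i j l : ℤ} (hz : z = η + c5 + ellKappa τ + i * (2 * ellKappa τ))
    (hγe : γe = c5 - η + ellKappa τ + j * (2 * ellKappa τ))
    (hγo : γo = η + c1 + ellKappa τ + l * (2 * ellKappa τ))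
    (f1 : SnFinite τ z ∧ CdFinite τ z) (f2 : SnFinite τ γe ∧ CdFinite τ γe)
    (f3 : SnFinite τ γo ∧ CdFinite τ γo)
    (f4 : SnFinite τ (z + γe + γo) ∧ CdFinite τ (z + γe + γo)) :
    RCGEquation τ γe γo z x y
      (xFun (wordImage τ RJ1 (signedState τ e c1 c5 (η, x, y))))
      (yFun (wordImage τ RJ1 (signedState τ e c1 c5 (η, x, y)))) := by
  have hY := h.ne_zero.1
  rw [halfStepRegular_signedState] at h
  rw [wordImage_RJ1_signedState]
  refine ⟨rcgHalf_twoStepY hτ he h.1 f1.1 f1.2 f2.1 f2.2 (cd_eq_of_eq_add hτ i hz)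
    (cd_eq_of_eq_add hτ j hγe), ?_⟩
  simp only [xFun, yFun, signedState]
  rw [← signedState, secondX_signedState]
  have hz' : cd τ (z + γe + γo) = cd τ (c5 + e * ellKappa τ / 2
      + (η + c1 + (c5 + e * ellKappa τ / 2))) := by
    rcases he with rfl | rfl
    · refine cd_eq_of_eq_add hτ (i + j + l + 1) ?_
      rw [hz, hγe, hγo]
      push_cast
      ring
    · refine cd_eq_of_eq_add hτ (i + j + l + 2) ?_
      rw [hz, hγe, hγo]
      push_cast
      ring
  refine rcgHalf_twoStepY_inv hτ he hY h.2 f4.1 f4.2 f3.1 f3.2 hz'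
    (cd_eq_of_eq_add hτ l ?_)
  rw [hγo]
  ring

theorem specialState_eq (τ : ℂ) (q : ℂ × ℂ × ℂ × ℂ × ℂ) :
    specialState τ q = signedState τ 1 q.1 q.2.1 q.2.2 := by
  simp only [signedState, one_mul]
  rfl

/-- The parameters of the images of a point with special parameters, up to periods of `cd`. -/
theorem exists_signedState (τ : ℂ) (q : ℂ × ℂ × ℂ × ℂ × ℂ) (n : ℕ) :
    ∃ (e c1 c5 η x y : ℂ) (i j l : ℤ), (e = 1 ∨ e = -1)
      ∧ wordImage τ (RJ1Pow n) (specialState τ q) = signedState τ e c1 c5 (η, x, y)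
      ∧ z0Fun τ (specialState τ q)
          + 2 * n * (gammaE τ (specialState τ q) + gammaO τ (specialState τ q))
        = η + c5 + ellKappa τ + i * (2 * ellKappa τ)
      ∧ gammaE τ (specialState τ q) = c5 - η + ellKappa τ + j * (2 * ellKappa τ)
      ∧ gammaO τ (specialState τ q) = η + c1 + ellKappa τ + l * (2 * ellKappa τ) := by
  induction n with
  | zero =>
    refine ⟨1, q.1, q.2.1, q.2.2.1, q.2.2.2.1, q.2.2.2.2, 0, 0, 0, .inl rfl,
      specialState_eq τ q, ?_, ?_, ?_⟩
    · simp [z0Fun, specialState, etaFun, cFun]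
    · simp [gammaE, specialState, etaFun, cFun]
    · simp [gammaO, specialState, etaFun, cFun]
  | succ n ih =>
    obtain ⟨e, c1, c5, η, x, y, i, j, l, he, h, hz, hγe, hγo⟩ := ih
    have h' := wordImage_RJ1_signedState τ e c1 c5 η x y
    rw [← h, ← wordImage_append, ← RJ1Pow_succ] at h'
    rcases he with rfl | rfl
    -- From sign `+1`, the step preserves both `γ`'s and loses `2κ` in `z`; from sign `-1` below, it
    -- loses `2κ` in each `γ` and `8κ` in `z`. The term `2(j + l)` carries the corrections of the
    -- `γ`'s over to `z`.
    · refine ⟨_, _, _, _, _, _, i + 2 * (j + l) + 1, j, l, .inr rfl, h', ?_, ?_, ?_⟩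
      · push_cast
        linear_combination hz + 2 * hγe + 2 * hγo
      · linear_combination hγe
      · linear_combination hγo
    · refine ⟨_, _, _, _, _, _, i + 2 * (j + l) + 4, j + 1, l + 1, .inl (neg_neg 1), h',
        ?_, ?_, ?_⟩
      · push_cast
        linear_combination hz + 2 * hγe + 2 * hγo
      · push_cast
        linear_combination hγe
      · push_cast
        linear_combination hγo

/-! ### Genericity of the regularity of all images -/

section Orbit

variable {τ : ℂ} {q0 : ℂ × ℂ × ℂ × ℂ × ℂ}

theorem meroStateAt_wordImage_RJ1Pow (hτ : 0 < τ.im)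
    (h : ∀ n, HalfStepRegular τ (wordImage τ (RJ1Pow n) (specialState τ q0))) (n : ℕ) :
    MeroStateAt q0 fun q => wordImage τ (RJ1Pow n) (specialState τ q) := by
  induction n with
  | zero => exact meroStateAt_specialState τ q0
  | succ n ih =>
    simp only [RJ1Pow_succ, wordImage_append]
    exact ih.wordImage_RJ1 hτ (h n)

theorem genAt_halfStepRegular (hτ : 0 < τ.im)
    (h : ∀ n, HalfStepRegular τ (wordImage τ (RJ1Pow n) (specialState τ q0))) (n : ℕ) :
    GenAt q0 fun q => HalfStepRegular τ (wordImage τ (RJ1Pow n) (specialState τ q)) :=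
  (meroStateAt_wordImage_RJ1Pow hτ h n).halfStepRegular hτ (h n)

theorem genAt_wordRegular (hτ : 0 < τ.im)
    (h : ∀ n, HalfStepRegular τ (wordImage τ (RJ1Pow n) (specialState τ q0))) (n : ℕ) :
    GenAt q0 fun q => WordRegular τ (RJ1Pow n) (specialState τ q) := by
  induction n with
  | zero => exact ⟨fun _ => 1, fun _ => analyticAt_const, one_ne_zero, fun _ _ => trivial⟩
  | succ n ih =>
    simp only [RJ1Pow_succ, wordRegular_append]
    exact ih.and ((genAt_halfStepRegular hτ h n).mono fun _ => wordRegular_RJ1)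

theorem genAt_finite {E : Type} [NormedAddCommGroup E] [NormedSpace ℂ E] {p0 : E}
    (hτ : 0 < τ.im) {f : E → ℂ} (hf : ∀ p, AnalyticAt ℂ f p) (h : ThetaGeneric τ (f p0)) :
    GenAt p0 fun p => SnFinite τ (f p) ∧ CdFinite τ (f p) :=
  (GenAt.snFinite hτ hf h.1).and (GenAt.cdFinite hτ hf h.2.1)

theorem analyticAt_special (τ : ℂ) (p : ℂ × ℂ × ℂ × ℂ × ℂ) :
    AnalyticAt ℂ (fun q => z0Fun τ (specialState τ q)) p
    ∧ AnalyticAt ℂ (fun q => gammaE τ (specialState τ q)) p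
    ∧ AnalyticAt ℂ (fun q => gammaO τ (specialState τ q)) p := by
  obtain ⟨h1, h2, -, -⟩ := meroStateAt_specialState τ p
  exact ⟨((h2 p).add (h1 4 p)).add analyticAt_const, ((h1 4 p).sub (h2 p)).add analyticAt_const,
    ((h2 p).add (h1 0 p)).add analyticAt_const⟩

/-- Generically, the images of a point with special parameters satisfy the reduced equation. -/
theorem genAt_rcgEquation (hτ : 0 < τ.im) {c1 c5 η u : ℂ} (hg : QuadGeneric τ c1 c5 η u)
    (hq : q0 = (c1, c5, η, cd τ (η + u), cd τ (η - u)))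
    (h : ∀ n, HalfStepRegular τ (wordImage τ (RJ1Pow n) (specialState τ q0))) (n : ℕ) :
    GenAt q0 fun q => RCGEquation τ (gammaE τ (specialState τ q)) (gammaO τ (specialState τ q))
      (z0Fun τ (specialState τ q)
        + 2 * n * (gammaE τ (specialState τ q) + gammaO τ (specialState τ q)))
      (xFun (wordImage τ (RJ1Pow n) (specialState τ q)))
      (yFun (wordImage τ (RJ1Pow n) (specialState τ q)))
      (xFun (wordImage τ (RJ1Pow (n + 1)) (specialState τ q)))
      (yFun (wordImage τ (RJ1Pow (n + 1)) (specialState τ q))) := by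
  have a1 := fun p => (analyticAt_special τ p).1
  have a2 := fun p => (analyticAt_special τ p).2.1
  have a3 := fun p => (analyticAt_special τ p).2.2
  have ez : z0Fun τ (specialState τ q0) = η + c5 + ellKappa τ := by rw [hq]; rfl
  have ee : gammaE τ (specialState τ q0) = c5 - η + ellKappa τ := by rw [hq]; rfl
  have eo : gammaO τ (specialState τ q0) = η + c1 + ellKappa τ := by rw [hq]; rfl
  have g1 := genAt_finite (p0 := q0) hτ (f := fun q => z0Fun τ (specialState τ q)
    + 2 * n * (gammaE τ (specialState τ q) + gammaO τ (specialState τ q)))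
    (fun p => by fun_prop) (by
      simp only [ez, ee, eo, ellKappa]
      -- The coefficient of `η` is `±1` in all four combinations, so none of them is trivial.
      convert hg (2 * n) (2 * n + 1) 1 0 (8 * n + 2) (4 * n + 1) (by simp) using 1
      push_cast
      ring)
  have g2 := genAt_finite (p0 := q0) hτ a2 (by
      simp only [ee, ellKappa]
      convert hg 0 1 (-1) 0 2 1 (by simp) using 1
      push_cast
      ring)
  have g3 := genAt_finite (p0 := q0) hτ a3 (by
      simp only [eo, ellKappa]
      convert hg 1 0 1 0 2 1 (by simp) using 1
      push_cast
      ring)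
  have g4 := genAt_finite (p0 := q0) hτ (f := fun q => z0Fun τ (specialState τ q)
    + 2 * n * (gammaE τ (specialState τ q) + gammaO τ (specialState τ q))
    + gammaE τ (specialState τ q) + gammaO τ (specialState τ q))
    (fun p => by fun_prop) (by
      simp only [ez, ee, eo, ellKappa]
      convert hg (2 * n + 1) (2 * n + 2) 1 0 (8 * n + 6) (4 * n + 3) (by simp) using 1
      push_cast
      ring)
  refine ((genAt_halfStepRegular hτ h n).and (g1.and (g2.and (g3.and g4)))).mono ?_
  rintro q ⟨hr, f1, f2, f3, f4⟩
  obtain ⟨e, c1', c5', η', x', y', i, j, l, he, hs, hz, hγe, hγo⟩ := exists_signedState τ q n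
  rw [RJ1Pow_succ, wordImage_append, hs]
  rw [hs] at hr
  exact rcgEquation_signedState hτ he hr hz hγe hγo f1 f2 f3 f4

end Orbit

end EllipticPainleve

/-! ### Assembly of the four assertions -/

theorem mainTheorem2 (τ : ℂ) (hτ : 0 < τ.im) :
    -- `R_J1` is not a translation: linear action, and action on the parameters
    ((∀ i, picAct RJ1 (simpleRoot i) = ∑ j, matrixRJ1 i j • simpleRoot j)
      ∧ ¬ IsRootTranslation RJ1
      ∧ (∀ (p : State) (i : Fin 8), i.val < 4 →
          act τ RJ1 (cFun i) p = -cFun i p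
            + ((p.1 0 + p.1 1 + p.1 2 + p.1 3) - (p.1 4 + p.1 5 + p.1 6 + p.1 7)) / 4
            - ellKappa τ)
      ∧ (∀ (p : State) (i : Fin 8), 4 ≤ i.val →
          act τ RJ1 (cFun i) p = -cFun i p
            + ((p.1 0 + p.1 1 + p.1 2 + p.1 3) + 3 * (p.1 4 + p.1 5 + p.1 6 + p.1 7)) / 4
            - ellKappa τ)
      ∧ (∀ p : State, act τ RJ1 etaFun p = etaFun p + lamFun p / 2)
      ∧ ¬ IsParamTranslation τ RJ1)
    -- the special parameters: translational motion (up to periods) and the reduced equation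
    ∧ ((∀ p : State, RCGCondition τ p →
          act τ RJ1 (gammaE τ) p = gammaE τ p
          ∧ act τ RJ1 (gammaO τ) p = gammaO τ p
          ∧ act τ RJ1 (z0Fun τ) p
              = z0Fun τ p + 2 * (gammaE τ p + gammaO τ p) - 2 * ellKappa τ
          ∧ act τ RJ1 (cFun 1) p = act τ RJ1 (cFun 0) p + 2 * ellK τ - 4 * ellK τ
          ∧ act τ RJ1 (cFun 2) p = act τ RJ1 (cFun 0) p + ellIK' τ - 2 * ellIK' τ
          ∧ act τ RJ1 (cFun 3) p = act τ RJ1 (cFun 0) p + ellKappa τ - 2 * ellKappa τ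
          ∧ act τ RJ1 (cFun 5) p = act τ RJ1 (cFun 4) p + 2 * ellK τ - 4 * ellK τ
          ∧ act τ RJ1 (cFun 6) p = act τ RJ1 (cFun 4) p + ellIK' τ - 2 * ellIK' τ
          ∧ act τ RJ1 (cFun 7) p = act τ RJ1 (cFun 4) p + ellKappa τ - 2 * ellKappa τ)
      ∧ (∀ n : ℕ, Generically fun q : ℂ × ℂ × ℂ × ℂ × ℂ =>
          WordRegular τ (RJ1Pow (n + 1)) (specialState τ q)
          ∧ RCGEquation τ (gammaE τ (specialState τ q)) (gammaO τ (specialState τ q))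
              (z0Fun τ (specialState τ q)
                + 2 * n * (gammaE τ (specialState τ q) + gammaO τ (specialState τ q)))
              (act τ (RJ1Pow n) xFun (specialState τ q))
              (act τ (RJ1Pow n) yFun (specialState τ q))
              (act τ (RJ1Pow (n + 1)) xFun (specialState τ q))
              (act τ (RJ1Pow (n + 1)) yFun (specialState τ q))))
    -- `T_J1 = R_J1²` is a translation, and acts as the 8-parameter elliptic Painlevé equation
    ∧ ((∀ i, picAct TJ1 (simpleRoot i)
          = simpleRoot i + (![0, -2, 0, 0, 0, 1, 0, 0, 0] : Fin 9 → ℤ) i • picDelta)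
      ∧ (∀ v, picAct TJ1 v
          = kacTranslation (2 • picH 0 - picE 4 - picE 5 - picE 6 - picE 7) v)
      ∧ (∀ (p : State) (i : Fin 8), i.val < 4 →
          act τ TJ1 (cFun i) p = cFun i p - lamFun p)
      ∧ (∀ (p : State) (i : Fin 8), 4 ≤ i.val →
          act τ TJ1 (cFun i) p = cFun i p + lamFun p - 4 * ellKappa τ)
      ∧ (∀ p : State, act τ TJ1 etaFun p = etaFun p + lamFun p - 2 * ellKappa τ)
      ∧ (∀ w : List Gen, ∀ p : State, (∀ g ∈ w, ∃ i, g = Gen.s i) →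
          act τ w lamFun p = lamFun p)
      ∧ Generically fun p : State =>
          WordRegular τ TJ1 p
          ∧ ∀ xt yt xb yb : ℂ, EllipticPainleveEquation τ p xt yt xb yb ↔
              xt = act τ RJ1 xFun p ∧ yt = act τ RJ1 yFun p
              ∧ xb = act τ TJ1 xFun p ∧ yb = act τ TJ1 yFun p)
    -- projective reduction: for the special parameters the 8-parameter equation is the composite
    -- of two successive steps of the reduced equation
    ∧ ((∀ p : State, RCGCondition τ p → RCGCondition τ
          (fun i => act τ TJ1 (cFun i) p,
            act τ TJ1 etaFun p, act τ TJ1 xFun p, act τ TJ1 yFun p))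
      ∧ Generically fun q : ℂ × ℂ × ℂ × ℂ × ℂ =>
          WordRegular τ TJ1 (specialState τ q)
          ∧ ∀ xt yt xb yb : ℂ, EllipticPainleveEquation τ (specialState τ q) xt yt xb yb ↔
              RCGEquation τ (gammaE τ (specialState τ q)) (gammaO τ (specialState τ q))
                (z0Fun τ (specialState τ q)) (xFun (specialState τ q)) (yFun (specialState τ q))
                xt yt
              ∧ RCGEquation τ (gammaE τ (specialState τ q)) (gammaO τ (specialState τ q))
                (z0Fun τ (specialState τ q)
                  + 2 * (gammaE τ (specialState τ q) + gammaO τ (specialState τ q)))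
                xt yt xb yb) := by
  simp only [act_eq]
  obtain ⟨c1, c5, η, u, hg, h⟩ := exists_halfStepRegular hτ
  -- The special base point also serves for genericity in the full space of parameters and
  -- coordinates, so no second one is required.
  have hmero := meroStateAt_id (specialState τ (c1, c5, η, cd τ (η + u), cd τ (η - u)))
  have hgen := (hmero.halfStepRegular hτ (h 0)).and
    ((hmero.wordImage_RJ1 hτ (h 0)).halfStepRegular hτ (h 1))
  have hgen' := ((genAt_halfStepRegular hτ h 0).and (genAt_halfStepRegular hτ h 1)).and
    ((genAt_rcgEquation hτ hg rfl h 0).and (genAt_rcgEquation hτ hg rfl h 1))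
  refine ⟨⟨picAct_RJ1_simpleRoot, not_isRootTranslation_RJ1, fun p i hi => ?_, fun p i hi => ?_,
    fun p => ?_, not_isParamTranslation_RJ1 τ⟩, ⟨fun p hp => ?_, fun n => ?_⟩,
    ⟨picAct_TJ1_simpleRoot, picAct_TJ1, fun p i hi => cFun_wordImage_TJ1_of_lt τ p hi,
      fun p i hi => cFun_wordImage_TJ1_of_le τ p hi, etaFun_wordImage_TJ1 τ,
      fun w p hw => lamFun_wordImage τ w p hw, ?_⟩, fun p hp => ?_, ?_⟩
  · rw [cFun_wordImage_RJ1, stepC_of_lt τ _ hi, cFun, sumA, sumB]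
  · rw [cFun_wordImage_RJ1, stepC_of_le τ _ hi, cFun, sumA, sumB]
  · rw [etaFun_wordImage_RJ1, stepEta, lamFun_eq]
    ring
  · obtain ⟨q, rfl⟩ := (rcgCondition_iff τ p).1 hp
    rw [specialState_eq, wordImage_RJ1_signedState]
    simp only [gammaE, gammaO, z0Fun, etaFun, cFun, signedState, ellKappa, Matrix.cons_val]
    refine ⟨?_, ?_, ?_, ?_, ?_, ?_, ?_, ?_, ?_⟩ <;> ring
  · exact ((genAt_wordRegular hτ h (n + 1)).and (genAt_rcgEquation hτ hg rfl h n)).generically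
  · exact (hgen.mono fun p hp => ⟨wordRegular_TJ1 hp.1 hp.2,
      ellipticPainleveEquation_iff hτ hp.1 hp.2⟩).generically
  · obtain ⟨q, rfl⟩ := (rcgCondition_iff τ p).1 hp
    have e : (fun i => cFun i (wordImage τ TJ1 (specialState τ q)),
        etaFun (wordImage τ TJ1 (specialState τ q)), xFun (wordImage τ TJ1 (specialState τ q)),
        yFun (wordImage τ TJ1 (specialState τ q))) = wordImage τ TJ1 (specialState τ q) := rfl
    rw [e, specialState_eq, wordImage_TJ1, wordImage_RJ1_signedState, wordImage_RJ1_signedState,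
      neg_neg]
    simp [RCGCondition, signedState, cFun]
  · refine (hgen'.mono fun q hq => ?_).generically
    obtain ⟨⟨h0, h1⟩, r0, r1⟩ := hq
    have e1 : RJ1Pow 1 = RJ1 := List.append_nil RJ1
    rw [e1] at h1
    change HalfStepRegular τ (specialState τ q) at h0
    rw [e1, show RJ1Pow (1 + 1) = TJ1 from rfl] at r1
    rw [show RJ1Pow (0 + 1) = RJ1 from e1, show wordImage τ (RJ1Pow 0) (specialState τ q)
      = specialState τ q from rfl] at r0
    refine ⟨wordRegular_TJ1 h0 h1, fun xt yt xb yb => ?_⟩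
    rw [ellipticPainleveEquation_iff hτ h0 h1]
    simp only [Nat.cast_zero, mul_zero, zero_mul, add_zero, Nat.cast_one, mul_one] at r0 r1
    constructor
    · rintro ⟨rfl, rfl, rfl, rfl⟩
      exact ⟨r0, r1⟩
    · rintro ⟨k0, k1⟩
      -- The reduced equation determines its output, so the iterates of `R`, which satisfy it, are
      -- its only solution.
      obtain ⟨rfl, rfl⟩ := (rcgEquation_iff r0 _ _).1 k0
      obtain ⟨rfl, rfl⟩ := (rcgEquation_iff r1 _ _).1 k1
      exact ⟨rfl, rfl, rfl, rfl⟩
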